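/- For a finite graph $G$ (possibly disconnected, distances between different components being $\infty$), a set $S\subseteq V(G)$ is resolving if for any two distinct vertices $u,v$ there is $w\in S$ with $d(w,u)\neq d(w,v)$. Metric Dimension asks, given $G$ and a positive integer $k$, whether $G$ has a resolving set of size at most $k$. Vertices $u,v$ are true twins if $N[u]=N[v]$ and false twins if $N(u)=N(v)$. A cluster graph is a disjoint union of cliques. A set $X\subseteq V(G)$ is a cluster modulator if $G-X$ is a cluster graph; the cliques of $G-X$ are then its connected components. Two cliques of $G-X$ are identical if the multisets $\{N(u)\cap X : u\in C\}$ agree; for an equivalence class $\mathcal C$ of identical cliques, $t(\mathcal C)$ denotes the number of pairs of true twins in each clique of $\mathcal C$ (it is used only when no three vertices are mutual twins). The distance to cluster (to clique) of $G$ is the least size of a set $X$ such that $G-X$ is a cluster graph (a clique). For a cluster modulator $X$ put $$B(X)=2^{2^{|X|+1}}\cdot\bigl(2^{|X|+2}+|X|+1\bigr)\cdot 2^{|X|+1}+|X| .$$ **Theorem.** (1) Twin rule. If $u,v,w$ are distinct vertices of $G$ that are mutual true twins or mutual false twins, then for every integer $k$, $G$ has a resolving set of size at most $k$ if and only if $G-u$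 has one of size at most $k-1$. (2) Clique rule. Let $X$ be a cluster modulator of $G$, suppose that $G$ has no three distinct mutual true twins and no three distinct mutual false twins, and let $C$ be a clique of $G-X$ whose equivalence class $\mathcal C$ has at least $2^{|X|+2}+|X|+2$ members. Then for every integer $k$, $G$ has a resolving set of size at most $k$ if and only if $G-C$ has one of size at most $k-\max\{1,t(\mathcal C)\}$. (3) If $X$ is a cluster modulator of $G$ and neither rule applies to $(G,X)$, then $|V(G)|\le B(X)$. (4) Kernel. There is a polynomial-time algorithm that maps every instance $(G,k)$ of Metric Dimension given with a cluster modulator $X$ to an equivalent instance $(G',k')$ with a cluster modulator $X'$ of $G'$ such that $|X'|\le|X|$, $|V(G')|\le B(X)$ and $k'\le B(X)$. Moreover, some sequence of applications of the two rules leads from $(G,k)$ to a pair $(G[A],j)$ to which neither rule applies (with modulator $X\cap A$), and if $j>0$ then $(G',X')$ is a copy of $(G[A],X\cap A)$ and $k'\le j$. (5) Metric Dimension is fixed-parameter tractable parameterized by the distance to cluster, and also parameterized by the distance to clique: in either case, with $\kappa(G)$ denoting the parameter, there are a computable function $f$, a constant $c$ and an algorithm that decides every instance $I=(G,k)$ in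 at most $f(\kappa(G))\cdot|I|^{c}$ steps. -/

import Mathlib

/-! ### Graphs: metric dimension, twins, cluster modulators -/

namespace MetricDim

variable {V : Type*}

/-- `S` is a resolving set: any two distinct vertices have different distances to some `w ∈ S`.
The distance is the extended one, so vertices in different components are at distance `⊤`. -/
def IsResolving (G : SimpleGraph V) (S : Finset V) : Prop :=
  ∀ u v : V, u ≠ v → ∃ w ∈ S, G.edist w u ≠ G.edist w v

/-- `G` has a resolving set of size at most `k`. The budget is an integer because
reduction rules may make it zero or negative. -/
def HasResolvingSet (G : SimpleGraph V) (k : ℤ) : Prop :=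
  ∃ S : Finset V, IsResolving G S ∧ (S.card : ℤ) ≤ k

/-- `N[u] = N[v]`. -/
def TrueTwins (G : SimpleGraph V) (u v : V) : Prop :=
  insert u (G.neighborSet u) = insert v (G.neighborSet v)

/-- `N(u) = N(v)`. -/
def FalseTwins (G : SimpleGraph V) (u v : V) : Prop :=
  G.neighborSet u = G.neighborSet v

/-- Three distinct vertices that are mutual true twins or mutual false twins. -/
def TripleTwins (G : SimpleGraph V) (u v w : V) : Prop :=
  u ≠ v ∧ u ≠ w ∧ v ≠ w ∧
    ((TrueTwins G u v ∧ TrueTwins G u w ∧ TrueTwins G v w) ∨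
      (FalseTwins G u v ∧ FalseTwins G u w ∧ FalseTwins G v w))

/-- A cluster graph is a disjoint union of cliques: each connected component is a clique. -/
def IsClusterGraph (H : SimpleGraph V) : Prop :=
  ∀ u v : V, H.Reachable u v → u ≠ v → H.Adj u v

/-- `G - X` is a cluster graph. -/
def IsClusterModulator (G : SimpleGraph V) (X : Finset V) : Prop :=
  IsClusterGraph (G.induce ((X : Set V)ᶜ))

/-- The distance to cluster of `G`. -/
noncomputable def distToCluster (G : SimpleGraph V) : ℕ :=
  sInf {m : ℕ | ∃ X : Finset V, IsClusterModulator G X ∧ X.card = m}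

/-- The distance to clique of `G`. -/
noncomputable def distToClique (G : SimpleGraph V) : ℕ :=
  sInf {m : ℕ | ∃ X : Finset V, G.IsClique ((X : Set V)ᶜ) ∧ X.card = m}

/-- `C` is (the vertex set of) one of the cliques of `G - X`, that is, a connected component of
`G - X` that is a clique. -/
def IsCliqueOf (G : SimpleGraph V) (X C : Finset V) : Prop :=
  C.Nonempty ∧ Disjoint C X ∧ G.IsClique (C : Set V) ∧
    ∀ u ∈ C, ∀ v, v ∉ X → G.Adj u v → v ∈ C

open Classical in
/-- The multiset `{N(u) ∩ X : u ∈ C}`. -/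
noncomputable def signature (G : SimpleGraph V) (X C : Finset V) : Multiset (Finset V) :=
  C.val.map fun u => X.filter fun x => G.Adj u x

/-- The equivalence class of `C`: the cliques of `G - X` with the same signature as `C`. -/
def cliqueClass (G : SimpleGraph V) (X C : Finset V) : Set (Finset V) :=
  {D | IsCliqueOf G X D ∧ signature G X D = signature G X C}

open Classical in
/-- The number of pairs of true twins in `C`. -/
noncomputable def twinPairs (G : SimpleGraph V) (C : Finset V) : ℕ :=
  ((C.powersetCard 2).filter fun p => ∀ u ∈ p, ∀ v ∈ p, TrueTwins G u v).card

/-- The twin rule applies to `G` and removes `u`. -/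
def TwinRule (G : SimpleGraph V) (u : V) : Prop :=
  ∃ v w : V, TripleTwins G u v w

/-- The clique rule applies to `(G, X)` and removes `C`: the twin rule has been applied
exhaustively, and `C` is a clique of `G - X` in a large equivalence class. -/
def CliqueRule (G : SimpleGraph V) (X C : Finset V) : Prop :=
  (∀ u : V, ¬ TwinRule G u) ∧ IsCliqueOf G X C ∧
    2 ^ (X.card + 2) + X.card + 2 ≤ (cliqueClass G X C).ncard

/-- Neither of the two rules applies to `(G, X)`. -/
def IsReduced (G : SimpleGraph V) (X : Finset V) : Prop :=
  (∀ u : V, ¬ TwinRule G u) ∧ ∀ C : Finset V, ¬ CliqueRule G X C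

open Classical in
/-- The part of `X` inside `A`, as a set of vertices of the induced subgraph `G[A]`. -/
noncomputable def restrict (X : Finset V) (A : Set V) : Finset A :=
  X.subtype fun x => x ∈ A

/-- One application of one of the two rules, inside a fixed graph `G`: the pair `(A, j)` stands
for the current graph `G[A]` (with modulator `X ∩ A`) and the current budget `j`. -/
inductive Step (G : SimpleGraph V) (X : Finset V) : Set V × ℤ → Set V × ℤ → Prop
  | twin (A : Set V) (j : ℤ) (u : A) :
      TwinRule (G.induce A) u → Step G X (A, j) (A \ {u.val}, j - 1)
  | clique (A : Set V) (j : ℤ) (C : Finset A) :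
      CliqueRule (G.induce A) (restrict X A) C →
        Step G X (A, j)
          (A \ Subtype.val '' (C : Set A), j - max 1 (twinPairs (G.induce A) C : ℤ))

end MetricDim

/-! ### A random access machine with a step count -/

namespace RAM

/-- The memory: finitely many (those named in the program) unbounded arrays of natural numbers;
`σ a i` is cell `i` of array `a`. -/
abbrev Memory : Type := ℕ → ℕ → ℕ

/-- Expressions: constants, indirect reads, addition and truncated subtraction. There is no
multiplication, so unit cost is polynomially related to Turing machine time. -/
inductive Expr : Type
  | const (c : ℕ)
  | read (a : ℕ) (i : Expr)
  | add (e₁ e₂ : Expr)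
  | sub (e₁ e₂ : Expr)

/-- The value of an expression. -/
def Expr.eval (σ : Memory) : Expr → ℕ
  | .const c => c
  | .read a i => σ a (i.eval σ)
  | .add e₁ e₂ => e₁.eval σ + e₂.eval σ
  | .sub e₁ e₂ => e₁.eval σ - e₂.eval σ

/-- The number of operations needed to evaluate an expression. -/
def Expr.cost : Expr → ℕ
  | .const _ => 1
  | .read _ i => i.cost + 1
  | .add e₁ e₂ => e₁.cost + e₂.cost + 1
  | .sub e₁ e₂ => e₁.cost + e₂.cost + 1

/-- Programs: `write a i e` stores the value of `e` in cell `i` of array `a`; `ite e p q` runs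
`p` if `e` is nonzero and `q` otherwise; `loop e p` repeats `p` while `e` is nonzero. -/
inductive Prog : Type
  | skip
  | write (a : ℕ) (i e : Expr)
  | seq (p q : Prog)
  | ite (e : Expr) (p q : Prog)
  | loop (e : Expr) (p : Prog)

/-- `Run p σ τ t`: started on memory `σ`, the program `p` halts with memory `τ` after exactly
`t` steps. -/
inductive Run : Prog → Memory → Memory → ℕ → Prop
  | skip (σ : Memory) : Run .skip σ σ 1
  | write (σ : Memory) (a : ℕ) (i e : Expr) :
      Run (.write a i e) σ
        (Function.update σ a (Function.update (σ a) (i.eval σ) (e.eval σ)))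
        (i.cost + e.cost + 1)
  | seq {p q : Prog} {σ τ ρ : Memory} {s t : ℕ} :
      Run p σ τ s → Run q τ ρ t → Run (.seq p q) σ ρ (s + t)
  | ite_true {e : Expr} {p q : Prog} {σ τ : Memory} {t : ℕ} :
      e.eval σ ≠ 0 → Run p σ τ t → Run (.ite e p q) σ τ (e.cost + 1 + t)
  | ite_false {e : Expr} {p q : Prog} {σ τ : Memory} {t : ℕ} :
      e.eval σ = 0 → Run q σ τ t → Run (.ite e p q) σ τ (e.cost + 1 + t)
  | loop_exit {e : Expr} {p : Prog} {σ : Memory} :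
      e.eval σ = 0 → Run (.loop e p) σ σ (e.cost + 1)
  | loop_next {e : Expr} {p : Prog} {σ τ ρ : Memory} {s t : ℕ} :
      e.eval σ ≠ 0 → Run p σ τ s → Run (.loop e p) τ ρ t →
        Run (.loop e p) σ ρ (e.cost + 1 + s + t)

end RAM

/-! ### The problem, its encoding, and fixed-parameter tractability -/

namespace MetricDim

/-- An instance of Metric Dimension: a finite graph and a positive integer. -/
structure Instance : Type where
  n : ℕ
  graph : SimpleGraph (Fin n)
  k : ℕ
  k_pos : 0 < k

/-- The instance is a yes-instance: there is a resolving set of size at most `k`. -/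
def Instance.IsYes (I : Instance) : Prop :=
  HasResolvingSet I.graph (I.k : ℤ)

/-- The length of a binary encoding: the adjacency matrix and the numbers `n` and `k`. -/
def Instance.size (I : Instance) : ℕ :=
  I.n ^ 2 + Nat.size I.n + Nat.size I.k

open Classical in
/-- The input memory for an instance with a vertex set `X`: array `0` holds `n`, array `1`
holds `k`, array `2` holds the adjacency matrix row by row, array `3` holds the indicator
function of `X`, and all other cells are zero. With `X = ∅` this encodes the bare instance. -/
noncomputable def encode (I : Instance) (X : Finset (Fin I.n)) : RAM.Memory := fun a i =>
  if a = 0 ∧ i = 0 then I.n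
  else if a = 1 ∧ i = 0 then I.k
  else if a = 2 ∧ ∃ u v : Fin I.n, I.graph.Adj u v ∧ i = u.val * I.n + v.val then 1
  else if a = 3 ∧ ∃ u ∈ X, i = u.val then 1
  else 0

open Classical in
/-- The output memory `σ` contains the instance `I` with the vertex set `X`, in the same layout;
cells outside the layout are ignored. -/
def Contains (σ : RAM.Memory) (I : Instance) (X : Finset (Fin I.n)) : Prop :=
  σ 0 0 = I.n ∧ σ 1 0 = I.k ∧
    (∀ u v : Fin I.n, σ 2 (u.val * I.n + v.val) = if I.graph.Adj u v then 1 else 0) ∧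
    ∀ u : Fin I.n, σ 3 u.val = if u ∈ X then 1 else 0

open Classical in
/-- Metric Dimension is fixed-parameter tractable for the parameter `κ`: one program decides every
instance `I` (its answer, `1` or `0`, is left in the first cell of array `0`) in at most
`f (κ I) * |I| ^ c` steps, with `f` computable. -/
def IsFPT (κ : Instance → ℕ) : Prop :=
  ∃ (p : RAM.Prog) (f : ℕ → ℕ) (c : ℕ), Computable f ∧
    ∀ I : Instance, ∃ (σ : RAM.Memory) (t : ℕ),
      RAM.Run p (encode I ∅) σ t ∧ t ≤ f (κ I) * I.size ^ c ∧
        σ 0 0 = if I.IsYes then 1 else 0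

/-- Metric Dimension, given together with a cluster modulator `X`, has a kernel with at most
`g |X|` vertices, obtained by applying the two rules exhaustively: one polynomial-time program
turns every `(G, k, X)` into an equivalent `(G', k', X')`, with `X'` a cluster modulator of `G'`
and `|X'| ≤ |X|`, such that `G'` has at most `g |X|` vertices and `k'` is at most `g |X|` as well.
Here some sequence of rule applications leads from `(G, k)` to a reduced `(G[A], j)`, and if
`j` is positive then `(G', X')` is a copy of `(G[A], X ∩ A)` and `k' ≤ j`. (If `j ≤ 0`, the output
may be any no-instance of the required size.) -/
def HasKernel (g : ℕ → ℕ) : Prop :=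
  ∃ (p : RAM.Prog) (c : ℕ), ∀ (I : Instance) (X : Finset (Fin I.n)),
    IsClusterModulator I.graph X →
      ∃ (σ : RAM.Memory) (t : ℕ) (I' : Instance) (X' : Finset (Fin I'.n)),
        RAM.Run p (encode I X) σ t ∧ t ≤ c * I.size ^ c ∧ Contains σ I' X' ∧
          (I.IsYes ↔ I'.IsYes) ∧ IsClusterModulator I'.graph X' ∧ X'.card ≤ X.card ∧
          I'.n ≤ g X.card ∧ I'.k ≤ g X.card ∧
          ∃ (A : Set (Fin I.n)) (j : ℤ),
            Relation.ReflTransGen (Step I.graph X) (Set.univ, (I.k : ℤ)) (A, j) ∧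
              IsReduced (I.graph.induce A) (restrict X A) ∧
              (0 < j → (I'.k : ℤ) ≤ j ∧
                ∃ φ : I'.graph ≃g I.graph.induce A, ∀ i, i ∈ X' ↔ (φ i).val ∈ X)

end MetricDim

namespace MetricDim

/-! ### Distances under maps of graphs -/

/-! The engine of both reduction rules is symmetry. Two twins are exchanged by an automorphism, and
two identical cliques $D$, $E$ of $G-X$ are exchanged by an automorphism that fixes every other
vertex (`exists_swap`). Hence twins are distinguished only by themselves, and two identical cliques
cannot both be missed by a resolving set. Moreover $G$ retracts onto $G-u$ and onto $G-C$, by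
sending the deleted part to its copy, so deletion changes no distance between surviving vertices.

Twin rule: a resolving set contains at least two of $u,v,w$; after a swap it contains $u$ and
another of them, and that one can do everything that $u$ does for the pairs outside $u$.

Clique rule, from $G$ to $G-C$: if the class is large, then some member $D$ meets the resolving set
$S$ and each type (neighbourhood in $X$) of the vertices in $S\cap D$ also occurs in $S$ inside at
least three other members (`exists_removable_clique`). For a pair outside $D$ one of these members
avoids the pair, and a swap shows that its vertex of $S$ replaces the one in $D$. So $S\setminus D$
suffices outside $D$, and $D$ can be moved to $C$. The saving is at least $\max\{1,t\}$, because
without three mutual twins the twin pairs in $D$ are disjoint and $S$ hits each of them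
(`exists_hitting_set`).

From $G-C$ to $G$: if some other member contains exactly $\max\{1,t\}$ vertices of $S$, these are
copied into $C$ (`exists_resolving_of_card_inter_eq`). Otherwise all members met by $S$ have a
vertex to spare; $|X|$ spare vertices, one from each of $|X|$ members, pay for adding all of $X$,
and a hitting set of the twin pairs is added in $C$ (`exists_resolving_of_lt_card_inter`). With $X$
in the set, vertices of one clique are separated by their types or are twins, and vertices of
different cliques are separated by a chosen vertex in one of the two cliques or, if there is none,
by the point of $X$ through which a shortest path enters.

Size bound: in a reduced graph a clique has at most two vertices of each of the $2^{|X|}$ types,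
which bounds the size of a clique and the number of classes, while the clique rule bounds each
class.

The algorithms are written in a small language of bounded sums and bounded loops, whose semantics is
a total function on memories. `Tm.run` and `St.run` compile it to the random access machine with a
running time polynomial in the loop bounds, so that only total functions have to be verified. The
kernel applies a rule in each of $n$ rounds. If the budget is used up, then at least one rule was
applied, so at least two vertices remain and the instance is negative; a triangle with budget 1 is
output. For fixed-parameter tractability a modulator of at most three times the least size comes
from greedily marking disjoint induced paths on three vertices; the kernel for it is solved by
trying all vertex sets. The distance to clique is at least the distance to cluster, so the same
algorithm serves both parameters. -/

theorem edist_map_le {V W : Type*} {G : SimpleGraph V} {H : SimpleGraph W} (f : V → W)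
    (hf : ∀ a b, G.Adj a b → f a = f b ∨ H.Adj (f a) (f b)) (a b : V) :
    H.edist (f a) (f b) ≤ G.edist a b := by
  by_cases h : G.edist a b = ⊤
  · rw [h]; exact le_top
  obtain ⟨p, hp⟩ := SimpleGraph.exists_walk_of_edist_ne_top h
  rw [← hp]
  clear hp h
  induction p with
  | nil => simp
  -- Each edge is collapsed or sent to an edge, so the image of a walk is no longer than the walk.
  | @cons u v w huv p ih =>
    refine (SimpleGraph.edist_triangle (v := f v)).trans ?_
    rw [SimpleGraph.Walk.length_cons, Nat.cast_add, add_comm]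
    refine add_le_add ih ?_
    rw [Nat.cast_one, SimpleGraph.edist_le_one_iff_adj_or_eq]
    exact (hf _ _ huv).symm

theorem edist_iso {V W : Type*} {G : SimpleGraph V} {H : SimpleGraph W} (φ : G ≃g H) (a b : V) :
    H.edist (φ a) (φ b) = G.edist a b := by
  refine le_antisymm (edist_map_le φ (fun a b h => Or.inr (φ.map_adj_iff.2 h)) a b) ?_
  have := edist_map_le φ.symm (fun a b h => Or.inr (φ.symm.map_adj_iff.2 h)) (φ a) (φ b)
  simpa using this

/-- Distances do not change in an induced subgraph onto which the graph retracts. -/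
theorem edist_induce_of_retraction {V : Type*} {G : SimpleGraph V} {A : Set V} (f : V → V)
    (hA : ∀ a, f a ∈ A) (hf : ∀ a b, G.Adj a b → f a = f b ∨ G.Adj (f a) (f b))
    (hid : ∀ a ∈ A, f a = a) (a b : A) : (G.induce A).edist a b = G.edist a b := by
  refine le_antisymm ?_ ?_
  · have := edist_map_le (G := G) (H := G.induce A) (fun x => ⟨f x, hA x⟩)
      (fun x y h => by simpa [Subtype.ext_iff] using hf x y h) a b
    simpa [hid] using this
  · exact edist_map_le (G := G.induce A) (H := G) Subtype.val
      (fun x y h => Or.inr (by simpa using h)) a b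

theorem IsResolving.map {V W : Type*} {G : SimpleGraph V} {H : SimpleGraph W} (φ : G ≃g H)
    {S : Finset V} (hS : IsResolving G S) : IsResolving H (S.map φ.toEquiv.toEmbedding) := by
  intro u v huv
  obtain ⟨w, hw, hne⟩ := hS (φ.symm u) (φ.symm v) (by simpa using huv)
  refine ⟨φ w, Finset.mem_map_of_mem _ hw, ?_⟩
  rw [← edist_iso φ, ← edist_iso φ] at hne
  simpa using hne

theorem HasResolvingSet.iso {V W : Type*} {G : SimpleGraph V} {H : SimpleGraph W} (φ : G ≃g H)
    {k : ℤ} (h : HasResolvingSet G k) : HasResolvingSet H k := by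
  obtain ⟨S, hS, hk⟩ := h
  exact ⟨_, hS.map φ, by simpa using hk⟩

theorem hasResolvingSet_iso {V W : Type*} {G : SimpleGraph V} {H : SimpleGraph W} (φ : G ≃g H)
    {k : ℤ} : HasResolvingSet G k ↔ HasResolvingSet H k :=
  ⟨fun h => h.iso φ, fun h => h.iso φ.symm⟩

/-- The subgraph induced by a set inside an induced subgraph. -/
noncomputable def induceInduceIso {V : Type*} (G : SimpleGraph V) (A : Set V) (B : Set A) :
    (G.induce A).induce B ≃g G.induce (Subtype.val '' B) where
  toEquiv := Equiv.Set.image _ B Subtype.val_injective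
  map_rel_iff' := by simp

/-- A set of vertices of `G` outside `Aᶜ` as a set of vertices of `G[A]`, resolving by the same
distances. -/
theorem isResolving_induce_iff {V : Type*} {G : SimpleGraph V} {A : Set V} {S : Finset V}
    (hSA : ∀ s ∈ S, s ∈ A) (hd : ∀ a b : A, (G.induce A).edist a b = G.edist a b) :
    (∃ T : Finset A, IsResolving (G.induce A) T ∧ T.card = S.card ∧ ∀ a, a ∈ T ↔ a.val ∈ S) ↔
      ∀ a ∈ A, ∀ b ∈ A, a ≠ b → ∃ s ∈ S, G.edist s a ≠ G.edist s b := by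
  classical
  constructor
  · rintro ⟨T, hT, -, hTS⟩ a ha b hb hab
    obtain ⟨w, hw, h⟩ := hT ⟨a, ha⟩ ⟨b, hb⟩ (by simpa using hab)
    rw [hd, hd] at h
    exact ⟨w, (hTS _).1 hw, h⟩
  · intro h
    refine ⟨S.subtype (· ∈ A), ?_, ?_, by simp⟩
    · intro a b hab
      obtain ⟨s, hs, h⟩ := h a a.2 b b.2 (by simpa [Subtype.ext_iff] using hab)
      refine ⟨⟨s, hSA s hs⟩, by simpa using hs, ?_⟩
      rwa [hd, hd]
    · rw [Finset.card_subtype, Finset.filter_true_of_mem hSA]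

/-- When deletion preserves distances, resolving sets of $G[A]$ can be discussed inside $G$, without
passing to the subtype. Both rules are proved in this form. -/
theorem hasResolvingSet_induce {V : Type*} {G : SimpleGraph V} {A : Set V} {k : ℤ}
    (hd : ∀ a b : A, (G.induce A).edist a b = G.edist a b) :
    HasResolvingSet (G.induce A) k ↔ ∃ S : Finset V, (∀ s ∈ S, s ∈ A) ∧
      (∀ a ∈ A, ∀ b ∈ A, a ≠ b → ∃ s ∈ S, G.edist s a ≠ G.edist s b) ∧ (S.card : ℤ) ≤ k := by
  constructor
  · rintro ⟨T, hT, hk⟩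
    refine ⟨T.map (Function.Embedding.subtype _), by simp +contextual, ?_, by simpa using hk⟩
    refine (isResolving_induce_iff (by simp +contextual) hd).1 ⟨T, hT, by simp, by simp⟩
  · rintro ⟨S, hSA, hS, hk⟩
    obtain ⟨T, hT, hc, -⟩ := (isResolving_induce_iff hSA hd).2 hS
    exact ⟨T, hT, by rwa [hc]⟩

/-! ### Twins -/

/-- `u` and `v` have the same neighbours apart from themselves. -/
def Twins {V : Type*} (G : SimpleGraph V) (u v : V) : Prop :=
  ∀ w, w ≠ u → w ≠ v → (G.Adj u w ↔ G.Adj v w)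

theorem TrueTwins.twins {V : Type*} {G : SimpleGraph V} {u v : V} (h : TrueTwins G u v) :
    Twins G u v := fun w hu hv => by
  have := Set.ext_iff.1 h w
  simpa [hu, hv] using this

theorem FalseTwins.twins {V : Type*} {G : SimpleGraph V} {u v : V} (h : FalseTwins G u v) :
    Twins G u v := fun w _ _ => by
  have := Set.ext_iff.1 h w
  simpa using this

theorem TripleTwins.twins {V : Type*} {G : SimpleGraph V} {u v w : V} (h : TripleTwins G u v w) :
    Twins G u v ∧ Twins G u w ∧ Twins G v w := by
  obtain ⟨-, -, -, ⟨h1, h2, h3⟩ | ⟨h1, h2, h3⟩⟩ := h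
  exacts [⟨h1.twins, h2.twins, h3.twins⟩, ⟨h1.twins, h2.twins, h3.twins⟩]

theorem edist_self_ne {V : Type*} {G : SimpleGraph V} {a b : V} (h : a ≠ b) :
    G.edist a a ≠ G.edist a b := by
  rw [SimpleGraph.edist_self]
  exact (SimpleGraph.edist_pos_of_ne h).ne

open Classical in
/-- Exchanging two twins is an automorphism. -/
noncomputable def Twins.swapIso {V : Type*} {G : SimpleGraph V} {u v : V} (h : Twins G u v) :
    G ≃g G where
  toEquiv := Equiv.swap u v
  map_rel_iff' := by
    intro a b
    simp only [Equiv.swap_apply_def]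
    by_cases hau : a = u <;> by_cases hav : a = v <;> by_cases hbu : b = u <;>
      by_cases hbv : b = v <;> simp_all [Twins, SimpleGraph.adj_comm]

open Classical in
theorem Twins.edist_eq {V : Type*} {G : SimpleGraph V} {u v a : V} (h : Twins G u v)
    (hu : a ≠ u) (hv : a ≠ v) : G.edist u a = G.edist v a := by
  have := edist_iso h.swapIso u a
  rw [← this]
  change G.edist (Equiv.swap u v u) (Equiv.swap u v a) = G.edist v a
  rw [Equiv.swap_apply_left, Equiv.swap_apply_of_ne_of_ne hu hv]

/-- The swap of $u$ and $v$ fixes every third vertex, which is therefore equally far from both. -/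
theorem Twins.mem_or_mem {V : Type*} {G : SimpleGraph V} {u v : V} (h : Twins G u v)
    {S : Finset V} (hS : ∃ s ∈ S, G.edist s u ≠ G.edist s v) : u ∈ S ∨ v ∈ S := by
  obtain ⟨s, hs, hne⟩ := hS
  by_contra! hc
  refine hne ?_
  rw [SimpleGraph.edist_comm, h.edist_eq (by grind) (by grind), SimpleGraph.edist_comm]

/-- Sending $u$ to its twin and fixing the rest retracts $G$ onto $G-u$. -/
theorem Twins.edist_induce {V : Type*} {G : SimpleGraph V} {u v : V} (h : Twins G u v)
    (huv : u ≠ v) (a b : ({u}ᶜ : Set V)) :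
    (G.induce ({u}ᶜ : Set V)).edist a b = G.edist a b := by
  classical
  refine edist_induce_of_retraction (fun x => if x = u then v else x) ?_ ?_ ?_ a b
  · intro x; by_cases hx : x = u <;> simp [hx, huv.symm]
  · intro x y hxy
    by_cases hx : x = u <;> by_cases hy : y = u <;> simp [hx, hy]
    · by_cases hv : v = y
      · exact Or.inl hv
      · exact Or.inr ((h y hy (Ne.symm hv)).1 (hx ▸ hxy))
    · by_cases hv : x = v
      · exact Or.inl hv
      · exact Or.inr ((h x hx hv).1 (hy ▸ hxy.symm)).symm
    · exact Or.inr hxy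
  · intro x hx; simp at hx; simp [hx]

theorem twinRule_safe {V : Type*} (G : SimpleGraph V) (k : ℤ) (u : V)
    (hu : TwinRule G u) :
    HasResolvingSet G k ↔ HasResolvingSet (G.induce ({u}ᶜ : Set V)) (k - 1) := by
  classical
  obtain ⟨v, w, ht⟩ := hu
  obtain ⟨huv, huw, hvw, -⟩ := id ht
  obtain ⟨tuv, tuw, tvw⟩ := ht.twins
  rw [hasResolvingSet_induce (tuv.edist_induce huv)]
  constructor
  · rintro ⟨S, hS, hk⟩
    -- Each of the three pairs is hit, so at most one of the three vertices is missing. If it is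
    -- $u$, then $v,w\in S$, and swapping $u$ with $v$ yields a set with $u$ and $w$.
    have key : ∃ T : Finset V, IsResolving G T ∧ T.card = S.card ∧ u ∈ T ∧ (v ∈ T ∨ w ∈ T) := by
      have h1 := tuv.mem_or_mem (hS u v huv)
      have h2 := tuw.mem_or_mem (hS u w huw)
      have h3 := tvw.mem_or_mem (hS v w hvw)
      by_cases hu : u ∈ S
      · exact ⟨S, hS, rfl, hu, h3⟩
      · refine ⟨_, hS.map tuv.swapIso, by simp, ?_, Or.inr ?_⟩
        · rw [Finset.mem_map]
          exact ⟨v, by tauto, by simp [Twins.swapIso]⟩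
        · rw [Finset.mem_map]
          exact ⟨w, by tauto, by simp [Twins.swapIso, Equiv.swap_apply_of_ne_of_ne huw.symm hvw.symm]⟩
    obtain ⟨T, hT, hc, huT, hvT⟩ := key
    obtain ⟨z, hzT, hzu, tz⟩ : ∃ z ∈ T, z ≠ u ∧ Twins G u z := by
      rcases hvT with h | h
      · exact ⟨v, h, huv.symm, tuv⟩
      · exact ⟨w, h, huw.symm, tuw⟩
    -- The twin $z$ takes over from $u$: it has the same distances as $u$ to all third vertices, and
    -- it resolves every pair that contains $z$ itself.
    refine ⟨T.erase u, by simp +contextual, ?_, ?_⟩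
    · intro a ha b hb hab
      simp only [Set.mem_compl_iff, Set.mem_singleton_iff] at ha hb
      obtain ⟨s, hs, hne⟩ := hT a b hab
      by_cases hsu : s = u
      · subst hsu
        by_cases haz : a = z
        · exact ⟨z, by simp [hzu, hzT], by subst haz; exact edist_self_ne hab⟩
        by_cases hbz : b = z
        · exact ⟨z, by simp [hzu, hzT], by subst hbz; exact (edist_self_ne hab.symm).symm⟩
        refine ⟨z, by simp [hzu, hzT], ?_⟩
        rwa [← tz.edist_eq ha haz, ← tz.edist_eq hb hbz]
      · exact ⟨s, by simp [hsu, hs], hne⟩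
    · rw [Finset.card_erase_of_mem huT]
      have := Finset.card_pos.2 ⟨u, huT⟩
      omega
  · rintro ⟨S, hSA, hS, hk⟩
    refine ⟨insert u S, ?_, ?_⟩
    · intro a b hab
      by_cases ha : a = u
      · exact ⟨u, by simp, by subst ha; exact edist_self_ne hab⟩
      by_cases hb : b = u
      · exact ⟨u, by simp, by subst hb; exact (edist_self_ne hab.symm).symm⟩
      obtain ⟨s, hs, h⟩ := hS a ha b hb hab
      exact ⟨s, by simp [hs], h⟩
    · have := Finset.card_insert_le u S
      omega

end MetricDim

namespace MetricDim

/-! ### Cliques of `G - X` -/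

open Classical in
/-- The neighbours of `u` in `X`. -/
noncomputable def nbhdIn {V : Type*} (G : SimpleGraph V) (X : Finset V) (u : V) : Finset V :=
  X.filter fun x => G.Adj u x

theorem mem_nbhdIn {V : Type*} {G : SimpleGraph V} {X : Finset V} {u x : V} :
    x ∈ nbhdIn G X u ↔ x ∈ X ∧ G.Adj u x := by simp [nbhdIn]

theorem nbhdIn_eq_iff {V : Type*} {G : SimpleGraph V} {X : Finset V} {u v : V} :
    nbhdIn G X u = nbhdIn G X v ↔ ∀ x ∈ X, G.Adj u x ↔ G.Adj v x := by
  simp [Finset.ext_iff, mem_nbhdIn]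

theorem signature_eq_map {V : Type*} (G : SimpleGraph V) (X C : Finset V) :
    signature G X C = C.val.map (nbhdIn G X) := rfl

namespace IsCliqueOf

variable {V : Type*} {G : SimpleGraph V} {X C D : Finset V} {u v : V}

theorem notMem (hC : IsCliqueOf G X C) (hu : u ∈ C) : u ∉ X :=
  Finset.disjoint_left.1 hC.2.1 hu

theorem adj (hC : IsCliqueOf G X C) (hu : u ∈ C) (hv : v ∈ C) (huv : u ≠ v) : G.Adj u v :=
  hC.2.2.1 hu hv huv

theorem mem_of_adj (hC : IsCliqueOf G X C) (hu : u ∈ C) (hv : v ∉ X) (h : G.Adj u v) : v ∈ C :=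
  hC.2.2.2 u hu v hv h

theorem eq_of_mem (hC : IsCliqueOf G X C) (hD : IsCliqueOf G X D) (hu : u ∈ C) (hu' : u ∈ D) :
    C = D := by
  ext v
  by_cases huv : u = v
  · subst huv; tauto
  · exact ⟨fun h => hD.mem_of_adj hu' (hC.notMem h) (hC.adj hu h huv),
      fun h => hC.mem_of_adj hu (hD.notMem h) (hD.adj hu' h huv)⟩

theorem edist_le_one (hC : IsCliqueOf G X C) (hu : u ∈ C) (hv : v ∈ C) : G.edist u v ≤ 1 := by
  rw [SimpleGraph.edist_le_one_iff_adj_or_eq]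
  by_cases huv : u = v
  · exact Or.inr huv
  · exact Or.inl (hC.adj hu hv huv)

theorem one_lt_edist (hC : IsCliqueOf G X C) (hu : u ∈ C) (hv : v ∉ C) (hvX : v ∉ X) :
    1 < G.edist u v := by
  rw [← not_le, SimpleGraph.edist_le_one_iff_adj_or_eq]
  rintro (h | rfl)
  · exact hv (hC.mem_of_adj hu hvX h)
  · exact hv hu

/-- Outside $X$ all vertices of $C$ have the same closed neighbourhood, namely $C$; only the
neighbours in $X$ can differ. -/
theorem trueTwins_iff (hC : IsCliqueOf G X C) (hu : u ∈ C) (hv : v ∈ C) :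
    TrueTwins G u v ↔ nbhdIn G X u = nbhdIn G X v := by
  rw [nbhdIn_eq_iff]
  by_cases huv : u = v
  · subst huv; simp [TrueTwins]
  constructor
  · intro h x hx
    have h := Set.ext_iff.1 h x
    have h1 : x ≠ u := fun e => hC.notMem hu (e ▸ hx)
    have h2 : x ≠ v := fun e => hC.notMem hv (e ▸ hx)
    simpa [h1, h2] using h
  · intro h
    ext w
    have hadj := hC.adj hu hv huv
    by_cases hw : w ∈ X
    · have h1 : w ≠ u := fun e => hC.notMem hu (e ▸ hw)
      have h2 : w ≠ v := fun e => hC.notMem hv (e ▸ hw)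
      simp [h1, h2, h w hw]
    · have key : ∀ z ∈ C, w ∈ insert z (G.neighborSet z) ↔ w ∈ C := by
        intro z hz
        simp only [Set.mem_insert_iff, SimpleGraph.mem_neighborSet]
        constructor
        · rintro (rfl | h)
          · exact hz
          · exact hC.mem_of_adj hz hw h
        · intro hwC
          by_cases hwz : w = z
          · exact Or.inl hwz
          · exact Or.inr (hC.adj hz hwC (Ne.symm hwz))
      rw [key u hu, key v hv]

/-- Shortest paths that enter a clique of `G - X` pass through `X`. -/
theorem exists_mem_edist_add_le (hC : IsCliqueOf G X C) {s a : V} (ha : a ∈ C) (hs : s ∉ C) :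
    ∀ p : G.Walk s a, ∃ y ∈ X, G.edist s y + G.edist y a ≤ p.length := by
  intro p
  induction p with
  | nil => exact absurd ha hs
  | @cons s v a hsv p ih =>
    rw [SimpleGraph.Walk.length_cons]
    by_cases hv : v ∈ C
    · refine ⟨s, ?_, ?_⟩
      · by_contra hsX
        exact hs (hC.mem_of_adj hv hsX hsv.symm)
      · rw [SimpleGraph.edist_self, zero_add]
        exact SimpleGraph.edist_le (.cons hsv p)
    · obtain ⟨y, hy, hle⟩ := ih ha hv
      refine ⟨y, hy, ?_⟩
      push_cast
      have h1 : G.edist s y ≤ 1 + G.edist v y := by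
        refine (SimpleGraph.edist_triangle (v := v)).trans ?_
        gcongr
        rw [SimpleGraph.edist_le_one_iff_adj_or_eq]; exact Or.inl hsv
      calc _ ≤ 1 + G.edist v y + G.edist y a := by gcongr
        _ = (G.edist v y + G.edist y a) + 1 := by ring
        _ ≤ _ := by gcongr

/-- Take the nearer of $a,b$, say $a$. A shortest path from $s$ to $a$ meets $X$ in some $y$ that
splits its length; if $y$ were equally far from $a$ and $b$, then $s$ would be as near to $b$ as to
$a$. This lets $X$ replace every vertex outside the two cliques. -/
theorem exists_mem_edist_ne (hC : IsCliqueOf G X C) (hD : IsCliqueOf G X D) {s a b : V}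
    (ha : a ∈ C) (hb : b ∈ D) (hsC : s ∉ C) (hsD : s ∉ D) (h : G.edist s a ≠ G.edist s b) :
    ∃ y ∈ X, G.edist y a ≠ G.edist y b := by
  wlog hlt : G.edist s a < G.edist s b generalizing a b C D
  · obtain ⟨y, hy, h'⟩ := this hD hC hb ha hsD hsC h.symm
      (lt_of_le_of_ne (not_lt.1 hlt) h.symm)
    exact ⟨y, hy, h'.symm⟩
  obtain ⟨p, hp⟩ := SimpleGraph.exists_walk_of_edist_ne_top (ne_top_of_lt hlt)
  obtain ⟨y, hy, hle⟩ := hC.exists_mem_edist_add_le ha hsC p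
  refine ⟨y, hy, fun he => ?_⟩
  rw [hp, he] at hle
  exact absurd (SimpleGraph.edist_triangle.trans hle) (not_le.2 hlt)

end IsCliqueOf

/-! ### Exchanging identical cliques -/

/-- Equal multisets of types give equally many vertices of each type, hence a bijection type by
type. The prescribed value at $s$ is what later moves a chosen vertex of a resolving set to another
chosen one. -/
theorem exists_equiv_of_signature_eq {V : Type*} {G : SimpleGraph V} {X D E : Finset V}
    (h : signature G X D = signature G X E) {s s' : V} (hs : s ∈ D) (hs' : s' ∈ E)
    (hss : nbhdIn G X s = nbhdIn G X s') :
    ∃ e : D ≃ E, (∀ a, nbhdIn G X (e a) = nbhdIn G X a) ∧ e ⟨s, hs⟩ = ⟨s', hs'⟩ := by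
  classical
  have hcard : ∀ c, Nonempty
      ({a : D // nbhdIn G X a = c} ≃ {b : E // nbhdIn G X b = c}) := by
    intro c
    have h1 := congrArg (Multiset.count c) h
    simp only [signature_eq_map, Multiset.count_map] at h1
    have key : ∀ F : Finset V, Fintype.card {a : F // nbhdIn G X a = c} =
        (Multiset.filter (fun a => c = nbhdIn G X a) F.val).card := by
      intro F
      have : (Multiset.filter (fun a => c = nbhdIn G X a) F.val).card =
          (F.filter (fun a => c = nbhdIn G X a)).card := rfl
      rw [this, ← Fintype.card_coe]
      refine Fintype.card_congr ⟨fun a => ⟨a.1.1, ?_⟩, fun a => ⟨⟨a.1, ?_⟩, ?_⟩, ?_, ?_⟩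
      · have := a.2; simp [this]
      · exact (Finset.mem_filter.1 a.2).1
      · exact (Finset.mem_filter.1 a.2).2.symm
      · intro a; rfl
      · intro a; rfl
    exact ⟨Fintype.equivOfCardEq (by rw [key, key, h1])⟩
  let e₀ : D ≃ E := Equiv.ofFiberEquiv fun c => (hcard c).some
  have he₀ : ∀ a, nbhdIn G X (e₀ a) = nbhdIn G X a := fun a =>
    Equiv.ofFiberEquiv_map (f := fun a : D => nbhdIn G X a) (g := fun a : E => nbhdIn G X a) _ a
  -- Composing with a transposition of two vertices of the same type keeps all types and corrects
  -- the image of $s$.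
  refine ⟨e₀.trans (Equiv.swap (e₀ ⟨s, hs⟩) ⟨s', hs'⟩), fun a => ?_, by simp⟩
  rw [← he₀ a, Equiv.trans_apply, Equiv.swap_apply_def]
  split_ifs with h1 h2
  · rw [h1, he₀, hss]
  · rw [h2, he₀, hss]
  · rfl

/-- Identical cliques can be exchanged by an automorphism that fixes everything else. -/
theorem exists_swap {V : Type*} {G : SimpleGraph V} {X D E : Finset V}
    (hD : IsCliqueOf G X D) (hE : IsCliqueOf G X E) (h : signature G X D = signature G X E)
    (hne : D ≠ E) {s s' : V} (hs : s ∈ D) (hs' : s' ∈ E)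
    (hss : nbhdIn G X s = nbhdIn G X s') :
    ∃ φ : G ≃g G, (∀ a, φ (φ a) = a) ∧ (∀ a, a ∉ D → a ∉ E → φ a = a) ∧ (∀ a ∈ D, φ a ∈ E) ∧
      (∀ a ∈ E, φ a ∈ D) ∧ (∀ a, nbhdIn G X (φ a) = nbhdIn G X a) ∧ φ s = s' := by
  classical
  obtain ⟨e, he, hes⟩ := exists_equiv_of_signature_eq h hs hs' hss
  have hDE : ∀ a ∈ D, a ∉ E := fun a ha ha' => hne (hD.eq_of_mem hE ha ha')
  let f : V → V := fun a => if ha : a ∈ D then (e ⟨a, ha⟩).1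
    else if ha : a ∈ E then (e.symm ⟨a, ha⟩).1 else a
  have fD : ∀ a (ha : a ∈ D), f a = (e ⟨a, ha⟩).1 := fun a ha => by simp [f, ha]
  have fE : ∀ a (ha : a ∈ E), f a = (e.symm ⟨a, ha⟩).1 := fun a ha => by
    have : a ∉ D := fun h => hDE a h ha
    simp [f, ha, this]
  have fO : ∀ a, a ∉ D → a ∉ E → f a = a := fun a h1 h2 => by simp [f, h1, h2]
  have fDE : ∀ a ∈ D, f a ∈ E := fun a ha => by rw [fD a ha]; exact Subtype.property _
  have fED : ∀ a ∈ E, f a ∈ D := fun a ha => by rw [fE a ha]; exact Subtype.property _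
  have hinv : Function.Involutive f := by
    intro a
    by_cases ha : a ∈ D
    · have h2 : f a ∈ E := fDE a ha
      rw [fE _ h2]
      have : (⟨f a, h2⟩ : E) = e ⟨a, ha⟩ := Subtype.ext (fD a ha)
      rw [this, Equiv.symm_apply_apply]
    by_cases ha' : a ∈ E
    · have h2 : f a ∈ D := fED a ha'
      rw [fD _ h2]
      have : (⟨f a, h2⟩ : D) = e.symm ⟨a, ha'⟩ := Subtype.ext (fE a ha')
      rw [this, Equiv.apply_symm_apply]
    · rw [fO a ha ha', fO a ha ha']
  have hnb : ∀ a, nbhdIn G X (f a) = nbhdIn G X a := by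
    intro a
    by_cases ha : a ∈ D
    · rw [fD a ha, he]
    by_cases ha' : a ∈ E
    · rw [fE a ha', ← he, Equiv.apply_symm_apply]
    · rw [fO a ha ha']
  have fX : ∀ a ∈ X, f a = a := fun a ha =>
    fO a (fun h => hD.notMem h ha) (fun h => hE.notMem h ha)
  -- Edges with an end in $X$ survive because $X$ is fixed and types are kept; every other edge that
  -- meets $D$ or $E$ lies inside that clique.
  have hadj : ∀ a b, G.Adj a b → G.Adj (f a) (f b) := by
    have hX : ∀ a, ∀ b ∈ X, G.Adj a b → G.Adj (f a) (f b) := by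
      intro a b hb hab
      rw [fX b hb]
      exact (nbhdIn_eq_iff.1 (hnb a) b hb).2 hab
    intro a b hab
    by_cases hb : b ∈ X
    · exact hX a b hb hab
    by_cases ha : a ∈ X
    · exact (hX b a ha hab.symm).symm
    have hfne : f a ≠ f b := fun h => hab.ne (hinv.injective h)
    by_cases haD : a ∈ D
    · exact hE.adj (fDE a haD) (fDE b (hD.mem_of_adj haD hb hab)) hfne
    by_cases haE : a ∈ E
    · exact hD.adj (fED a haE) (fED b (hE.mem_of_adj haE hb hab)) hfne
    have hbD : b ∉ D := fun h => haD (hD.mem_of_adj h ha hab.symm)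
    have hbE : b ∉ E := fun h => haE (hE.mem_of_adj h ha hab.symm)
    rwa [fO a haD haE, fO b hbD hbE]
  refine ⟨⟨hinv.toPerm, ?_⟩, hinv, fO, fDE, fED, hnb, ?_⟩
  · intro a b
    refine ⟨fun h => ?_, hadj a b⟩
    have := hadj _ _ h
    rwa [Function.Involutive.coe_toPerm, hinv, hinv] at this
  · change f s = s'
    rw [fD s hs, hes]

/-! ### Twin pairs in a clique -/

/-- Without three mutual twins the twin pairs in $C$ are disjoint, so a choice of one vertex of $R$
from each pair is injective and produces exactly $t$ vertices. It yields both the lower bound for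
the part of a resolving set in a clique and the economical sets used when a clique is put back. -/
theorem exists_hitting_set {V : Type*} {G : SimpleGraph V} {C R : Finset V}
    (h3 : ∀ u, ¬ TwinRule G u) (hne : R.Nonempty)
    (hR : ∀ u ∈ C, ∀ v ∈ C, u ≠ v → TrueTwins G u v → u ∈ R ∨ v ∈ R) :
    ∃ T ⊆ R, T.card = max 1 (twinPairs G C) ∧ T.Nonempty ∧
      ∀ u ∈ C, ∀ v ∈ C, u ≠ v → TrueTwins G u v → u ∈ T ∨ v ∈ T := by
  classical
  obtain ⟨P, hP, hPc⟩ : ∃ P : Finset (Finset V), (∀ p, p ∈ P ↔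
      (p ⊆ C ∧ p.card = 2) ∧ ∀ u ∈ p, ∀ v ∈ p, TrueTwins G u v) ∧ P.card = twinPairs G C :=
    by
      refine ⟨_, fun p => ?_, rfl⟩
      simp only [Finset.mem_filter, Finset.mem_powersetCard]
  have hsel : ∀ p ∈ P, ∃ u ∈ p, u ∈ R := by
    intro p hp
    rw [hP, Finset.card_eq_two] at hp
    obtain ⟨⟨hpC, u, v, huv, rfl⟩, ht⟩ := hp
    rcases hR u (hpC (by simp)) v (hpC (by simp)) huv (ht _ (by simp) _ (by simp)) with h | h
    · exact ⟨u, by simp, h⟩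
    · exact ⟨v, by simp, h⟩
  have : Nonempty V := ⟨hne.choose⟩
  choose! g hgp hgR using hsel
  have hinj : Set.InjOn g (P : Set (Finset V)) := by
    intro p hp q hq hpq
    have hpq' := hgp q hq
    rw [← hpq] at hpq'
    have hpp := hgp p hp
    rw [Finset.mem_coe, hP, Finset.card_eq_two] at hp hq
    generalize g p = z at hpp hpq'
    have other : ∀ r : Finset V, (∃ x y, x ≠ y ∧ r = {x, y}) → z ∈ r →
        ∃ y, y ≠ z ∧ r = {z, y} := by
      rintro r ⟨x, y, hxy, rfl⟩ hz
      rcases Finset.mem_insert.1 hz with h | h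
      · exact ⟨y, h ▸ hxy.symm, by rw [h]⟩
      · rw [Finset.mem_singleton] at h
        exact ⟨x, h ▸ hxy, by rw [h, Finset.pair_comm]⟩
    obtain ⟨y, hy, rfl⟩ := other p hp.1.2 hpp
    obtain ⟨y', hy', rfl⟩ := other q hq.1.2 hpq'
    -- Two pairs with the same chosen vertex $z$ but different partners would form three mutual true
    -- twins.
    by_cases hyy : y = y'
    · rw [hyy]
    · exfalso
      have t1 := hp.2 z (by simp) y (by simp)
      have t2 := hq.2 z (by simp) y' (by simp)
      exact h3 z ⟨y, y', hy.symm, hy'.symm, hyy, Or.inl ⟨t1, t2, t1.symm.trans t2⟩⟩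
  have hcardg : (P.image g).card = twinPairs G C := by rw [Finset.card_image_of_injOn hinj, hPc]
  have hhit : ∀ u ∈ C, ∀ v ∈ C, u ≠ v → TrueTwins G u v → u ∈ P.image g ∨ v ∈ P.image g := by
    intro u hu v hv huv ht
    have hp : ({u, v} : Finset V) ∈ P := by
      rw [hP]
      refine ⟨⟨by simp [Finset.insert_subset_iff, hu, hv], Finset.card_pair huv⟩, ?_⟩
      intro a ha b hb
      simp only [Finset.mem_insert, Finset.mem_singleton] at ha hb
      rcases ha with rfl | rfl <;> rcases hb with rfl | rfl
      exacts [rfl, ht, ht.symm, rfl]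
    have hm := Finset.mem_image_of_mem g hp
    have := hgp _ hp
    simp only [Finset.mem_insert, Finset.mem_singleton] at this
    rcases this with h | h <;> rw [h] at hm
    exacts [Or.inl hm, Or.inr hm]
  -- With no twin pairs the selection is empty; any one vertex of $R$ then makes it nonempty, which
  -- accounts for the maximum with 1.
  by_cases ht : twinPairs G C = 0
  · obtain ⟨r, hr⟩ := hne
    refine ⟨{r}, by simpa using hr, by simp [ht], by simp, ?_⟩
    intro u hu v hv huv htw
    rw [ht, Finset.card_eq_zero] at hcardg
    simpa [hcardg] using hhit u hu v hv huv htw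
  · refine ⟨P.image g, ?_, ?_, ?_, hhit⟩
    · intro a ha
      obtain ⟨p, hp, rfl⟩ := Finset.mem_image.1 ha
      exact hgR p hp
    · rw [hcardg]; omega
    · rw [← Finset.card_pos]; omega

end MetricDim

namespace MetricDim

/-! ### Invariance under isomorphism, and the clique through a given vertex -/

theorem trueTwins_iso {V W : Type*} {G : SimpleGraph V} {H : SimpleGraph W} (φ : G ≃g H)
    {u v : V} : TrueTwins H (φ u) (φ v) ↔ TrueTwins G u v := by
  simp only [TrueTwins, Set.ext_iff, Set.mem_insert_iff, SimpleGraph.mem_neighborSet]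
  rw [φ.surjective.forall (p := fun w => (w = φ u ∨ H.Adj (φ u) w ↔ w = φ v ∨ H.Adj (φ v) w))]
  exact forall_congr' fun x => by
    rw [φ.map_adj_iff, φ.map_adj_iff, φ.injective.eq_iff, φ.injective.eq_iff]

theorem twinPairs_map {V W : Type*} {G : SimpleGraph V} {H : SimpleGraph W} (φ : G ≃g H)
    (C : Finset V) : twinPairs H (C.map φ.toEquiv.toEmbedding) = twinPairs G C := by
  unfold twinPairs
  symm
  refine Finset.card_bij (fun p _ => p.map φ.toEquiv.toEmbedding) ?_ ?_ ?_
  · intro p hp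
    simp only [Finset.mem_filter, Finset.mem_powersetCard, Finset.forall_mem_map,
      Finset.card_map, Finset.map_subset_map] at hp ⊢
    exact ⟨hp.1, fun u hu v hv => (trueTwins_iso φ).2 (hp.2 u hu v hv)⟩
  · intro p _ q _ h
    exact Finset.map_injective _ h
  · intro q hq
    simp only [Finset.mem_filter, Finset.mem_powersetCard] at hq
    obtain ⟨p, hp, rfl⟩ := Finset.subset_map_iff.1 hq.1.1
    refine ⟨p, ?_, rfl⟩
    simp only [Finset.mem_filter, Finset.mem_powersetCard, Finset.forall_mem_map,
      Finset.card_map] at hq ⊢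
    exact ⟨⟨hp, hq.1.2⟩, fun u hu v hv => (trueTwins_iso φ).1 (hq.2 u hu v hv)⟩

theorem IsClusterModulator.exists_clique {V : Type*} [Fintype V] {G : SimpleGraph V}
    {X : Finset V} (hX : IsClusterModulator G X) {a : V} (ha : a ∉ X) :
    ∃ C, IsCliqueOf G X C ∧ a ∈ C ∧ ∀ b, b ∈ C ↔ b ∉ X ∧ (b = a ∨ G.Adj a b) := by
  classical
  have hcl : ∀ u v : V, ∀ (p : u ∉ X) (q : v ∉ X),
      (G.induce ((X : Set V)ᶜ)).Reachable ⟨u, p⟩ ⟨v, q⟩ → u ≠ v → G.Adj u v := by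
    intro u v p q h hne
    exact hX ⟨u, p⟩ ⟨v, q⟩ h (by simpa using hne)
  have hr : ∀ u v : V, ∀ (p : u ∉ X) (q : v ∉ X), G.Adj u v →
      (G.induce ((X : Set V)ᶜ)).Reachable ⟨u, p⟩ ⟨v, q⟩ := by
    intro u v p q h
    exact SimpleGraph.Adj.reachable (by simpa using h)
  have hmem : ∀ b, b ∈ Finset.univ.filter (fun b => b ∉ X ∧ (b = a ∨ G.Adj a b)) ↔
      b ∉ X ∧ (b = a ∨ G.Adj a b) := by simp
  have hreach : ∀ b (q : b ∉ X), (b = a ∨ G.Adj a b) →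
      (G.induce ((X : Set V)ᶜ)).Reachable ⟨a, ha⟩ ⟨b, q⟩ := by
    rintro b q (rfl | h)
    · exact SimpleGraph.Reachable.refl _
    · exact hr a b ha q h
  refine ⟨Finset.univ.filter (fun b => b ∉ X ∧ (b = a ∨ G.Adj a b)), ⟨⟨a, ?_⟩, ?_, ?_, ?_⟩,
    ?_, hmem⟩
  · simp [ha]
  · rw [Finset.disjoint_left]
    intro b hb
    exact ((hmem b).1 hb).1
  · intro u hu v hv huv
    rw [Finset.mem_coe, hmem] at hu hv
    exact hcl u v hu.1 hv.1 ((hreach u hu.1 hu.2).symm.trans (hreach v hv.1 hv.2)) huv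
  · intro u hu v hv huv
    rw [hmem] at hu ⊢
    refine ⟨hv, ?_⟩
    by_cases h : v = a
    · exact Or.inl h
    · exact Or.inr (hcl a v ha hv ((hreach u hu.1 hu.2).trans (hr u v hu.1 hv huv)) (Ne.symm h))
  · simp [ha]

/-! ### The clique rule -/

section CliqueRule

variable {V : Type*} {G : SimpleGraph V} {X C D E : Finset V}

/-- The exchange without a prescribed pair of vertices: any vertex of $D$ has a partner of its type
in $E$, by equality of signatures. -/
theorem exists_iso_of_mem_cliqueClass (hD : D ∈ cliqueClass G X C) (hE : E ∈ cliqueClass G X C)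
    (hne : D ≠ E) : ∃ φ : G ≃g G, (∀ a, φ (φ a) = a) ∧ (∀ a, a ∉ D → a ∉ E → φ a = a) ∧
      (∀ a ∈ D, φ a ∈ E) ∧ (∀ a ∈ E, φ a ∈ D) ∧ (∀ a, nbhdIn G X (φ a) = nbhdIn G X a) := by
  obtain ⟨a, ha⟩ := hD.1.1
  have h : signature G X D = signature G X E := hD.2.trans hE.2.symm
  have : nbhdIn G X a ∈ E.val.map (nbhdIn G X) := by
    rw [← signature_eq_map, ← h, signature_eq_map]
    exact Multiset.mem_map_of_mem _ ha
  obtain ⟨b, hb, hab⟩ := Multiset.mem_map.1 this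
  obtain ⟨φ, h1, h2, h3, h4, h5, -⟩ := exists_swap hD.1 hE.1 h hne ha hb hab.symm
  exact ⟨φ, h1, h2, h3, h4, h5⟩

theorem twinPairs_eq_of_mem_cliqueClass (hC : IsCliqueOf G X C) (hD : D ∈ cliqueClass G X C) :
    twinPairs G D = twinPairs G C := by
  by_cases hne : D = C
  · rw [hne]
  obtain ⟨φ, h1, h2, h3, h4, -⟩ := exists_iso_of_mem_cliqueClass hD ⟨hC, rfl⟩ hne
  rw [← twinPairs_map φ]
  congr 1
  ext b
  rw [Finset.mem_map]
  exact ⟨fun ⟨a, ha, h⟩ => h ▸ h3 a ha, fun hb => ⟨φ b, h4 b hb, h1 b⟩⟩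

/-- Of two identical cliques, at least one contains a vertex of a resolving set. -/
theorem inter_nonempty_or_of_mem_cliqueClass [DecidableEq V] (hD : D ∈ cliqueClass G X C)
    (hE : E ∈ cliqueClass G X C) (hne : D ≠ E) {S : Finset V}
    (hS : ∀ a ∈ D, ∀ b ∈ E, a ≠ b → ∃ s ∈ S, G.edist s a ≠ G.edist s b) :
    (S ∩ D).Nonempty ∨ (S ∩ E).Nonempty := by
  by_contra! hc
  simp only [Finset.ext_iff, Finset.mem_inter, Finset.notMem_empty,
    iff_false, not_and] at hc
  obtain ⟨φ, h1, h2, h3, h4, -⟩ := exists_iso_of_mem_cliqueClass hD hE hne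
  obtain ⟨a, ha⟩ := hD.1.1
  have hab : a ≠ φ a := fun h => hne (hD.1.eq_of_mem hE.1 ha (h ▸ h3 a ha))
  obtain ⟨s, hs, h⟩ := hS a ha (φ a) (h3 a ha) hab
  apply h
  rw [← edist_iso φ s a, h2 s (hc.1 s hs) (hc.2 s hs)]

/-- A hitting set of size exactly $\max\{1,t\}$ can be chosen inside $S\cap D$. -/
theorem max_le_card_inter [DecidableEq V] (h3 : ∀ u, ¬ TwinRule G u) (hC : IsCliqueOf G X C)
    (hD : D ∈ cliqueClass G X C) {S : Finset V} (hne : (S ∩ D).Nonempty)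
    (hS : ∀ u ∈ D, ∀ v ∈ D, u ≠ v → TrueTwins G u v → u ∈ S ∨ v ∈ S) :
    max 1 (twinPairs G C) ≤ (S ∩ D).card := by
  obtain ⟨T, hT, hc, -⟩ := exists_hitting_set (C := D) h3 hne (by
    intro u hu v hv huv ht
    rcases hS u hu v hv huv ht with h | h
    · exact Or.inl (Finset.mem_inter.2 ⟨h, hu⟩)
    · exact Or.inr (Finset.mem_inter.2 ⟨h, hv⟩))
  rw [← twinPairs_eq_of_mem_cliqueClass hC hD, ← hc]
  exact Finset.card_le_card hT

/-- Mapping $C$ onto its copy $D$ and fixing the rest is a retraction: an edge that leaves $C$ ends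
in $X$, and the exchange keeps adjacency to $X$. -/
theorem edist_induce_compl_of_mem_cliqueClass (hC : IsCliqueOf G X C)
    (hD : D ∈ cliqueClass G X C) (hne : D ≠ C) (a b : ((C : Set V)ᶜ : Set V)) :
    (G.induce ((C : Set V)ᶜ)).edist a b = G.edist a b := by
  classical
  obtain ⟨φ, h1, h2, h3, h4, h5⟩ := exists_iso_of_mem_cliqueClass hD ⟨hC, rfl⟩ hne
  have hDC : ∀ x ∈ D, x ∉ C := fun x hx hx' => hne (hD.1.eq_of_mem hC hx hx')
  have key : ∀ x ∈ C, ∀ y, y ∉ C → G.Adj x y → G.Adj (φ x) y := by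
    intro x hx y hy hxy
    have hyX : y ∈ X := by
      by_contra h
      exact hy (hC.mem_of_adj hx h hxy)
    exact (nbhdIn_eq_iff.1 (h5 x) y hyX).2 hxy
  refine edist_induce_of_retraction (fun x => if x ∈ C then φ x else x) ?_ ?_ ?_ a b
  · intro x
    by_cases hx : x ∈ C
    · simpa [hx] using hDC _ (h4 x hx)
    · simp [hx]
  · intro x y hxy
    by_cases hx : x ∈ C <;> by_cases hy : y ∈ C <;> simp only [hx, hy, if_true, if_false]
    · exact Or.inr (φ.map_adj_iff.2 hxy)
    · exact Or.inr (key x hx y hy hxy)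
    · exact Or.inr (key y hy x hx hxy.symm).symm
    · exact Or.inr hxy
  · intro x hx
    have : x ∉ C := by simpa using hx
    simp [this]

/-- In a large class of identical cliques, some clique can be removed from a resolving set. -/
theorem exists_removable_clique [DecidableEq V] {𝒞 : Finset (Finset V)}
    (h𝒞 : ∀ D, D ∈ 𝒞 ↔ D ∈ cliqueClass G X C) (hcard : 2 ^ (X.card + 2) + 2 ≤ 𝒞.card)
    {S : Finset V} (hS : IsResolving G S) :
    ∃ D ∈ 𝒞, (S ∩ D).Nonempty ∧ ∀ a, a ∉ D → ∀ b, b ∉ D → a ≠ b →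
      ∃ s ∈ S \ D, G.edist s a ≠ G.edist s b := by
  -- The cliques in which $S$ has a vertex of type $Y$. A type is rare if at most three cliques show
  -- it; the bad cliques are those that show a rare type, at most $3\cdot 2^{|X|}$ of them, and
  -- those missed by $S$, at most one.
  let cls : Finset V → Finset (Finset V) := fun Y =>
    𝒞.filter fun D => ∃ s ∈ S ∩ D, nbhdIn G X s = Y
  let bad := (X.powerset.filter fun Y => (cls Y).card ≤ 3).biUnion cls ∪
    𝒞.filter fun D => ¬ (S ∩ D).Nonempty
  have hbad : bad.card < 𝒞.card := by
    have h1 : ((X.powerset.filter fun Y => (cls Y).card ≤ 3).biUnion cls).card ≤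
        2 ^ X.card * 3 := by
      refine (Finset.card_biUnion_le_card_mul _ _ 3 ?_).trans ?_
      · intro Y hY
        exact (Finset.mem_filter.1 hY).2
      · refine Nat.mul_le_mul_right 3 ((Finset.card_filter_le _ _).trans ?_)
        rw [Finset.card_powerset]
    have h2 : (𝒞.filter fun D => ¬ (S ∩ D).Nonempty).card ≤ 1 := by
      rw [Finset.card_le_one]
      intro D hD E hE
      by_contra hne
      rw [Finset.mem_filter, h𝒞] at hD hE
      rcases inter_nonempty_or_of_mem_cliqueClass hD.1 hE.1 hne
        (fun a _ b _ hab => hS a b hab) with h | h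
      · exact hD.2 h
      · exact hE.2 h
    have h3 := Finset.card_union_le
      ((X.powerset.filter fun Y => (cls Y).card ≤ 3).biUnion cls)
      (𝒞.filter fun D => ¬ (S ∩ D).Nonempty)
    have h4 : 2 ^ (X.card + 2) = 2 ^ X.card * 4 := by ring
    change ((X.powerset.filter fun Y => (cls Y).card ≤ 3).biUnion cls ∪
      𝒞.filter fun D => ¬ (S ∩ D).Nonempty).card < _
    omega
  obtain ⟨D, hD, hDbad⟩ := Finset.exists_mem_notMem_of_card_lt_card hbad
  rw [Finset.mem_union, not_or] at hDbad
  refine ⟨D, hD, ?_, ?_⟩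
  · by_contra h
    exact hDbad.2 (Finset.mem_filter.2 ⟨hD, h⟩)
  intro a ha b hb hab
  obtain ⟨s, hs, hne⟩ := hS a b hab
  by_cases hsD : s ∈ D
  swap
  · exact ⟨s, by simp [hs, hsD], hne⟩
  have hDcls : D ∈ cls (nbhdIn G X s) := Finset.mem_filter.2
    ⟨hD, s, Finset.mem_inter.2 ⟨hs, hsD⟩, rfl⟩
  have hlarge : 3 < (cls (nbhdIn G X s)).card := by
    by_contra h
    refine hDbad.1 (Finset.mem_biUnion.2 ⟨nbhdIn G X s, Finset.mem_filter.2 ⟨?_, by omega⟩, hDcls⟩)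
    rw [Finset.mem_powerset]
    exact fun x hx => (mem_nbhdIn.1 hx).1
  have hone : ∀ z, (𝒞.filter fun D => z ∈ D).card ≤ 1 := by
    intro z
    rw [Finset.card_le_one]
    intro D hD E hE
    rw [Finset.mem_filter, h𝒞] at hD hE
    exact hD.1.1.eq_of_mem hE.1.1 hD.2 hE.2
  -- At least four cliques show the type of $s$, and only three are excluded: $D$ and the cliques of
  -- $a$ and of $b$.
  obtain ⟨D', hD', hnot⟩ : ∃ D' ∈ cls (nbhdIn G X s),
      D' ∉ {D} ∪ ((𝒞.filter fun D => a ∈ D) ∪ 𝒞.filter fun D => b ∈ D) := by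
    apply Finset.exists_mem_notMem_of_card_lt_card
    refine lt_of_le_of_lt ((Finset.card_union_le _ _).trans
      (add_le_add le_rfl (Finset.card_union_le _ _))) ?_
    have := hone a
    have := hone b
    rw [Finset.card_singleton]
    omega
  obtain ⟨hD'𝒞, s', hs', hss⟩ := Finset.mem_filter.1 hD'
  rw [Finset.mem_inter] at hs'
  simp only [Finset.mem_union, Finset.mem_singleton, Finset.mem_filter, hD'𝒞, true_and,
    not_or] at hnot
  obtain ⟨hDD', ha', hb'⟩ := hnot
  have hDc := (h𝒞 D).1 hD
  have hDc' := (h𝒞 D').1 hD'𝒞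
  -- The exchange of $D$ and $D'$ that takes $s$ to $s'$ fixes $a$ and $b$, so $s'$ separates them
  -- as $s$ does.
  obtain ⟨φ, h1, h2, h3, h4, h5, h6⟩ := exists_swap hDc.1 hDc'.1 (hDc.2.trans hDc'.2.symm)
    (Ne.symm hDD') hsD hs'.2 hss.symm
  refine ⟨s', Finset.mem_sdiff.2 ⟨hs'.1, fun h => hDD' (hDc'.1.eq_of_mem hDc.1 hs'.2 h)⟩, ?_⟩
  rw [← edist_iso φ, ← edist_iso φ s b, h6, h2 a ha ha', h2 b hb hb'] at hne
  exact hne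

end CliqueRule

end MetricDim

/-! ### The clique rule: putting a clique back, and safety -/

namespace MetricDim

section CliqueRule

variable {V : Type*} {G : SimpleGraph V} {X C D E : Finset V}

/-- The part of $S$ in $D$ is copied into $C$ by the exchange. Pairs inside $C$ are then resolved as
the corresponding pairs inside $D$ were, and a vertex together with its copy separates $C$ from
everything else. -/
theorem exists_resolving_of_card_inter_eq [DecidableEq V] (hC : IsCliqueOf G X C)
    (hD : D ∈ cliqueClass G X C) (hne : D ≠ C) {S : Finset V} (hSC : ∀ s ∈ S, s ∉ C)
    (hS : ∀ a, a ∉ C → ∀ b, b ∉ C → a ≠ b → ∃ s ∈ S, G.edist s a ≠ G.edist s b)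
    (hnonempty : (S ∩ D).Nonempty) :
    ∃ T, IsResolving G T ∧ T.card ≤ S.card + (S ∩ D).card := by
  obtain ⟨φ, h1, h2, h3, h4, h5⟩ := exists_iso_of_mem_cliqueClass hD ⟨hC, rfl⟩ hne
  have hDC : ∀ x ∈ D, x ∉ C := fun x hx hx' => hne (hD.1.eq_of_mem hC hx hx')
  refine ⟨S ∪ (S ∩ D).image φ, ?_, (Finset.card_union_le _ _).trans
    (add_le_add le_rfl Finset.card_image_le)⟩
  have hmem : ∀ a, φ a ∈ S → φ a ∈ D → a ∈ S ∪ (S ∩ D).image φ := fun a ha haD =>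
    Finset.mem_union_right _ (Finset.mem_image.2 ⟨φ a, Finset.mem_inter.2 ⟨ha, haD⟩, h1 a⟩)
  -- The copy $\varphi(s')$ is within distance 1 of $a$. If it fails, then it is adjacent to $b$, so
  -- $b\in X$; now $s'$, which has the same type, is adjacent to $b$ but at distance more than 1
  -- from $a$.
  have mixed : ∀ a ∈ C, ∀ b, b ∉ C → ∃ s ∈ S ∪ (S ∩ D).image φ, G.edist s a ≠ G.edist s b := by
    intro a ha b hb
    obtain ⟨s', hs'⟩ := hnonempty
    obtain ⟨hs'S, hs'D⟩ := Finset.mem_inter.1 hs'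
    by_cases heq : G.edist (φ s') a = G.edist (φ s') b
    swap
    · exact ⟨φ s', Finset.mem_union_right _ (Finset.mem_image_of_mem _ hs'), heq⟩
    have hsC := h3 s' hs'D
    have hle := hC.edist_le_one hsC ha
    rw [heq, SimpleGraph.edist_le_one_iff_adj_or_eq] at hle
    have hadj : G.Adj (φ s') b := hle.resolve_right fun h => hb (h ▸ hsC)
    have hbX : b ∈ X := by
      by_contra h
      exact hb (hC.mem_of_adj hsC h hadj)
    have hadj' : G.Adj s' b := (nbhdIn_eq_iff.1 (h5 s') b hbX).1 hadj
    refine ⟨s', Finset.mem_union_left _ hs'S, ?_⟩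
    rw [SimpleGraph.edist_eq_one_iff_adj.2 hadj']
    exact (hD.1.one_lt_edist hs'D (fun h => hDC a h ha) (hC.notMem ha)).ne'
  intro a b hab
  by_cases ha : a ∈ C <;> by_cases hb : b ∈ C
  · by_cases ha' : φ a ∈ S
    · exact ⟨a, hmem a ha' (h4 a ha), edist_self_ne hab⟩
    by_cases hb' : φ b ∈ S
    · exact ⟨b, hmem b hb' (h4 b hb), (edist_self_ne hab.symm).symm⟩
    obtain ⟨s, hs, hne'⟩ := hS (φ a) (hDC _ (h4 a ha)) (φ b) (hDC _ (h4 b hb))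
      (fun h => hab (φ.injective h))
    -- A vertex of $S\cap D$ is at distance 1 from all other vertices of $D$, so it cannot be what
    -- separates two vertices of $D$ outside $S$.
    by_cases hsD : s ∈ D
    · refine absurd ?_ hne'
      have : ∀ z ∈ C, φ z ∉ S → G.edist s (φ z) = 1 := by
        intro z hz hzS
        rw [SimpleGraph.edist_eq_one_iff_adj]
        exact hD.1.adj hsD (h4 z hz) fun h => hzS (h ▸ hs)
      rw [this a ha ha', this b hb hb']
    · refine ⟨s, Finset.mem_union_left _ hs, ?_⟩
      rw [← edist_iso φ, ← edist_iso φ s b, h2 s hsD (hSC s hs)]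
      exact hne'
  · exact mixed a ha b hb
  · obtain ⟨s, hs, h⟩ := mixed b hb a ha
    exact ⟨s, hs, h.symm⟩
  · obtain ⟨s, hs, h⟩ := hS a ha b hb hab
    exact ⟨s, Finset.mem_union_left _ hs, h⟩

/-- An exchange of vertices at no cost: each of $|X|$ cliques has a vertex of $S$ outside some
hitting set of its twin pairs; these spare vertices are dropped and $X$ is taken instead. Only the
hitting set in $C$ is paid for. -/
theorem exists_resolving_of_lt_card_inter [Fintype V] [DecidableEq V]
    (hX : IsClusterModulator G X)
    (h3 : ∀ u, ¬ TwinRule G u) (hC : IsCliqueOf G X C) {𝒟 : Finset (Finset V)}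
    (h𝒟 : ∀ D ∈ 𝒟, D ∈ cliqueClass G X C ∧ D ≠ C) (hcard : 𝒟.card = X.card) {S : Finset V}
    (hS : ∀ a, a ∉ C → ∀ b, b ∉ C → a ≠ b → ∃ s ∈ S, G.edist s a ≠ G.edist s b)
    (hlt : ∀ D ∈ 𝒟, max 1 (twinPairs G C) < (S ∩ D).card) :
    ∃ T, IsResolving G T ∧ T.card ≤ S.card + max 1 (twinPairs G C) := by
  have hDC : ∀ D ∈ cliqueClass G X C, D ≠ C → ∀ x ∈ D, x ∉ C := fun D hD hne x hx hx' =>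
    hne (hD.1.eq_of_mem hC hx hx')
  have hsel : ∀ D ∈ 𝒟, ∃ r ∈ S ∩ D, ∃ T ⊆ S ∩ D, r ∉ T ∧ T.Nonempty ∧
      ∀ u ∈ D, ∀ v ∈ D, u ≠ v → TrueTwins G u v → u ∈ T ∨ v ∈ T := by
    intro D hD
    obtain ⟨hDc, hne⟩ := h𝒟 D hD
    have hlt' := hlt D hD
    obtain ⟨T, hT, hTc, hTne, hThit⟩ := exists_hitting_set (C := D) (R := S ∩ D) h3
      (Finset.card_pos.1 (by omega)) (by
        intro u hu v hv huv ht
        rcases ht.twins.mem_or_mem (hS u (hDC D hDc hne u hu) v (hDC D hDc hne v hv) huv)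
          with h | h
        · exact Or.inl (Finset.mem_inter.2 ⟨h, hu⟩)
        · exact Or.inr (Finset.mem_inter.2 ⟨h, hv⟩))
    rw [twinPairs_eq_of_mem_cliqueClass hC hDc] at hTc
    obtain ⟨r, hr, hrT⟩ := Finset.exists_mem_notMem_of_card_lt_card (hTc ▸ hlt')
    exact ⟨r, hr, T, hT, hrT, hTne, hThit⟩
  have : Nonempty V := ⟨hC.1.choose⟩
  choose! r hr T hTS hrT hTne hThit using hsel
  obtain ⟨TC, hTC, hTCc, hTCne, hTChit⟩ := exists_hitting_set (C := C) (R := C) h3 hC.1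
    (fun u hu _ _ _ _ => Or.inl hu)
  have hrinj : Set.InjOn r (𝒟 : Set (Finset V)) := by
    intro D hD E hE h
    have h1 := (Finset.mem_inter.1 (hr D hD)).2
    have h2 := (Finset.mem_inter.1 (hr E hE)).2
    rw [← h] at h2
    exact (h𝒟 D hD).1.1.eq_of_mem (h𝒟 E hE).1.1 h1 h2
  have hrS : 𝒟.image r ⊆ S := by
    intro z hz
    obtain ⟨D, hD, rfl⟩ := Finset.mem_image.1 hz
    exact (Finset.mem_inter.1 (hr D hD)).1
  -- The size is at most $|X|+(|S|-|X|)+\max\{1,t\}$, since the spare vertices lie in $|X|$ disjoint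
  -- cliques.
  obtain ⟨U, hU⟩ : ∃ U, U = X ∪ (S \ 𝒟.image r) ∪ TC := ⟨_, rfl⟩
  have hXU : ∀ x ∈ X, x ∈ U := fun x hx => by simp [hU, hx]
  have hTCU : ∀ x ∈ TC, x ∈ U := fun x hx => by simp [hU, hx]
  have hTU : ∀ D ∈ 𝒟, ∀ x ∈ T D, x ∈ U := by
    intro D hD x hx
    obtain ⟨hxS, hxD⟩ := Finset.mem_inter.1 (hTS D hD hx)
    rw [hU]
    refine Finset.mem_union_left _ (Finset.mem_union_right _ (Finset.mem_sdiff.2 ⟨hxS, ?_⟩))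
    intro h
    obtain ⟨E, hE, rfl⟩ := Finset.mem_image.1 h
    have : E = D := (h𝒟 E hE).1.1.eq_of_mem (h𝒟 D hD).1.1 (Finset.mem_inter.1 (hr E hE)).2 hxD
    subst this
    exact hrT E hE hx
  have hSU : ∀ s ∈ S, ∀ F, IsCliqueOf G X F → s ∈ F → F ∉ 𝒟 → s ∈ U := by
    intro s hs F hF hsF hF𝒟
    rw [hU]
    refine Finset.mem_union_left _ (Finset.mem_union_right _ (Finset.mem_sdiff.2 ⟨hs, ?_⟩))
    intro h
    obtain ⟨E, hE, rfl⟩ := Finset.mem_image.1 h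
    have : E = F := (h𝒟 E hE).1.1.eq_of_mem hF (Finset.mem_inter.1 (hr E hE)).2 hsF
    exact hF𝒟 (this ▸ hE)
  refine ⟨U, ?_, ?_⟩
  swap
  · have h1 := Finset.card_union_le (X ∪ (S \ 𝒟.image r)) TC
    have h2 := Finset.card_union_le X (S \ 𝒟.image r)
    have h3 := Finset.card_sdiff_add_card_eq_card hrS
    rw [Finset.card_image_of_injOn hrinj] at h3
    rw [hU]
    omega
  intro a b hab
  by_cases haU : a ∈ U
  · exact ⟨a, haU, edist_self_ne hab⟩
  by_cases hbU : b ∈ U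
  · exact ⟨b, hbU, (edist_self_ne hab.symm).symm⟩
  have haX : a ∉ X := fun h => haU (hXU a h)
  have hbX : b ∉ X := fun h => hbU (hXU b h)
  obtain ⟨E, hE, haE, -⟩ := hX.exists_clique haX
  obtain ⟨F, hF, hbF, -⟩ := hX.exists_clique hbX
  by_cases hEF : E = F
  · subst hEF
    -- Equal types in one clique mean true twins, one of which was kept; different types are
    -- separated by a vertex of $X$.
    by_cases htypes : nbhdIn G X a = nbhdIn G X b
    · exfalso
      have ht := (hE.trueTwins_iff haE hbF).2 htypes
      by_cases hE𝒟 : E ∈ 𝒟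
      · rcases hThit E hE𝒟 a haE b hbF hab ht with h | h
        exacts [haU (hTU E hE𝒟 a h), hbU (hTU E hE𝒟 b h)]
      by_cases hEC : E = C
      · subst hEC
        rcases hTChit a haE b hbF hab ht with h | h
        exacts [haU (hTCU a h), hbU (hTCU b h)]
      have hout : ∀ z ∈ E, z ∉ C := fun z hz hz' => hEC (hE.eq_of_mem hC hz hz')
      rcases ht.twins.mem_or_mem (hS a (hout a haE) b (hout b hbF) hab) with h | h
      exacts [haU (hSU a h E hE haE hE𝒟), hbU (hSU b h E hE hbF hE𝒟)]
    · rw [nbhdIn_eq_iff] at htypes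
      push Not at htypes
      obtain ⟨x, hx, h⟩ := htypes
      refine ⟨x, hXU x hx, fun he => ?_⟩
      have : G.Adj a x ↔ G.Adj b x := by
        rw [SimpleGraph.adj_comm, G.adj_comm b, ← SimpleGraph.edist_eq_one_iff_adj,
          ← SimpleGraph.edist_eq_one_iff_adj, he]
      tauto
  · have haF : a ∉ F := fun h => hEF (hE.eq_of_mem hF haE h)
    have hbE : b ∉ E := fun h => hEF (hE.eq_of_mem hF h hbF)
    by_cases hsE : ∃ s ∈ U, s ∈ E
    · obtain ⟨s, hs, hsE⟩ := hsE
      exact ⟨s, hs, ((hE.edist_le_one hsE haE).trans_lt (hE.one_lt_edist hsE hbE hbX)).ne⟩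
    by_cases hsF : ∃ s ∈ U, s ∈ F
    · obtain ⟨s, hs, hsF⟩ := hsF
      exact ⟨s, hs, ((hF.edist_le_one hsF hbF).trans_lt (hF.one_lt_edist hsF haF haX)).ne'⟩
    push Not at hsE hsF
    -- A clique met by $S$ is still met by $U$, because a nonempty hitting set is kept wherever a
    -- vertex is dropped. So if $U$ misses both cliques, then so does $S$, and the vertex of $S$
    -- that separates $a$ and $b$ can be replaced by one of $X$.
    have hunhit : ∀ F, IsCliqueOf G X F → (∀ s ∈ U, s ∉ F) → F ≠ C ∧ ∀ s ∈ S, s ∉ F := by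
      intro F hF hUF
      refine ⟨?_, fun s hs hsF => ?_⟩
      · rintro rfl
        obtain ⟨z, hz⟩ := hTCne
        exact hUF z (hTCU z hz) (hTC hz)
      · by_cases hF𝒟 : F ∈ 𝒟
        · obtain ⟨z, hz⟩ := hTne F hF𝒟
          exact hUF z (hTU F hF𝒟 z hz) (Finset.mem_inter.1 (hTS F hF𝒟 hz)).2
        · exact hUF s (hSU s hs F hF hsF hF𝒟) hsF
    obtain ⟨hEC, hSE⟩ := hunhit E hE hsE
    obtain ⟨hFC, hSF⟩ := hunhit F hF hsF
    obtain ⟨s, hs, hne⟩ := hS a (fun h => hEC (hE.eq_of_mem hC haE h)) b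
      (fun h => hFC (hF.eq_of_mem hC hbF h)) hab
    obtain ⟨y, hy, h⟩ := hE.exists_mem_edist_ne hF haE hbF (hSE s hs) (hSF s hs) hne
    exact ⟨y, hXU y hy, h⟩

/-- The threshold serves both directions: $2^{|X|+2}+2$ members guarantee a removable clique, and
the summand $|X|$ ensures that, besides $C$ and the at most one member missed by $S$, there are
$|X|$ members to take spare vertices from. -/
theorem cliqueRule_safe [Fintype V] (G : SimpleGraph V) (k : ℤ) (X C : Finset V)
    (hX : IsClusterModulator G X) (hrule : CliqueRule G X C) :
    HasResolvingSet G k ↔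
      HasResolvingSet (G.induce ((C : Set V)ᶜ)) (k - max 1 (twinPairs G C : ℤ)) := by
  classical
  obtain ⟨h3, hC, hcard⟩ := hrule
  obtain ⟨𝒞, h𝒞⟩ : ∃ 𝒞 : Finset (Finset V), ∀ D, D ∈ 𝒞 ↔ D ∈ cliqueClass G X C :=
    ⟨(cliqueClass G X C).toFinite.toFinset, fun D => by simp⟩
  have hN : 2 ^ (X.card + 2) + X.card + 2 ≤ 𝒞.card := by
    rw [← Set.ncard_coe_finset 𝒞]
    refine hcard.trans (le_of_eq ?_)
    congr 1
    ext D
    exact (h𝒞 D).symm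
  have hpow : 0 < 2 ^ (X.card + 2) := by positivity
  have hCC : C ∈ 𝒞 := (h𝒞 C).2 ⟨hC, rfl⟩
  have hother : ∃ D ∈ 𝒞, D ≠ C := by
    obtain ⟨D, hD⟩ : (𝒞.erase C).Nonempty := by
      rw [← Finset.card_pos, Finset.card_erase_of_mem hCC]; omega
    exact ⟨D, Finset.mem_of_mem_erase hD, Finset.ne_of_mem_erase hD⟩
  have hd : ∀ a b : ((C : Set V)ᶜ : Set V),
      (G.induce ((C : Set V)ᶜ)).edist a b = G.edist a b := by
    obtain ⟨D, hD, hne⟩ := hother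
    exact edist_induce_compl_of_mem_cliqueClass hC ((h𝒞 D).1 hD) hne
  rw [hasResolvingSet_induce hd]
  have hmax : (max 1 (twinPairs G C : ℤ)) = ((max 1 (twinPairs G C) : ℕ) : ℤ) := by push_cast; rfl
  rw [hmax]
  simp only [Set.mem_compl_iff, Finset.mem_coe]
  constructor
  · rintro ⟨S, hS, hk⟩
    obtain ⟨D, hD, hne, hres⟩ := exists_removable_clique h𝒞 (by omega) hS
    have hDc := (h𝒞 D).1 hD
    have hle := max_le_card_inter h3 hC hDc hne
      (fun u _ v _ huv ht => ht.twins.mem_or_mem (hS u v huv))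
    have hcardS := Finset.card_sdiff_add_card_inter S D
    by_cases hDC : D = C
    · subst hDC
      exact ⟨S \ D, fun s hs => (Finset.mem_sdiff.1 hs).2, hres, by omega⟩
    -- The removable clique need not be $C$; exchanging the two carries $S\setminus D$ to a set
    -- outside $C$.
    obtain ⟨φ, h1, h2, h3', h4, h5⟩ := exists_iso_of_mem_cliqueClass hDc ((h𝒞 C).1 hCC) hDC
    have hnot : ∀ a, a ∉ C → φ a ∉ D := fun a ha h => ha (h1 a ▸ h3' _ h)
    refine ⟨(S \ D).image φ, ?_, ?_, ?_⟩
    · intro s hs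
      obtain ⟨z, hz, rfl⟩ := Finset.mem_image.1 hs
      intro h
      exact (Finset.mem_sdiff.1 hz).2 (h1 z ▸ h4 _ h)
    · intro a ha b hb hab
      obtain ⟨s, hs, h⟩ := hres (φ a) (hnot a ha) (φ b) (hnot b hb)
        (fun h => hab (φ.injective h))
      refine ⟨φ s, Finset.mem_image_of_mem _ hs, ?_⟩
      rw [← edist_iso φ, ← edist_iso φ _ b, h1]
      exact h
    · have := Finset.card_image_le (s := S \ D) (f := φ)
      omega
  · rintro ⟨S, hSC, hS, hk⟩
    suffices h : ∃ T, IsResolving G T ∧ T.card ≤ S.card + max 1 (twinPairs G C) by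
      obtain ⟨T, hT, hle⟩ := h
      exact ⟨T, hT, by omega⟩
    by_cases hex : ∃ D ∈ 𝒞, D ≠ C ∧ (S ∩ D).card = max 1 (twinPairs G C)
    · obtain ⟨D, hD, hDC, hc⟩ := hex
      rw [← hc]
      exact exists_resolving_of_card_inter_eq hC ((h𝒞 D).1 hD) hDC hSC hS
        (Finset.card_pos.1 (by omega))
    push Not at hex
    have hDC : ∀ D ∈ 𝒞, D ≠ C → ∀ x ∈ D, x ∉ C := fun D hD hne x hx hx' =>
      hne (((h𝒞 D).1 hD).1.eq_of_mem hC hx hx')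
    have hunhit : ((𝒞.erase C).filter fun D => ¬ (S ∩ D).Nonempty).card ≤ 1 := by
      rw [Finset.card_le_one]
      intro D hD E hE
      by_contra hne
      rw [Finset.mem_filter, Finset.mem_erase] at hD hE
      rcases inter_nonempty_or_of_mem_cliqueClass ((h𝒞 D).1 hD.1.2) ((h𝒞 E).1 hE.1.2) hne
        (fun a ha b hb hab => hS a (hDC D hD.1.2 hD.1.1 a ha) b (hDC E hE.1.2 hE.1.1 b hb) hab)
        with h | h
      exacts [hD.2 h, hE.2 h]
    have hsplit := Finset.card_filter_add_card_filter_not (s := 𝒞.erase C)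
      (fun D => (S ∩ D).Nonempty)
    rw [Finset.card_erase_of_mem hCC] at hsplit
    obtain ⟨𝒟, h𝒟, h𝒟c⟩ := Finset.exists_subset_card_eq
      (s := (𝒞.erase C).filter fun D => (S ∩ D).Nonempty) (n := X.card) (by omega)
    have h𝒟' : ∀ D ∈ 𝒟, D ∈ 𝒞 ∧ D ≠ C ∧ (S ∩ D).Nonempty := by
      intro D hD
      have := h𝒟 hD
      rw [Finset.mem_filter, Finset.mem_erase] at this
      tauto
    refine exists_resolving_of_lt_card_inter hX h3 hC
      (fun D hD => ⟨(h𝒞 D).1 (h𝒟' D hD).1, (h𝒟' D hD).2.1⟩) h𝒟c hS ?_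
    intro D hD
    obtain ⟨hD𝒞, hne, hnon⟩ := h𝒟' D hD
    refine lt_of_le_of_ne ?_ (Ne.symm (hex D hD𝒞 hne))
    exact max_le_card_inter h3 hC ((h𝒞 D).1 hD𝒞) hnon (fun u hu v hv huv ht =>
      ht.twins.mem_or_mem (hS u (hDC D hD𝒞 hne u hu) v (hDC D hD𝒞 hne v hv) huv))

end CliqueRule

/-! ### The size of reduced graphs -/

theorem IsCliqueOf.card_filter_nbhdIn_le {V : Type*} [DecidableEq V] {G : SimpleGraph V}
    {X C : Finset V} (h3 : ∀ u, ¬ TwinRule G u) (hC : IsCliqueOf G X C) (Y : Finset V) :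
    (C.filter fun u => nbhdIn G X u = Y).card ≤ 2 := by
  by_contra! h
  obtain ⟨u, v, w, hu, hv, hw, huv, huw, hvw⟩ := Finset.two_lt_card_iff.1 h
  rw [Finset.mem_filter] at hu hv hw
  refine h3 u ⟨v, w, huv, huw, hvw, Or.inl ⟨?_, ?_, ?_⟩⟩
  · rw [hC.trueTwins_iff hu.1 hv.1, hu.2, hv.2]
  · rw [hC.trueTwins_iff hu.1 hw.1, hu.2, hw.2]
  · rw [hC.trueTwins_iff hv.1 hw.1, hv.2, hw.2]

/-- The factors are the number of classes, the number of cliques in a class and the number of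
vertices of a clique; a class is determined by how often each subset of $X$ occurs as a type, and
this is at most twice. -/
theorem card_le_of_isReduced {V : Type*} [Fintype V] (G : SimpleGraph V) (X : Finset V)
    (hX : IsClusterModulator G X) (hred : IsReduced G X) :
    Fintype.card V ≤
      2 ^ 2 ^ (X.card + 1) * (2 ^ (X.card + 2) + X.card + 1) * 2 ^ (X.card + 1) + X.card := by
  classical
  obtain ⟨h3, hcl⟩ := hred
  obtain ⟨𝒞, h𝒞⟩ : ∃ 𝒞 : Finset (Finset V), ∀ D, D ∈ 𝒞 ↔ IsCliqueOf G X D :=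
    ⟨Finset.univ.filter (IsCliqueOf G X), fun D => by simp⟩
  have hnb : ∀ u, nbhdIn G X u ∈ X.powerset := fun u =>
    Finset.mem_powerset.2 fun x hx => (mem_nbhdIn.1 hx).1
  have hsize : ∀ D ∈ 𝒞, D.card ≤ 2 ^ (X.card + 1) := by
    intro D hD
    have := Finset.card_le_mul_card_image_of_maps_to (s := D) (t := X.powerset)
      (f := nbhdIn G X) (fun u _ => hnb u) 2
      (fun Y _ => ((h𝒞 D).1 hD).card_filter_nbhdIn_le h3 Y)
    rw [Finset.card_powerset] at this
    rw [pow_succ]; omega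
  let sig : Finset V → (Finset V → ℕ) := fun D Y =>
    (D.filter fun u => nbhdIn G X u = Y).card
  have hsig : ∀ D E, (∀ Y ∈ X.powerset, sig D Y = sig E Y) →
      signature G X D = signature G X E := by
    intro D E h
    ext Y
    have key : ∀ F : Finset V, Multiset.count Y (signature G X F) = sig F Y := by
      intro F
      rw [signature_eq_map, Multiset.count_map]
      simp only [eq_comm (a := Y)]
      rfl
    rw [key, key]
    by_cases hY : Y ∈ X.powerset
    · exact h Y hY
    · have : ∀ F, sig F Y = 0 := by
        intro F
        rw [Finset.card_eq_zero, Finset.filter_eq_empty_iff]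
        intro u _ hu
        exact hY (hu ▸ hnb u)
      rw [this, this]
  have hclasses : 𝒞.card ≤ 2 ^ 2 ^ (X.card + 1) * (2 ^ (X.card + 2) + X.card + 1) := by
    have h := Finset.card_le_mul_card_image_of_maps_to (s := 𝒞)
      -- Multiplicities are at most 2; four possible values are allowed because
      -- $4^{2^{|X|}}=2^{2^{|X|+1}}$.
      (t := X.powerset.pi fun _ => Finset.range 4)
      (f := fun D Y _ => sig D Y) ?_ (2 ^ (X.card + 2) + X.card + 1) ?_
    · rw [Finset.card_pi, Finset.prod_const, Finset.card_range, Finset.card_powerset] at h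
      have : 4 ^ 2 ^ X.card = 2 ^ 2 ^ (X.card + 1) := by
        rw [pow_succ 2 X.card, mul_comm, pow_mul]; norm_num
      rw [this, mul_comm] at h
      exact h
    · intro D hD
      rw [Finset.mem_pi]
      intro Y _
      have := ((h𝒞 D).1 hD).card_filter_nbhdIn_le h3 Y
      rw [Finset.mem_range]
      change (D.filter fun u => nbhdIn G X u = Y).card < 4
      omega
    · intro p _
      by_contra! hlt
      obtain ⟨C, hC⟩ : (𝒞.filter fun D => (fun Y (_ : Y ∈ X.powerset) => sig D Y) = p).Nonempty :=
        Finset.card_pos.1 (lt_of_le_of_lt (Nat.zero_le _) hlt)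
      rw [Finset.mem_filter] at hC
      refine hcl C ⟨h3, (h𝒞 C).1 hC.1, ?_⟩
      refine le_trans (Nat.succ_le_of_lt hlt) ?_
      rw [← Set.ncard_coe_finset]
      refine Set.ncard_le_ncard ?_ (Set.toFinite _)
      intro D hD
      rw [Finset.mem_coe, Finset.mem_filter] at hD
      refine ⟨(h𝒞 D).1 hD.1, hsig D C fun Y hY => ?_⟩
      have := hD.2.trans hC.2.symm
      exact congrFun (congrFun this Y) hY
  have hcover : Finset.univ ⊆ X ∪ 𝒞.biUnion id := by
    intro a _
    by_cases ha : a ∈ X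
    · exact Finset.mem_union_left _ ha
    · obtain ⟨D, hD, haD, -⟩ := hX.exists_clique ha
      exact Finset.mem_union_right _ (Finset.mem_biUnion.2 ⟨D, (h𝒞 D).2 hD, haD⟩)
  calc Fintype.card V = (Finset.univ : Finset V).card := rfl
    _ ≤ _ := Finset.card_le_card hcover
    _ ≤ X.card + (𝒞.biUnion id).card := Finset.card_union_le _ _
    _ ≤ X.card + 𝒞.card * 2 ^ (X.card + 1) := by
        gcongr
        exact Finset.card_biUnion_le_card_mul _ _ _ hsize
    _ ≤ _ := by
        rw [add_comm]
        gcongr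

end MetricDim

/-! ### A small language with total semantics, compiled to the random access machine -/

namespace RAM

/-- Store `i` in the first cell of array `v`. -/
def Memory.set (σ : Memory) (v i : ℕ) : Memory := Function.update σ v (Function.update (σ v) 0 i)

@[simp] theorem Memory.set_self (σ : Memory) (v i : ℕ) : (σ.set v i) v 0 = i := by simp [Memory.set]

@[simp] theorem Memory.set_of_ne (σ : Memory) {v a : ℕ} (i : ℕ) (h : a ≠ v) :
    (σ.set v i) a = σ a := by simp [Memory.set, h]

theorem Memory.set_cell_of_ne (σ : Memory) {v j : ℕ} (a i : ℕ) (h : j ≠ 0) :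
    (σ.set v i) a j = σ a j := by
  by_cases ha : a = v
  · subst ha; simp [Memory.set, h]
  · simp [ha]

/-- Terms: constants, reads, addition, truncated subtraction, case distinction, and the sum of
the values of a term when the first cell of array `v` ranges over the numbers below the first cell
of array `0`. -/
inductive Tm : Type
  | const (c : ℕ)
  | rd (a : ℕ) (i : Tm)
  | add (e₁ e₂ : Tm)
  | sub (e₁ e₂ : Tm)
  | ite (c e₁ e₂ : Tm)
  | sum (v : ℕ) (e : Tm)

/-- The value of a term. -/
def Tm.eval : Tm → Memory → ℕ
  | .const c, _ => c
  | .rd a i, σ => σ a (i.eval σ)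
  | .add e₁ e₂, σ => e₁.eval σ + e₂.eval σ
  | .sub e₁ e₂, σ => e₁.eval σ - e₂.eval σ
  | .ite c e₁ e₂, σ => if c.eval σ = 0 then e₂.eval σ else e₁.eval σ
  | .sum v e, σ => ∑ i ∈ Finset.range (σ 0 0), e.eval (σ.set v i)

/-- Only arrays below `64` occur, and array `0` is not used as a variable. -/
def Tm.wf : Tm → Bool
  | .const _ => true
  | .rd a i => decide (a < 64) && i.wf
  | .add e₁ e₂ => e₁.wf && e₂.wf
  | .sub e₁ e₂ => e₁.wf && e₂.wf
  | .ite c e₁ e₂ => c.wf && e₁.wf && e₂.wf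
  | .sum v e => decide (v < 64) && decide (v ≠ 0) && e.wf

/-- The first cell of an array. -/
def reg (a : ℕ) : Expr := .read a (.const 0)

/-- Write to the first cell of an array. -/
def setReg (a : ℕ) (e : Expr) : Prog := .write a (.const 0) e

@[simp] theorem eval_reg (σ : Memory) (a : ℕ) : (reg a).eval σ = σ a 0 := rfl

theorem run_setReg (σ : Memory) (a : ℕ) (e : Expr) :
    Run (setReg a e) σ (σ.set a (e.eval σ)) (e.cost + 2) := by
  have := Run.write σ a (.const 0) e
  simp only [Expr.eval, Expr.cost] at this
  rw [show e.cost + 2 = 1 + e.cost + 1 by ring]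
  exact this

/-- The loop that runs `body` with `v` set to each number below the first cell of array `b`,
with its counter in register `c` and its bound in register `c + 1`. -/
def forLoop (c v b : ℕ) (body : Prog) : Prog :=
  .seq (setReg c (.const 0)) (.seq (setReg (c + 1) (reg b))
    (.loop (.sub (reg (c + 1)) (reg c))
      (.seq (setReg v (reg c)) (.seq body (setReg c (.add (reg c) (.const 1)))))))

/-- The bound is copied to register $c+1$ at the start, so the body is free to change array $b$; it
has to preserve the counter and the copied bound. The constants 16 and 13 are the overhead of one
round and of the whole loop. -/
theorem run_forLoop {c v b m T : ℕ} {body : Prog} (Inv : ℕ → Memory → Prop) {σ : Memory}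
    (hb : σ b 0 = m) (hbc : b ≠ c)
    (h0 : Inv 0 ((σ.set c 0).set (c + 1) m))
    (hstep : ∀ i < m, ∀ μ : Memory, Inv i μ → μ c 0 = i → μ (c + 1) 0 = m →
      ∃ τ t, Run body (μ.set v i) τ t ∧ t ≤ T ∧ τ c 0 = i ∧ τ (c + 1) 0 = m ∧
        Inv (i + 1) (τ.set c (i + 1))) :
    ∃ τ t, Run (forLoop c v b body) σ τ t ∧ t ≤ m * (T + 16) + 13 ∧ Inv m τ := by
  have loop : ∀ k i, k + i = m → ∀ μ : Memory, Inv i μ → μ c 0 = i → μ (c + 1) 0 = m →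
      ∃ τ t, Run (.loop (.sub (reg (c + 1)) (reg c))
        (.seq (setReg v (reg c)) (.seq body (setReg c (.add (reg c) (.const 1)))))) μ τ t ∧
        t ≤ k * (T + 16) + 6 ∧ Inv m τ := by
    intro k
    induction k with
    | zero =>
      intro i hi μ hI hc hc'
      obtain rfl : i = m := by omega
      refine ⟨μ, _, Run.loop_exit ?_, ?_, hI⟩
      · simp [Expr.eval, hc, hc']
      · simp [Expr.cost, reg]
    | succ k ih =>
      intro i hi μ hI hc hc'
      obtain ⟨τ, t, hrun, ht, hτc, hτc', hI'⟩ := hstep i (by omega) μ hI hc hc'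
      have h1 := run_setReg μ v (reg c)
      have h2 := run_setReg τ c (.add (reg c) (.const 1))
      simp only [eval_reg, Expr.eval, hc, hτc] at h1 h2
      obtain ⟨ρ, t', hrun', ht', hI''⟩ := ih (i + 1) (by omega) _ hI' (by simp)
        (by rw [Memory.set_of_ne _ _ (by omega), hτc'])
      refine ⟨ρ, _, Run.loop_next ?_ (Run.seq h1 (Run.seq hrun h2)) hrun', ?_, hI''⟩
      · simp only [Expr.eval, eval_reg, hc, hc']; omega
      · simp only [Expr.cost, reg]
        rw [Nat.add_mul]
        omega
  have h1 := run_setReg σ c (.const 0)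
  have h2 := run_setReg (σ.set c 0) (c + 1) (reg b)
  simp only [eval_reg, Expr.eval, Memory.set_of_ne _ _ hbc, hb] at h1 h2
  obtain ⟨τ, t, hrun, ht, hI⟩ := loop m 0 (by omega) _ h0
    (by rw [Memory.set_of_ne _ _ (by omega)]; simp) (by simp)
  refine ⟨τ, _, Run.seq h1 (Run.seq h2 hrun), ?_, hI⟩
  simp only [Expr.cost, reg]
  omega

/-- The program that leaves the value of a term in register `r`, using registers from `r` on. -/
def Tm.compile : Tm → ℕ → Prog
  | .const c, r => setReg r (.const c)
  | .rd a i, r => .seq (i.compile r) (setReg r (.read a (reg r)))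
  | .add e₁ e₂, r =>
      .seq (e₁.compile r) (.seq (e₂.compile (r + 1)) (setReg r (.add (reg r) (reg (r + 1)))))
  | .sub e₁ e₂, r =>
      .seq (e₁.compile r) (.seq (e₂.compile (r + 1)) (setReg r (.sub (reg r) (reg (r + 1)))))
  | .ite c e₁ e₂, r => .seq (c.compile r) (.ite (reg r) (e₁.compile r) (e₂.compile r))
  | .sum v e, r =>
      .seq (setReg (r + 1) (reg v)) (.seq (setReg r (.const 0))
        (.seq (forLoop (r + 2) v 0
          (.seq (e.compile (r + 4)) (setReg r (.add (reg r) (reg (r + 4))))))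
          (setReg v (reg (r + 1)))))

/-- A bound for the running time of a compiled term if array `0` starts with at most `N`. -/
def Tm.cost : Tm → ℕ → ℕ
  | .const _, _ => 3
  | .rd _ i, N => i.cost N + 5
  | .add e₁ e₂, N => e₁.cost N + e₂.cost N + 7
  | .sub e₁ e₂, N => e₁.cost N + e₂.cost N + 7
  | .ite c e₁ e₂, N => c.cost N + e₁.cost N + e₂.cost N + 3
  | .sum _ e, N => N * (e.cost N + 23) + 24

/-- Arrays below 64 belong to the source language and all others are scratch, so the machine memory
`μ` has to match `σ` only below 64. Everything below $r$ is restored exactly, including the variable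
of a sum, so intermediate results held in earlier registers survive. -/
theorem Tm.run {N : ℕ} : ∀ (e : Tm), e.wf = true → ∀ r, 64 ≤ r → ∀ σ μ : Memory,
    (∀ a < 64, μ a = σ a) → σ 0 0 ≤ N →
    ∃ τ t, Run (e.compile r) μ τ t ∧ t ≤ e.cost N ∧ τ r 0 = e.eval σ ∧ ∀ a < r, τ a = μ a
  | .const c, _, r, hr, σ, μ, hμ, hN =>
    ⟨_, _, run_setReg μ r (.const c), by simp [Expr.cost, Tm.cost],
      by simp [Tm.eval, Expr.eval], fun a ha => Memory.set_of_ne _ _ (by omega)⟩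
  | .rd a i, he, r, hr, σ, μ, hμ, hN => by
    simp only [Tm.wf, Bool.and_eq_true, decide_eq_true_eq] at he
    obtain ⟨τ, t, h, ht, hτ, hlt⟩ := Tm.run i he.2 r hr σ μ hμ hN
    refine ⟨_, _, Run.seq h (run_setReg τ r (.read a (reg r))), ?_, ?_, ?_⟩
    · simp only [Expr.cost, Tm.cost, reg]; omega
    · simp [Tm.eval, Expr.eval, hτ, hlt a (by omega), hμ a he.1]
    · intro a ha
      rw [Memory.set_of_ne _ _ (by omega), hlt a ha]
  | .add e₁ e₂, he, r, hr, σ, μ, hμ, hN => by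
    simp only [Tm.wf, Bool.and_eq_true] at he
    obtain ⟨τ₁, t₁, h₁, ht₁, hτ₁, hlt₁⟩ := Tm.run e₁ he.1 r hr σ μ hμ hN
    obtain ⟨τ₂, t₂, h₂, ht₂, hτ₂, hlt₂⟩ := Tm.run e₂ he.2 (r + 1) (by omega) σ τ₁
      (fun a ha => by rw [hlt₁ a (by omega), hμ a ha]) hN
    refine ⟨_, _, Run.seq h₁ (Run.seq h₂ (run_setReg τ₂ r _)), ?_, ?_, ?_⟩
    · simp only [Expr.cost, Tm.cost, reg]; omega
    · simp [Tm.eval, Expr.eval, hτ₂, hlt₂ r (by omega), hτ₁]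
    · intro a ha
      rw [Memory.set_of_ne _ _ (by omega), hlt₂ a (by omega), hlt₁ a ha]
  | .sub e₁ e₂, he, r, hr, σ, μ, hμ, hN => by
    simp only [Tm.wf, Bool.and_eq_true] at he
    obtain ⟨τ₁, t₁, h₁, ht₁, hτ₁, hlt₁⟩ := Tm.run e₁ he.1 r hr σ μ hμ hN
    obtain ⟨τ₂, t₂, h₂, ht₂, hτ₂, hlt₂⟩ := Tm.run e₂ he.2 (r + 1) (by omega) σ τ₁
      (fun a ha => by rw [hlt₁ a (by omega), hμ a ha]) hN
    refine ⟨_, _, Run.seq h₁ (Run.seq h₂ (run_setReg τ₂ r _)), ?_, ?_, ?_⟩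
    · simp only [Expr.cost, Tm.cost, reg]; omega
    · simp [Tm.eval, Expr.eval, hτ₂, hlt₂ r (by omega), hτ₁]
    · intro a ha
      rw [Memory.set_of_ne _ _ (by omega), hlt₂ a (by omega), hlt₁ a ha]
  | .ite c e₁ e₂, he, r, hr, σ, μ, hμ, hN => by
    simp only [Tm.wf, Bool.and_eq_true] at he
    obtain ⟨τ, t, h, ht, hτ, hlt⟩ := Tm.run c he.1.1 r hr σ μ hμ hN
    have hag : ∀ a < 64, τ a = σ a := fun a ha => by rw [hlt a (by omega), hμ a ha]
    by_cases hc : c.eval σ = 0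
    · obtain ⟨τ₂, t₂, h₂, ht₂, hτ₂, hlt₂⟩ := Tm.run e₂ he.2 r hr σ τ hag hN
      refine ⟨_, _, Run.seq h (Run.ite_false (by simp [hτ, hc]) h₂), ?_, ?_, ?_⟩
      · simp only [Expr.cost, Tm.cost, reg]; omega
      · simp [Tm.eval, hc, hτ₂]
      · intro a ha
        rw [hlt₂ a ha, hlt a ha]
    · obtain ⟨τ₂, t₂, h₂, ht₂, hτ₂, hlt₂⟩ := Tm.run e₁ he.1.2 r hr σ τ hag hN
      refine ⟨_, _, Run.seq h (Run.ite_true (by simp [hτ, hc]) h₂), ?_, ?_, ?_⟩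
      · simp only [Expr.cost, Tm.cost, reg]; omega
      · simp [Tm.eval, hc, hτ₂]
      · intro a ha
        rw [hlt₂ a ha, hlt a ha]
  | .sum v e, he, r, hr, σ, μ, hμ, hN => by
    simp only [Tm.wf, Bool.and_eq_true, decide_eq_true_eq] at he
    obtain ⟨⟨hv, hv0⟩, he⟩ := he
    have h1 := run_setReg μ (r + 1) (reg v)
    have h2 := run_setReg (μ.set (r + 1) ((reg v).eval μ)) r (.const 0)
    simp only [eval_reg, Expr.eval] at h1 h2
    obtain ⟨τ, t, h, ht, hI⟩ := run_forLoop (c := r + 2) (v := v) (b := 0) (m := σ 0 0)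
      (T := e.cost N + 7)
      (body := .seq (e.compile (r + 4)) (setReg r (.add (reg r) (reg (r + 4)))))
      -- Register $r$ carries the partial sum and register $r+1$ the old value of the variable, to
      -- be restored after the loop.
      (fun i ν => (∀ a < r, a ≠ v → ν a = μ a) ∧ (∀ j, j ≠ 0 → ν v j = μ v j) ∧
        ν r 0 = ∑ j ∈ Finset.range i, e.eval (σ.set v j) ∧ ν (r + 1) 0 = μ v 0)
      (σ := (μ.set (r + 1) (μ v 0)).set r 0) (by
        rw [Memory.set_of_ne _ _ (by omega), Memory.set_of_ne _ _ (by omega), hμ 0 (by omega)])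
      (by omega) (by
        refine ⟨fun a ha _ => ?_, fun j hj => ?_, ?_, ?_⟩
        · rw [Memory.set_of_ne _ _ (by omega), Memory.set_of_ne _ _ (by omega),
            Memory.set_of_ne _ _ (by omega), Memory.set_of_ne _ _ (by omega)]
        · rw [Memory.set_of_ne _ _ (by omega), Memory.set_of_ne _ _ (by omega),
            Memory.set_of_ne _ _ (by omega), Memory.set_of_ne _ _ (by omega)]
        · rw [Memory.set_of_ne _ _ (by omega), Memory.set_of_ne _ _ (by omega)]
          simp
        · rw [Memory.set_of_ne _ _ (by omega), Memory.set_of_ne _ _ (by omega),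
            Memory.set_of_ne _ _ (by omega)]
          simp) (by
        rintro i hi ν ⟨hν1, hν2, hν3, hν4⟩ hνc hνc'
        obtain ⟨ρ, s, hρ, hs, hρv, hρlt⟩ := Tm.run (N := N) e he (r + 4) (by omega) (σ.set v i) (ν.set v i)
          (by
            intro a ha
            by_cases hav : a = v
            · subst hav
              funext j
              by_cases hj : j = 0
              · subst hj; simp
              · rw [Memory.set_cell_of_ne _ _ _ hj, Memory.set_cell_of_ne _ _ _ hj, hν2 j hj,
                  hμ a ha]
            · rw [Memory.set_of_ne _ _ hav, Memory.set_of_ne _ _ hav, hν1 a (by omega) hav,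
                hμ a ha])
          (by rw [Memory.set_of_ne _ _ (Ne.symm hv0)]; exact hN)
        have keep : ∀ a < r + 4, a ≠ r → a ≠ v → (ρ.set r (ρ r 0 + ρ (r + 4) 0)) a = ν a := by
          intro a ha har hav
          rw [Memory.set_of_ne _ _ har, hρlt a ha, Memory.set_of_ne _ _ hav]
        refine ⟨_, _, Run.seq hρ (run_setReg ρ r _), ?_, ?_, ?_, ?_, ?_, ?_, ?_⟩
        · simp only [Expr.cost, reg]; omega
        · simp only [Expr.eval, eval_reg]
          rw [keep _ (by omega) (by omega) (by omega), hνc]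
        · simp only [Expr.eval, eval_reg]
          rw [keep _ (by omega) (by omega) (by omega), hνc']
        · intro a ha hav
          simp only [Expr.eval, eval_reg]
          rw [Memory.set_of_ne _ _ (by omega), keep a (by omega) (by omega) hav, hν1 a ha hav]
        · intro j hj
          rw [Memory.set_of_ne _ _ (by omega), Memory.set_of_ne _ _ (by omega),
            hρlt v (by omega), Memory.set_cell_of_ne _ _ _ hj, hν2 j hj]
        · rw [Memory.set_of_ne _ _ (by omega), Memory.set_self, Finset.sum_range_succ]
          simp only [Expr.eval, eval_reg]
          rw [hρlt r (by omega), Memory.set_of_ne _ _ (by omega), hν3, hρv]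
        · simp only [Expr.eval, eval_reg]
          rw [Memory.set_of_ne _ _ (by omega), keep _ (by omega) (by omega) (by omega), hν4])
    obtain ⟨hI1, hI2, hI3, hI4⟩ := hI
    have h4 := run_setReg τ v (reg (r + 1))
    simp only [eval_reg] at h4
    refine ⟨_, _, Run.seq h1 (Run.seq h2 (Run.seq h h4)), ?_, ?_, ?_⟩
    · simp only [Expr.cost, reg, Tm.cost]
      have : σ 0 0 * (e.cost N + 7 + 16) ≤ N * (e.cost N + 23) := Nat.mul_le_mul hN (by omega)
      omega
    · rw [Memory.set_of_ne _ _ (by omega), hI3]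
      rfl
    · intro a ha
      by_cases hav : a = v
      · subst hav
        funext j
        by_cases hj : j = 0
        · subst hj; simp [hI4]
        · rw [Memory.set_cell_of_ne _ _ _ hj, hI2 j hj]
      · rw [Memory.set_of_ne _ _ hav, hI1 a ha hav]

/-- Statements: assignment to a cell, simultaneous assignment to an initial segment of an array,
composition, and bounded loops. -/
inductive St : Type
  | set (a : ℕ) (i e : Tm)
  | bulk (b a v : ℕ) (e : Tm)
  | seq (s₁ s₂ : St)
  | loop (b v : ℕ) (s : St)

/-- Run `f` with `v` set to `0, …, m - 1`. -/
def iter (f : Memory → Memory) (v : ℕ) (σ : Memory) : ℕ → Memory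
  | 0 => σ
  | m + 1 => f ((iter f v σ m).set v m)

/-- The effect of a statement. -/
def St.eval : St → Memory → Memory
  | .set a i e, σ => Function.update σ a (Function.update (σ a) (i.eval σ) (e.eval σ))
  | .bulk b a v e, σ =>
      Function.update σ a fun i => if i < σ b 0 then e.eval (σ.set v i) else σ a i
  | .seq s₁ s₂, σ => s₂.eval (s₁.eval σ)
  | .loop b v s, σ => iter s.eval v σ (σ b 0)

/-- Only arrays below `64` occur, all loops are bounded by arrays in `B`, and these are not
written to. -/
def St.wf (B : List ℕ) : St → Bool
  | .set a i e => decide (a < 64) && decide (a ∉ B) && i.wf && e.wf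
  | .bulk b a v e => decide (b ∈ B) && decide (b < 64) && decide (a < 64) && decide (a ∉ B) &&
      decide (v < 64) && decide (v ∉ B) && decide (a ≠ v) && e.wf
  | .seq s₁ s₂ => s₁.wf B && s₂.wf B
  | .loop b v s => decide (b ∈ B) && decide (b < 64) && decide (v < 64) && decide (v ∉ B) && s.wf B

/-- The program for a statement, using registers from `r` on. -/
def St.compile : St → ℕ → Prog
  | .set a i e, r =>
      .seq (i.compile r) (.seq (e.compile (r + 1)) (.write a (reg r) (reg (r + 1))))
  -- Two passes: all values are first collected in the scratch array $r$, so that `e` always reads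
  -- the old contents of array $a$, and only then copied.
  | .bulk b a v e, r =>
      .seq (setReg (r + 1) (reg v))
        (.seq (forLoop (r + 2) v b (.seq (e.compile (r + 4)) (.write r (reg v) (reg (r + 4)))))
          (.seq (forLoop (r + 2) v b (.write a (reg v) (.read r (reg v))))
            (setReg v (reg (r + 1)))))
  | .seq s₁ s₂, r => .seq (s₁.compile r) (s₂.compile r)
  | .loop b v s, r => forLoop r v b (s.compile (r + 2))

/-- A bound for the running time of a compiled statement if all loop bounds are at most `N`. -/
def St.cost : St → ℕ → ℕ
  | .set _ i e, N => i.cost N + e.cost N + 5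
  | .bulk _ _ _ e, N => N * (e.cost N + 44) + 40
  | .seq s₁ s₂, N => s₁.cost N + s₂.cost N
  | .loop _ _ s, N => N * (s.cost N + 16) + 13

/-- Since bounds are never written to, an estimate for them that is true at the start remains true
throughout, which is what the running time needs. -/
theorem St.eval_of_mem {B : List ℕ} : ∀ (s : St), s.wf B = true → ∀ (σ : Memory), ∀ b ∈ B,
    s.eval σ b = σ b
  | .set a i e, h, σ, b, hb => by
    simp only [St.wf, Bool.and_eq_true, decide_eq_true_eq] at h
    have : b ≠ a := fun e => h.1.1.2 (e ▸ hb)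
    simp [St.eval, this]
  | .bulk b' a v e, h, σ, b, hb => by
    simp only [St.wf, Bool.and_eq_true, decide_eq_true_eq] at h
    have : b ≠ a := fun e => h.1.1.1.1.2 (e ▸ hb)
    simp [St.eval, this]
  | .seq s₁ s₂, h, σ, b, hb => by
    simp only [St.wf, Bool.and_eq_true] at h
    rw [St.eval, St.eval_of_mem s₂ h.2 _ b hb, St.eval_of_mem s₁ h.1 _ b hb]
  | .loop b' v s, h, σ, b, hb => by
    simp only [St.wf, Bool.and_eq_true, decide_eq_true_eq] at h
    have hbv : b ≠ v := fun e => h.1.2 (e ▸ hb)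
    rw [St.eval]
    generalize σ b' 0 = m
    induction m with
    | zero => rfl
    | succ m ih =>
      rw [iter, St.eval_of_mem s h.2 _ b hb, Memory.set_of_ne _ _ hbv, ih]

theorem iter_of_mem {B : List ℕ} {s : St} (hs : s.wf B = true) {v : ℕ} (hv : v ∉ B) (σ : Memory)
    (m : ℕ) {b : ℕ} (hb : b ∈ B) : iter s.eval v σ m b = σ b := by
  induction m with
  | zero => rfl
  | succ m ih =>
    rw [iter, St.eval_of_mem s hs _ b hb,
      Memory.set_of_ne _ _ (ne_of_mem_of_not_mem hb hv), ih]

/-- Unlike terms, statements change arrays below 64, so agreement with the total semantics replaces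
preservation there; scratch arrays below $r$ are kept because they hold the counters of enclosing
loops. -/
theorem St.run {N : ℕ} {B : List ℕ} (h0 : 0 ∈ B) : ∀ (s : St), s.wf B = true → ∀ r, 64 ≤ r →
    ∀ σ μ : Memory, (∀ a < 64, μ a = σ a) → (∀ b ∈ B, σ b 0 ≤ N) →
    ∃ τ t, Run (s.compile r) μ τ t ∧ t ≤ s.cost N ∧ (∀ a < 64, τ a = s.eval σ a) ∧
      ∀ a, 64 ≤ a → a < r → τ a = μ a
  | .set a i e, h, r, hr, σ, μ, hμ, hN => by
    simp only [St.wf, Bool.and_eq_true, decide_eq_true_eq] at h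
    obtain ⟨⟨⟨ha, haB⟩, hi⟩, he⟩ := h
    obtain ⟨τ₁, t₁, h₁, ht₁, hτ₁, hlt₁⟩ := Tm.run i hi r hr σ μ hμ (hN 0 h0)
    obtain ⟨τ₂, t₂, h₂, ht₂, hτ₂, hlt₂⟩ := Tm.run e he (r + 1) (by omega) σ τ₁
      (fun a ha => by rw [hlt₁ a (by omega), hμ a ha]) (hN 0 h0)
    have hag : ∀ x < r, τ₂ x = μ x := fun x hx => by rw [hlt₂ x (by omega), hlt₁ x hx]
    refine ⟨_, _, Run.seq h₁ (Run.seq h₂ (Run.write τ₂ a _ _)), ?_, ?_, ?_⟩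
    · simp only [Expr.cost, St.cost, reg]; omega
    · intro x hx
      simp only [eval_reg, hτ₂, hlt₂ r (by omega), hτ₁, St.eval]
      by_cases hxa : x = a
      · subst hxa
        simp [hag x (by omega), hμ x hx]
      · simp [hxa, hag x (by omega), hμ x hx]
    · intro x hx hxr
      rw [Function.update_of_ne (by omega), hag x hxr]
  | .seq s₁ s₂, h, r, hr, σ, μ, hμ, hN => by
    simp only [St.wf, Bool.and_eq_true] at h
    obtain ⟨τ₁, t₁, h₁, ht₁, hτ₁, hlt₁⟩ := St.run h0 s₁ h.1 r hr σ μ hμ hN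
    obtain ⟨τ₂, t₂, h₂, ht₂, hτ₂, hlt₂⟩ := St.run h0 s₂ h.2 r hr (s₁.eval σ) τ₁ hτ₁
      (fun b hb => by rw [St.eval_of_mem s₁ h.1 σ b hb]; exact hN b hb)
    refine ⟨_, _, Run.seq h₁ h₂, ?_, hτ₂, ?_⟩
    · simp only [St.cost]; omega
    · intro a ha har
      rw [hlt₂ a ha har, hlt₁ a ha har]
  | .loop b v s, h, r, hr, σ, μ, hμ, hN => by
    simp only [St.wf, Bool.and_eq_true, decide_eq_true_eq] at h
    obtain ⟨⟨⟨⟨hb, hb'⟩, hv⟩, hvB⟩, hs⟩ := h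
    obtain ⟨τ, t, hrun, ht, hI1, hI2⟩ := run_forLoop (c := r) (v := v) (b := b) (m := σ b 0)
      (T := s.cost N) (body := s.compile (r + 2))
      (fun i ν => (∀ a < 64, ν a = iter s.eval v σ i a) ∧ ∀ a, 64 ≤ a → a < r → ν a = μ a)
      (σ := μ) (by rw [hμ b hb']) (by omega) (by
        refine ⟨fun a ha => ?_, fun a ha har => ?_⟩
        · rw [Memory.set_of_ne _ _ (by omega), Memory.set_of_ne _ _ (by omega), hμ a ha, iter]
        · rw [Memory.set_of_ne _ _ (by omega), Memory.set_of_ne _ _ (by omega)]) (by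
        rintro i hi ν ⟨hν1, hν2⟩ hνc hνc'
        obtain ⟨ρ, t, hρ, ht, hρ1, hρ2⟩ := St.run (N := N) h0 s hs (r + 2) (by omega)
          ((iter s.eval v σ i).set v i) (ν.set v i) (by
            intro a ha
            have := hν1 a ha
            by_cases hav : a = v
            · subst hav; simp [Memory.set, this]
            · rw [Memory.set_of_ne _ _ hav, Memory.set_of_ne _ _ hav, this])
          (fun b hb => by
            rw [Memory.set_of_ne _ _ (ne_of_mem_of_not_mem hb hvB), iter_of_mem hs hvB _ _ hb]
            exact hN b hb)
        refine ⟨ρ, t, hρ, ht, ?_, ?_, ?_, ?_⟩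
        · rw [hρ2 r hr (by omega), Memory.set_of_ne _ _ (by omega), hνc]
        · rw [hρ2 (r + 1) (by omega) (by omega), Memory.set_of_ne _ _ (by omega), hνc']
        · intro a ha
          rw [Memory.set_of_ne _ _ (by omega), hρ1 a ha, iter]
        · intro a ha har
          rw [Memory.set_of_ne _ _ (by omega), hρ2 a ha (by omega),
            Memory.set_of_ne _ _ (by omega), hν2 a ha har])
    refine ⟨τ, t, hrun, ?_, hI1, hI2⟩
    rw [St.cost]
    have : σ b 0 * (s.cost N + 16) ≤ N * (s.cost N + 16) := Nat.mul_le_mul_right _ (hN b hb)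
    omega
  | .bulk b a v e, h, r, hr, σ, μ, hμ, hN => by
    simp only [St.wf, Bool.and_eq_true, decide_eq_true_eq] at h
    obtain ⟨⟨⟨⟨⟨⟨⟨hb, hb'⟩, ha⟩, haB⟩, hv⟩, hvB⟩, hav⟩, he⟩ := h
    have hv0 : 0 ≠ v := fun h => hvB (h ▸ h0)
    have hba : b ≠ a := fun h => haB (h ▸ hb)
    have hbv : b ≠ v := fun h => hvB (h ▸ hb)
    have h1 := run_setReg μ (r + 1) (reg v)
    simp only [eval_reg] at h1
    obtain ⟨τ, t, hrun, ht, hI1, hI2, hI3, hI4⟩ := run_forLoop (c := r + 2) (v := v) (b := b)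
      (m := σ b 0) (T := e.cost N + 5)
      (body := .seq (e.compile (r + 4)) (.write r (reg v) (reg (r + 4))))
      (fun i ν => (∀ x < r, x ≠ v → ν x = μ x) ∧ (∀ j, j ≠ 0 → ν v j = μ v j) ∧
        (∀ j < i, ν r j = e.eval (σ.set v j)) ∧ ν (r + 1) 0 = μ v 0)
      (σ := μ.set (r + 1) (μ v 0)) (by
        rw [Memory.set_of_ne _ _ (by omega), hμ b hb'])
      (by omega) (by
        refine ⟨fun x hx _ => ?_, fun j hj => ?_, fun j hj => absurd hj (Nat.not_lt_zero j), ?_⟩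
        · rw [Memory.set_of_ne _ _ (by omega), Memory.set_of_ne _ _ (by omega),
            Memory.set_of_ne _ _ (by omega)]
        · rw [Memory.set_of_ne _ _ (by omega), Memory.set_of_ne _ _ (by omega),
            Memory.set_of_ne _ _ (by omega)]
        · rw [Memory.set_of_ne _ _ (by omega), Memory.set_of_ne _ _ (by omega)]
          simp) (by
        rintro i hi ν ⟨hν1, hν2, hν3, hν4⟩ hνc hνc'
        obtain ⟨ρ, s, hρ, hs, hρv, hρlt⟩ := Tm.run (N := N) e he (r + 4) (by omega) (σ.set v i) (ν.set v i)
          (by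
            intro x hx
            by_cases hxv : x = v
            · subst hxv
              funext j
              by_cases hj : j = 0
              · subst hj; simp
              · rw [Memory.set_cell_of_ne _ _ _ hj, Memory.set_cell_of_ne _ _ _ hj, hν2 j hj,
                  hμ x hx]
            · rw [Memory.set_of_ne _ _ hxv, Memory.set_of_ne _ _ hxv, hν1 x (by omega) hxv,
                hμ x hx])
          (by rw [Memory.set_of_ne _ _ hv0]; exact hN 0 h0)
        have hρvi : ρ v 0 = i := by rw [hρlt v (by omega), Memory.set_self]
        refine ⟨_, _, Run.seq hρ (Run.write ρ r (reg v) (reg (r + 4))), ?_, ?_, ?_, ?_, ?_, ?_, ?_⟩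
        · simp only [Expr.cost, reg]; omega
        · rw [Function.update_of_ne (by omega), hρlt _ (by omega), Memory.set_of_ne _ _ (by omega),
            hνc]
        · rw [Function.update_of_ne (by omega), hρlt _ (by omega), Memory.set_of_ne _ _ (by omega),
            hνc']
        · intro x hx hxv
          rw [Memory.set_of_ne _ _ (by omega), Function.update_of_ne (by omega), hρlt _ (by omega),
            Memory.set_of_ne _ _ hxv, hν1 x hx hxv]
        · intro j hj
          rw [Memory.set_of_ne _ _ (by omega), Function.update_of_ne (by omega), hρlt _ (by omega),
            Memory.set_cell_of_ne _ _ _ hj, hν2 j hj]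
        · intro j hj
          rw [Memory.set_of_ne _ _ (by omega), Function.update_self]
          simp only [eval_reg, hρvi, hρv]
          by_cases hji : j = i
          · subst hji; simp
          · rw [Function.update_of_ne hji, hρlt r (by omega), Memory.set_of_ne _ _ (by omega),
              hν3 j (by omega)]
        · rw [Memory.set_of_ne _ _ (by omega), Function.update_of_ne (by omega),
            hρlt _ (by omega), Memory.set_of_ne _ _ (by omega), hν4])
    obtain ⟨τ', t', hrun', ht', hJ1, hJ2, hJ3, hJ4, hJ5⟩ := run_forLoop (c := r + 2) (v := v)
      (b := b) (m := σ b 0) (T := 7)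
      (body := .write a (reg v) (.read r (reg v)))
      (fun i ν => (∀ x < r, x ≠ v → x ≠ a → ν x = μ x) ∧ (∀ j, j ≠ 0 → ν v j = μ v j) ∧
        (∀ j < σ b 0, ν r j = e.eval (σ.set v j)) ∧ ν (r + 1) 0 = μ v 0 ∧
        ∀ j, ν a j = if j < i then e.eval (σ.set v j) else μ a j)
      (σ := τ) (by rw [hI1 b (by omega) hbv, hμ b hb'])
      (by omega) (by
        refine ⟨fun x hx hxv _ => ?_, fun j hj => ?_, fun j hj => ?_, ?_, fun j => ?_⟩
        · rw [Memory.set_of_ne _ _ (by omega), Memory.set_of_ne _ _ (by omega), hI1 x hx hxv]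
        · rw [Memory.set_of_ne _ _ (by omega), Memory.set_of_ne _ _ (by omega), hI2 j hj]
        · rw [Memory.set_of_ne _ _ (by omega), Memory.set_of_ne _ _ (by omega), hI3 j hj]
        · rw [Memory.set_of_ne _ _ (by omega), Memory.set_of_ne _ _ (by omega), hI4]
        · rw [Memory.set_of_ne _ _ (by omega), Memory.set_of_ne _ _ (by omega),
            hI1 a (by omega) hav]
          simp) (by
        rintro i hi ν ⟨hν1, hν2, hν3, hν4, hν5⟩ hνc hνc'
        refine ⟨_, _, Run.write _ a (reg v) (.read r (reg v)), ?_, ?_, ?_, ?_, ?_, ?_, ?_, ?_⟩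
        · simp only [Expr.cost, reg]; omega
        · rw [Function.update_of_ne (by omega), Memory.set_of_ne _ _ (by omega), hνc]
        · rw [Function.update_of_ne (by omega), Memory.set_of_ne _ _ (by omega), hνc']
        · intro x hx hxv hxa
          rw [Memory.set_of_ne _ _ (by omega), Function.update_of_ne hxa,
            Memory.set_of_ne _ _ hxv, hν1 x hx hxv hxa]
        · intro j hj
          rw [Memory.set_of_ne _ _ (by omega), Function.update_of_ne (Ne.symm hav),
            Memory.set_cell_of_ne _ _ _ hj, hν2 j hj]
        · intro j hj
          rw [Memory.set_of_ne _ _ (by omega), Function.update_of_ne (by omega),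
            Memory.set_of_ne _ _ (by omega), hν3 j hj]
        · rw [Memory.set_of_ne _ _ (by omega), Function.update_of_ne (by omega),
            Memory.set_of_ne _ _ (by omega), hν4]
        · intro j
          rw [Memory.set_of_ne _ _ (by omega), Function.update_self]
          simp only [eval_reg, Expr.eval, Memory.set_self,
            Memory.set_of_ne ν i hav]
          rw [Memory.set_of_ne _ _ (by omega), hν3 i hi]
          by_cases hji : j = i
          · subst hji; simp
          · rw [Function.update_of_ne hji, hν5 j]
            have : j < i ↔ j < i + 1 := by omega
            simp [this])
    have h4 := run_setReg τ' v (reg (r + 1))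
    simp only [eval_reg] at h4
    refine ⟨_, _, Run.seq h1 (Run.seq hrun (Run.seq hrun' h4)), ?_, ?_, ?_⟩
    · simp only [Expr.cost, reg, St.cost]
      have : σ b 0 * (e.cost N + 5 + 16) + σ b 0 * (7 + 16) ≤ N * (e.cost N + 44) := by
        rw [← mul_add]
        exact Nat.mul_le_mul (hN b hb) (by omega)
      omega
    · intro x hx
      by_cases hxv : x = v
      · subst hxv
        funext j
        simp only [St.eval, Function.update_of_ne (Ne.symm hav)]
        by_cases hj : j = 0
        · subst hj; simp [hJ4, hμ x hx]
        · rw [Memory.set_cell_of_ne _ _ _ hj, hJ2 j hj, hμ x hx]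
      · rw [Memory.set_of_ne _ _ hxv]
        by_cases hxa : x = a
        · subst hxa
          funext j
          rw [hJ5 j]
          simp [St.eval, hμ x hx]
        · rw [hJ1 x (by omega) hxv hxa]
          simp [St.eval, hxa, hμ x hx]
    · intro x hx hxr
      rw [Memory.set_of_ne _ _ (by omega), hJ1 x hxr (by omega) (by omega)]

/-! ### Polynomial running times -/

/-- Polynomially bounded functions. -/
def PolyBounded (f : ℕ → ℕ) : Prop := ∃ K d : ℕ, ∀ N, f N ≤ K * (N + 1) ^ d

theorem PolyBounded.const (c : ℕ) : PolyBounded fun _ => c := ⟨c, 0, fun N => by simp⟩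

theorem PolyBounded.id : PolyBounded fun N => N := ⟨1, 1, fun N => by simp⟩

theorem PolyBounded.add {f g : ℕ → ℕ} (hf : PolyBounded f) (hg : PolyBounded g) :
    PolyBounded fun N => f N + g N := by
  obtain ⟨K, d, hf⟩ := hf
  obtain ⟨L, e, hg⟩ := hg
  refine ⟨K + L, d + e, fun N => ?_⟩
  rw [add_mul]
  refine add_le_add ((hf N).trans ?_) ((hg N).trans ?_)
  · exact Nat.mul_le_mul_left _ (Nat.pow_le_pow_right (by omega) (by omega))
  · exact Nat.mul_le_mul_left _ (Nat.pow_le_pow_right (by omega) (by omega))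

theorem PolyBounded.mul {f g : ℕ → ℕ} (hf : PolyBounded f) (hg : PolyBounded g) :
    PolyBounded fun N => f N * g N := by
  obtain ⟨K, d, hf⟩ := hf
  obtain ⟨L, e, hg⟩ := hg
  refine ⟨K * L, d + e, fun N => ?_⟩
  calc f N * g N ≤ (K * (N + 1) ^ d) * (L * (N + 1) ^ e) := Nat.mul_le_mul (hf N) (hg N)
    _ = _ := by ring

theorem Tm.polyBounded_cost (e : Tm) : PolyBounded e.cost := by
  induction e with
  | const c => exact .const 3
  | rd a i ih => exact ih.add (.const 5)
  | add e₁ e₂ ih₁ ih₂ => exact (ih₁.add ih₂).add (.const 7)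
  | sub e₁ e₂ ih₁ ih₂ => exact (ih₁.add ih₂).add (.const 7)
  | ite c e₁ e₂ ih ih₁ ih₂ => exact ((ih.add ih₁).add ih₂).add (.const 3)
  | sum v e ih => exact (PolyBounded.id.mul (ih.add (.const 23))).add (.const 24)

theorem St.polyBounded_cost (s : St) : PolyBounded s.cost := by
  induction s with
  | set a i e => exact (i.polyBounded_cost.add e.polyBounded_cost).add (.const 5)
  | bulk b a v e => exact (PolyBounded.id.mul (e.polyBounded_cost.add (.const 44))).add (.const 40)
  | seq s₁ s₂ ih₁ ih₂ => exact ih₁.add ih₂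
  | loop b v s ih => exact (PolyBounded.id.mul (ih.add (.const 16))).add (.const 13)

end RAM

open Classical in
/-- The number of `i < n` with property `P`. -/
noncomputable def MetricDim.countBelow (n : ℕ) (P : ℕ → Prop) : ℕ :=
  ((Finset.range n).filter P).card

open Classical in
theorem MetricDim.countBelow_le (n : ℕ) (P : ℕ → Prop) : countBelow n P ≤ n :=
  (Finset.card_le_card (Finset.filter_subset _ _)).trans (Finset.card_range n).le

theorem MetricDim.countBelow_eq_card {n : ℕ} {P : ℕ → Prop} (s : Finset ℕ)
    (h : ∀ i, i ∈ s ↔ i < n ∧ P i) : countBelow n P = s.card := by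
  rw [countBelow]
  congr 1
  ext i
  simp [h]

namespace RAM

open MetricDim (countBelow countBelow_eq_card)

/-! ### Formulas -/

namespace Tm

/-- The first cell of an array. -/
def V (a : ℕ) : Tm := .rd a (.const 0)

/-- A term is true if it is not zero. -/
def Holds (e : Tm) (σ : Memory) : Prop := e.eval σ ≠ 0

def notT (e : Tm) : Tm := .sub (.const 1) e
def andT (e₁ e₂ : Tm) : Tm := .ite e₁ e₂ (.const 0)
def orT (e₁ e₂ : Tm) : Tm := .add e₁ e₂
def impT (e₁ e₂ : Tm) : Tm := .ite e₁ e₂ (.const 1)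
def iffT (e₁ e₂ : Tm) : Tm := .ite e₁ e₂ (notT e₂)
def ltT (e₁ e₂ : Tm) : Tm := .sub e₂ e₁
def leT (e₁ e₂ : Tm) : Tm := notT (.sub e₁ e₂)
def eqT (e₁ e₂ : Tm) : Tm := notT (.add (.sub e₁ e₂) (.sub e₂ e₁))
def allT (v : ℕ) (e : Tm) : Tm := notT (.sum v (notT e))
def countT (v : ℕ) (e : Tm) : Tm := .sum v (.ite e (.const 1) (.const 0))

/-- The least value of `w` for which `e` is true, or the first cell of array `0` if there is none;
`v` must not occur in `e`. -/
def leastT (v w : ℕ) (e : Tm) : Tm := countT v (notT (.sum w (andT (leT (V w) (V v)) e)))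

variable {σ : Memory} {e e₁ e₂ : Tm} {v : ℕ}

@[simp] theorem eval_V (a : ℕ) : (V a).eval σ = σ a 0 := rfl
@[simp] theorem eval_const (c : ℕ) : (const c).eval σ = c := rfl
@[simp] theorem eval_rd (a : ℕ) : (rd a e).eval σ = σ a (e.eval σ) := rfl
@[simp] theorem eval_add : (add e₁ e₂).eval σ = e₁.eval σ + e₂.eval σ := rfl
@[simp] theorem eval_sub : (sub e₁ e₂).eval σ = e₁.eval σ - e₂.eval σ := rfl

open Classical in
@[simp] theorem eval_ite : (ite e e₁ e₂).eval σ = if e.Holds σ then e₁.eval σ else e₂.eval σ := by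
  by_cases h : e.eval σ = 0 <;> simp [eval, Holds, h]

@[simp] theorem holds_not : (notT e).Holds σ ↔ ¬ e.Holds σ := by
  simp only [Holds, notT, eval_sub, eval_const]; omega

@[simp] theorem holds_and : (andT e₁ e₂).Holds σ ↔ e₁.Holds σ ∧ e₂.Holds σ := by
  simp only [andT, Holds, eval]; split_ifs <;> simp_all

@[simp] theorem holds_or : (orT e₁ e₂).Holds σ ↔ e₁.Holds σ ∨ e₂.Holds σ := by
  simp only [orT, Holds, eval]; omega

@[simp] theorem holds_imp : (impT e₁ e₂).Holds σ ↔ (e₁.Holds σ → e₂.Holds σ) := by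
  simp only [impT, Holds, eval]; split_ifs <;> simp_all

@[simp] theorem holds_iff : (iffT e₁ e₂).Holds σ ↔ (e₁.Holds σ ↔ e₂.Holds σ) := by
  simp only [iffT, notT, Holds, eval]; split_ifs <;> simp_all; omega

@[simp] theorem holds_lt : (ltT e₁ e₂).Holds σ ↔ e₁.eval σ < e₂.eval σ := by
  simp only [ltT, Holds, eval]; omega

@[simp] theorem holds_le : (leT e₁ e₂).Holds σ ↔ e₁.eval σ ≤ e₂.eval σ := by
  simp only [leT, notT, Holds, eval]; omega

@[simp] theorem holds_eq : (eqT e₁ e₂).Holds σ ↔ e₁.eval σ = e₂.eval σ := by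
  simp only [eqT, notT, Holds, eval]; omega

@[simp] theorem holds_sum : (sum v e).Holds σ ↔ ∃ i, i < σ 0 0 ∧ e.Holds (σ.set v i) := by
  simp [Holds, eval]

@[simp] theorem holds_all : (allT v e).Holds σ ↔ ∀ i, i < σ 0 0 → e.Holds (σ.set v i) := by
  simp [allT]

@[simp] theorem eval_count :
    (countT v e).eval σ = countBelow (σ 0 0) fun i => e.Holds (σ.set v i) := by
  rw [countBelow, Finset.card_filter]
  simp only [countT, eval, Holds]
  exact Finset.sum_congr rfl fun i _ => by split_ifs <;> simp_all

end Tm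

/-- The least number below `n` with property `P`, or `n` if there is none. -/
noncomputable def leastBelow (n : ℕ) (P : ℕ → Prop) : ℕ :=
  countBelow n fun i => ¬ ∃ j, j < n ∧ j ≤ i ∧ P j

/-- The numbers counted are those below the first witness, hence their number is that witness. The
default $n$ is not a vertex, so a comparison with $n$ tells whether the search succeeded. -/
theorem leastBelow_eq (n : ℕ) (P : ℕ → Prop) :
    (leastBelow n P = n ∧ ∀ i < n, ¬ P i) ∨ (leastBelow n P < n ∧ P (leastBelow n P)) := by
  classical
  by_cases h : ∃ i, i < n ∧ P i
  · right
    obtain ⟨h1, h2⟩ := Nat.find_spec h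
    have : leastBelow n P = Nat.find h := by
      rw [leastBelow, countBelow_eq_card (Finset.range (Nat.find h)), Finset.card_range]
      intro i
      rw [Finset.mem_range]
      constructor
      · intro hi
        refine ⟨hi.trans h1, ?_⟩
        rintro ⟨j, hj, hji, hP⟩
        exact Nat.find_min h (lt_of_le_of_lt hji hi) ⟨hj, hP⟩
      · rintro ⟨hi, hne⟩
        by_contra hle
        exact hne ⟨_, h1, not_lt.1 hle, h2⟩
    rw [this]
    exact ⟨h1, h2⟩
  · left
    push Not at h
    refine ⟨?_, h⟩
    rw [leastBelow, countBelow_eq_card (Finset.range n), Finset.card_range]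
    intro i
    rw [Finset.mem_range]
    refine ⟨fun hi => ⟨hi, ?_⟩, And.left⟩
    rintro ⟨j, hj, -, hP⟩
    exact h j hj hP

theorem Tm.eval_least {σ : Memory} {v w : ℕ} {e : Tm} {P : ℕ → Prop} (hv : v ≠ 0)
    (hwv : w ≠ v) (hP : ∀ i j, e.Holds ((σ.set v i).set w j) ↔ P j) :
    (leastT v w e).eval σ = leastBelow (σ 0 0) P := by
  simp [leastT, leastBelow, hP, hv.symm, hwv.symm]

/-! ### The graph in the memory -/

/-- Adjacency according to the matrix in array `2`. -/
def adjOf (σ : Memory) (i j : ℕ) : Prop := i < σ 0 0 ∧ j < σ 0 0 ∧ σ 2 (i * σ 0 0 + j) ≠ 0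

/-- The vertices in the set stored in array `3`. -/
def markOf (σ : Memory) (i : ℕ) : Prop := i < σ 0 0 ∧ σ 3 i ≠ 0

/-- The vertices in the set stored in array `4`. -/
def aliveOf (σ : Memory) (i : ℕ) : Prop := i < σ 0 0 ∧ σ 4 i ≠ 0

@[simp] theorem adjOf_set {σ : Memory} {v : ℕ} (i : ℕ) (h : 0 ≠ v) (h' : 2 ≠ v) :
    adjOf (σ.set v i) = adjOf σ := by
  funext a b; simp [adjOf, h, h']

@[simp] theorem markOf_set {σ : Memory} {v : ℕ} (i : ℕ) (h : 0 ≠ v) (h' : 3 ≠ v) :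
    markOf (σ.set v i) = markOf σ := by
  funext a; simp [markOf, h, h']

@[simp] theorem aliveOf_set {σ : Memory} {v : ℕ} (i : ℕ) (h : 0 ≠ v) (h' : 4 ≠ v) :
    aliveOf (σ.set v i) = aliveOf σ := by
  funext a; simp [aliveOf, h, h']

namespace Tm

variable {σ : Memory} {u v : ℕ}

/-- The product of the first cells of arrays `u` and `0`. -/
def mulT (u : ℕ) : Tm := .sum 63 (V u)

@[simp] theorem eval_mulT (hu : u ≠ 63) : (mulT u).eval σ = σ u 0 * σ 0 0 := by
  simp [mulT, eval, hu, mul_comm]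

def adjT (u v : ℕ) : Tm :=
  andT (ltT (V u) (V 0)) (andT (ltT (V v) (V 0)) (.rd 2 (.add (mulT u) (V v))))

@[simp] theorem holds_adj (hu : u ≠ 63) : (adjT u v).Holds σ ↔ adjOf σ (σ u 0) (σ v 0) := by
  simp only [adjT, holds_and, holds_lt, eval_V, adjOf]
  simp [Holds, hu]

def markT (u : ℕ) : Tm := andT (ltT (V u) (V 0)) (.rd 3 (V u))

@[simp] theorem holds_mark : (markT u).Holds σ ↔ markOf σ (σ u 0) := by
  simp only [markT, holds_and, holds_lt, eval_V, markOf]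
  simp [Holds]

def aliveT (u : ℕ) : Tm := andT (ltT (V u) (V 0)) (.rd 4 (V u))

@[simp] theorem holds_alive : (aliveT u).Holds σ ↔ aliveOf σ (σ u 0) := by
  simp only [aliveT, holds_and, holds_lt, eval_V, aliveOf]
  simp [Holds]

end Tm

end RAM

/-! ### The two rules on a set of numbers -/

namespace MetricDim

/-- A graph with a vertex set, on a finite set of numbers: all vertices are below `n`. -/
structure NatGraph where
  n : ℕ
  adj : ℕ → ℕ → Prop
  alive : ℕ → Prop
  mark : ℕ → Prop

namespace NatGraph

variable (Γ : NatGraph)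

/-- The number of `i < n` with property `P`. -/
noncomputable def count (P : ℕ → Prop) : ℕ := countBelow Γ.n P

def trueTwins (u v : ℕ) : Prop :=
  ∀ w, w < Γ.n → Γ.alive w → (w = u ∨ Γ.adj u w ↔ w = v ∨ Γ.adj v w)

def falseTwins (u v : ℕ) : Prop :=
  ∀ w, w < Γ.n → Γ.alive w → (Γ.adj u w ↔ Γ.adj v w)

def twinRule (u : ℕ) : Prop :=
  Γ.alive u ∧ ∃ v, v < Γ.n ∧ Γ.alive v ∧ ∃ w, w < Γ.n ∧ Γ.alive w ∧ u ≠ v ∧ u ≠ w ∧ v ≠ w ∧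
    ((Γ.trueTwins u v ∧ Γ.trueTwins u w ∧ Γ.trueTwins v w) ∨
      (Γ.falseTwins u v ∧ Γ.falseTwins u w ∧ Γ.falseTwins v w))

/-- `u` is in the clique of `a`. -/
def clique (a u : ℕ) : Prop := Γ.alive u ∧ ¬ Γ.mark u ∧ (u = a ∨ Γ.adj a u)

def sameType (u v : ℕ) : Prop :=
  ∀ x, x < Γ.n → Γ.alive x ∧ Γ.mark x → (Γ.adj u x ↔ Γ.adj v x)

noncomputable def typeCount (a u : ℕ) : ℕ := Γ.count fun w => Γ.clique a w ∧ Γ.sameType u w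

/-- Only types that occur in one of the two cliques are compared; any other type has multiplicity
zero in both. -/
def identical (a b : ℕ) : Prop :=
  ∀ u, u < Γ.n → Γ.clique a u ∨ Γ.clique b u → Γ.typeCount a u = Γ.typeCount b u

/-- The least vertex represents its clique, so that cliques can be counted by counting vertices. -/
def isMin (b : ℕ) : Prop := Γ.alive b ∧ ¬ Γ.mark b ∧ ∀ w, w < Γ.n → Γ.clique b w → b ≤ w

noncomputable def classSize (a : ℕ) : ℕ := Γ.count fun b => Γ.isMin b ∧ Γ.identical a b

noncomputable def markCount : ℕ := Γ.count fun x => Γ.alive x ∧ Γ.mark x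

def cliqueRule (a : ℕ) : Prop :=
  (∀ u, u < Γ.n → ¬ Γ.twinRule u) ∧ Γ.alive a ∧ ¬ Γ.mark a ∧
    2 ^ (Γ.markCount + 2) + Γ.markCount + 2 ≤ Γ.classSize a

/-- The order $u<w$ counts each unordered pair once. -/
noncomputable def twinPairs (a : ℕ) : ℕ := ∑ u ∈ Finset.range Γ.n, Γ.count fun w =>
  u < w ∧ Γ.clique a u ∧ Γ.clique a w ∧ Γ.trueTwins u w

end NatGraph

end MetricDim

namespace RAM

open MetricDim

/-- The graph and the vertex set in a memory. -/
def natGraph (σ : Memory) : NatGraph := ⟨σ 0 0, adjOf σ, aliveOf σ, markOf σ⟩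

@[simp] theorem natGraph_set {σ : Memory} {v : ℕ} (i : ℕ) (h : 4 < v) :
    natGraph (σ.set v i) = natGraph σ := by
  simp only [natGraph]
  rw [adjOf_set _ (by omega) (by omega), aliveOf_set _ (by omega) (by omega),
    markOf_set _ (by omega) (by omega), Memory.set_of_ne _ _ (by omega)]

namespace Tm

variable {σ : Memory} {u v : ℕ}

theorem natGraph_n : (natGraph σ).n = σ 0 0 := rfl
theorem natGraph_adj : (natGraph σ).adj = adjOf σ := rfl
theorem natGraph_alive : (natGraph σ).alive = aliveOf σ := rfl
theorem natGraph_mark : (natGraph σ).mark = markOf σ := rfl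

/-- To avoid capture, a formula that is used inside another one binds variables with higher numbers:
40 here, 39, 38, 37 and 36 further out, and 63 for products. -/
def trueTwinsT (u v : ℕ) : Tm :=
  allT 40 (impT (aliveT 40)
    (iffT (orT (eqT (V 40) (V u)) (adjT u 40)) (orT (eqT (V 40) (V v)) (adjT v 40))))

@[simp] theorem holds_trueTwinsT (hu : u < 40) (hv : v < 40) :
    (trueTwinsT u v).Holds σ ↔ (natGraph σ).trueTwins (σ u 0) (σ v 0) := by
  have h1 : u ≠ 40 := by omega
  have h2 : v ≠ 40 := by omega
  have h3 : u ≠ 63 := by omega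
  have h4 : v ≠ 63 := by omega
  simp [trueTwinsT, NatGraph.trueTwins, natGraph_n, natGraph_alive, natGraph_adj, h1, h2, h3, h4]

def falseTwinsT (u v : ℕ) : Tm :=
  allT 40 (impT (aliveT 40) (iffT (adjT u 40) (adjT v 40)))

@[simp] theorem holds_falseTwinsT (hu : u < 40) (hv : v < 40) :
    (falseTwinsT u v).Holds σ ↔ (natGraph σ).falseTwins (σ u 0) (σ v 0) := by
  have h1 : u ≠ 40 := by omega
  have h2 : v ≠ 40 := by omega
  have h3 : u ≠ 63 := by omega
  have h4 : v ≠ 63 := by omega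
  simp [falseTwinsT, NatGraph.falseTwins, natGraph_n, natGraph_alive, natGraph_adj, h1, h2, h3, h4]

def twinRuleT (u : ℕ) : Tm :=
  andT (aliveT u) (.sum 38 (andT (aliveT 38) (.sum 39 (andT (aliveT 39)
    (andT (notT (eqT (V u) (V 38))) (andT (notT (eqT (V u) (V 39)))
      (andT (notT (eqT (V 38) (V 39)))
        (orT (andT (trueTwinsT u 38) (andT (trueTwinsT u 39) (trueTwinsT 38 39)))
          (andT (falseTwinsT u 38) (andT (falseTwinsT u 39) (falseTwinsT 38 39)))))))))))

@[simp] theorem holds_twinRuleT (hu : u < 38) :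
    (twinRuleT u).Holds σ ↔ (natGraph σ).twinRule (σ u 0) := by
  have h1 : u ≠ 38 := by omega
  have h2 : u ≠ 39 := by omega
  have h3 : u < 40 := by omega
  simp [twinRuleT, NatGraph.twinRule, natGraph_n, natGraph_alive, h1, h2, h3]

def cliqueT (a u : ℕ) : Tm :=
  andT (aliveT u) (andT (notT (markT u)) (orT (eqT (V u) (V a)) (adjT a u)))

@[simp] theorem holds_cliqueT (hu : u < 63) :
    (cliqueT u v).Holds σ ↔ (natGraph σ).clique (σ u 0) (σ v 0) := by
  have h3 : u ≠ 63 := by omega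
  simp [cliqueT, NatGraph.clique, natGraph_alive, natGraph_adj, natGraph_mark, h3]

def sameTypeT (u v : ℕ) : Tm :=
  allT 40 (impT (andT (aliveT 40) (markT 40)) (iffT (adjT u 40) (adjT v 40)))

@[simp] theorem holds_sameTypeT (hu : u < 40) (hv : v < 40) :
    (sameTypeT u v).Holds σ ↔ (natGraph σ).sameType (σ u 0) (σ v 0) := by
  have h1 : u ≠ 40 := by omega
  have h2 : v ≠ 40 := by omega
  have h3 : u ≠ 63 := by omega
  have h4 : v ≠ 63 := by omega
  simp [sameTypeT, NatGraph.sameType, natGraph_n, natGraph_alive, natGraph_adj, natGraph_mark,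
    h1, h2, h3, h4]

def typeCountT (a u : ℕ) : Tm := countT 39 (andT (cliqueT a 39) (sameTypeT u 39))

@[simp] theorem eval_typeCountT (hu : u < 39) (hv : v < 39) :
    (typeCountT u v).eval σ = (natGraph σ).typeCount (σ u 0) (σ v 0) := by
  have h1 : u ≠ 39 := by omega
  have h2 : v ≠ 39 := by omega
  have h3 : u < 63 := by omega
  have h4 : v < 40 := by omega
  simp [typeCountT, NatGraph.typeCount, NatGraph.count, natGraph_n, h1, h2, h3, h4]

def identicalT (a b : ℕ) : Tm :=
  allT 38 (impT (orT (cliqueT a 38) (cliqueT b 38)) (eqT (typeCountT a 38) (typeCountT b 38)))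

@[simp] theorem holds_identicalT (hu : u < 38) (hv : v < 38) :
    (identicalT u v).Holds σ ↔ (natGraph σ).identical (σ u 0) (σ v 0) := by
  have h1 : u ≠ 38 := by omega
  have h2 : v ≠ 38 := by omega
  have h3 : u < 63 := by omega
  have h4 : v < 63 := by omega
  have h5 : u < 39 := by omega
  have h6 : v < 39 := by omega
  simp [identicalT, NatGraph.identical, natGraph_n, h1, h2, h3, h4, h5, h6]

def isMinT (b : ℕ) : Tm :=
  andT (aliveT b) (andT (notT (markT b)) (allT 38 (impT (cliqueT b 38) (leT (V b) (V 38)))))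

@[simp] theorem holds_isMinT (hu : u < 38) :
    (isMinT u).Holds σ ↔ (natGraph σ).isMin (σ u 0) := by
  have h1 : u ≠ 38 := by omega
  have h3 : u < 63 := by omega
  simp [isMinT, NatGraph.isMin, natGraph_n, natGraph_alive, natGraph_mark, h1, h3]

def classSizeT (a : ℕ) : Tm := countT 37 (andT (isMinT 37) (identicalT a 37))

@[simp] theorem eval_classSizeT (hu : u < 37) :
    (classSizeT u).eval σ = (natGraph σ).classSize (σ u 0) := by
  have h1 : u ≠ 37 := by omega
  have h3 : u < 38 := by omega
  simp [classSizeT, NatGraph.classSize, NatGraph.count, natGraph_n, h1, h3]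

def markCountT : Tm := countT 37 (andT (aliveT 37) (markT 37))

@[simp] theorem eval_markCountT : markCountT.eval σ = (natGraph σ).markCount := by
  simp [markCountT, NatGraph.markCount, NatGraph.count, natGraph_n, natGraph_alive, natGraph_mark]

/-- The clique rule, with the threshold in array `8`. -/
def cliqueRuleT (a : ℕ) : Tm :=
  andT (allT 37 (notT (twinRuleT 37))) (andT (aliveT a) (andT (notT (markT a))
    (leT (V 8) (classSizeT a))))

@[simp] theorem holds_cliqueRuleT (hu : u < 37)
    (h8 : σ 8 0 = 2 ^ ((natGraph σ).markCount + 2) + (natGraph σ).markCount + 2) :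
    (cliqueRuleT u).Holds σ ↔ (natGraph σ).cliqueRule (σ u 0) := by
  simp [cliqueRuleT, NatGraph.cliqueRule, natGraph_n, natGraph_alive, natGraph_mark, hu, h8]

def twinPairsT (a : ℕ) : Tm :=
  .sum 36 (countT 37 (andT (ltT (V 36) (V 37)) (andT (cliqueT a 36) (andT (cliqueT a 37)
    (trueTwinsT 36 37)))))

@[simp] theorem eval_twinPairsT (hu : u < 36) :
    (twinPairsT u).eval σ = (natGraph σ).twinPairs (σ u 0) := by
  have h1 : u ≠ 37 := by omega
  have h2 : u ≠ 36 := by omega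
  have h3 : u < 63 := by omega
  simp [twinPairsT, Tm.eval, NatGraph.twinPairs, NatGraph.count, natGraph_n, h1, h2, h3]

end Tm

end RAM

/-! ### Agreement of the numerical predicates with the graph notions -/

namespace MetricDim

open Classical in
/-- The clique of `G - X` that contains `a`. -/
noncomputable def cliqueAt {W : Type*} [Fintype W] (H : SimpleGraph W) (Y : Finset W) (a : W) :
    Finset W := Finset.univ.filter fun b => b ∉ Y ∧ (b = a ∨ H.Adj a b)

theorem mem_cliqueAt {W : Type*} [Fintype W] {H : SimpleGraph W} {Y : Finset W} {a b : W} :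
    b ∈ cliqueAt H Y a ↔ b ∉ Y ∧ (b = a ∨ H.Adj a b) := by simp [cliqueAt]

theorem IsClusterModulator.isCliqueOf_cliqueAt {W : Type*} [Fintype W] {H : SimpleGraph W}
    {Y : Finset W} (hY : IsClusterModulator H Y) {a : W} (ha : a ∉ Y) :
    IsCliqueOf H Y (cliqueAt H Y a) := by
  obtain ⟨C, hC, -, hmem⟩ := hY.exists_clique ha
  have : cliqueAt H Y a = C := by
    ext b; rw [mem_cliqueAt, hmem]
  rwa [this]

theorem IsCliqueOf.eq_cliqueAt {W : Type*} [Fintype W] {H : SimpleGraph W}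
    {Y C : Finset W} (hC : IsCliqueOf H Y C) {a : W} (ha : a ∈ C) : C = cliqueAt H Y a := by
  ext b
  rw [mem_cliqueAt]
  constructor
  · intro hb
    refine ⟨hC.notMem hb, ?_⟩
    by_cases h : b = a
    · exact Or.inl h
    · exact Or.inr (hC.adj ha hb (Ne.symm h))
  · rintro ⟨hb, rfl | h⟩
    · exact ha
    · exact hC.mem_of_adj ha hb h

/-- The numbers `e a` carry the graph `H` with the vertex set `Y`. -/
structure NatGraph.Models (Γ : NatGraph) {W : Type*} (H : SimpleGraph W) (Y : Finset W)
    (e : W → ℕ) : Prop where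
  inj : Function.Injective e
  lt : ∀ a, e a < Γ.n
  adj : ∀ a b, Γ.adj (e a) (e b) ↔ H.Adj a b
  alive : ∀ i, Γ.alive i ↔ ∃ a, e a = i
  mark : ∀ a, Γ.mark (e a) ↔ a ∈ Y

namespace NatGraph.Models

variable {Γ : NatGraph} {W : Type*} {H : SimpleGraph W} {Y : Finset W} {e : W → ℕ}

theorem alive_apply (h : Γ.Models H Y e) (a : W) : Γ.alive (e a) := (h.alive _).2 ⟨a, rfl⟩

theorem forall_alive (h : Γ.Models H Y e) {P : ℕ → Prop} :
    (∀ i, i < Γ.n → Γ.alive i → P i) ↔ ∀ a, P (e a) := by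
  constructor
  · exact fun hP a => hP _ (h.lt a) (h.alive_apply a)
  · intro hP i _ hi
    obtain ⟨a, rfl⟩ := (h.alive i).1 hi
    exact hP a

theorem exists_alive (h : Γ.Models H Y e) {P : ℕ → Prop} :
    (∃ i, i < Γ.n ∧ Γ.alive i ∧ P i) ↔ ∃ a, P (e a) := by
  constructor
  · rintro ⟨i, _, hi, hP⟩
    obtain ⟨a, rfl⟩ := (h.alive i).1 hi
    exact ⟨a, hP⟩
  · rintro ⟨a, hP⟩
    exact ⟨_, h.lt a, h.alive_apply a, hP⟩

theorem count_eq (h : Γ.Models H Y e) {P : ℕ → Prop} (s : Finset W)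
    (hP : ∀ i, P i → Γ.alive i) (hs : ∀ a, a ∈ s ↔ P (e a)) : Γ.count P = s.card := by
  rw [NatGraph.count, countBelow_eq_card (s.map ⟨e, h.inj⟩), Finset.card_map]
  intro i
  simp only [Finset.mem_map, Function.Embedding.coeFn_mk]
  constructor
  · rintro ⟨a, ha, rfl⟩
    exact ⟨h.lt a, (hs a).1 ha⟩
  · rintro ⟨-, hi⟩
    obtain ⟨a, rfl⟩ := (h.alive i).1 (hP i hi)
    exact ⟨a, (hs a).2 hi, rfl⟩

theorem trueTwins_iff (h : Γ.Models H Y e) (a b : W) :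
    Γ.trueTwins (e a) (e b) ↔ TrueTwins H a b := by
  rw [NatGraph.trueTwins, h.forall_alive
    (P := fun w => (w = e a ∨ Γ.adj (e a) w ↔ w = e b ∨ Γ.adj (e b) w))]
  simp [TrueTwins, Set.ext_iff, h.adj, h.inj.eq_iff]

theorem falseTwins_iff (h : Γ.Models H Y e) (a b : W) :
    Γ.falseTwins (e a) (e b) ↔ FalseTwins H a b := by
  rw [NatGraph.falseTwins, h.forall_alive (P := fun w => (Γ.adj (e a) w ↔ Γ.adj (e b) w))]
  simp [FalseTwins, Set.ext_iff, h.adj]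

theorem twinRule_iff (h : Γ.Models H Y e) (a : W) : Γ.twinRule (e a) ↔ TwinRule H a := by
  simp only [NatGraph.twinRule, h.alive_apply, true_and, h.exists_alive, TwinRule, TripleTwins,
    h.trueTwins_iff, h.falseTwins_iff, h.inj.eq_iff, ne_eq]

theorem clique_iff [Fintype W] (h : Γ.Models H Y e) (a b : W) :
    Γ.clique (e a) (e b) ↔ b ∈ cliqueAt H Y a := by
  simp [NatGraph.clique, mem_cliqueAt, h.alive_apply, h.mark, h.adj, h.inj.eq_iff]

theorem sameType_iff (h : Γ.Models H Y e) (a b : W) :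
    Γ.sameType (e a) (e b) ↔ nbhdIn H Y a = nbhdIn H Y b := by
  simp only [NatGraph.sameType, and_imp]
  rw [h.forall_alive (P := fun w => Γ.mark w → (Γ.adj (e a) w ↔ Γ.adj (e b) w)), nbhdIn_eq_iff]
  simp [h.adj, h.mark]

open Classical in
theorem typeCount_eq [Fintype W] (h : Γ.Models H Y e) (a b : W) :
    Γ.typeCount (e a) (e b) =
      Multiset.count (nbhdIn H Y b) (signature H Y (cliqueAt H Y a)) := by
  rw [signature_eq_map, Multiset.count_map]
  refine (h.count_eq ((cliqueAt H Y a).filter fun w => nbhdIn H Y b = nbhdIn H Y w) ?_ ?_)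
  · exact fun i hi => hi.1.1
  · intro w
    rw [Finset.mem_filter, h.clique_iff, h.sameType_iff]

theorem identical_iff [Fintype W] (h : Γ.Models H Y e) (a b : W) :
    Γ.identical (e a) (e b) ↔
      signature H Y (cliqueAt H Y a) = signature H Y (cliqueAt H Y b) := by
  classical
  constructor
  · intro hid
    ext T
    by_cases hT : ∃ u, (u ∈ cliqueAt H Y a ∨ u ∈ cliqueAt H Y b) ∧ nbhdIn H Y u = T
    · obtain ⟨u, hu, rfl⟩ := hT
      rw [← h.clique_iff, ← h.clique_iff] at hu
      have := hid (e u) (h.lt u) hu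
      rwa [h.typeCount_eq, h.typeCount_eq] at this
    · push Not at hT
      have key : ∀ c, (∀ u ∈ cliqueAt H Y c, nbhdIn H Y u ≠ T) →
          Multiset.count T (signature H Y (cliqueAt H Y c)) = 0 := by
        intro c hc
        rw [Multiset.count_eq_zero, signature_eq_map, Multiset.mem_map]
        rintro ⟨u, hu, hT⟩
        exact hc u hu hT
      rw [key a fun u hu => hT u (Or.inl hu), key b fun u hu => hT u (Or.inr hu)]
  · intro hs i _ hi
    have : Γ.alive i := by rcases hi with hi | hi <;> exact hi.1
    obtain ⟨u, rfl⟩ := (h.alive i).1 this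
    rw [h.typeCount_eq, h.typeCount_eq, hs]

theorem isMin_iff [Fintype W] (h : Γ.Models H Y e) (b : W) :
    Γ.isMin (e b) ↔ b ∉ Y ∧ ∀ w ∈ cliqueAt H Y b, e b ≤ e w := by
  have : (∀ w, w < Γ.n → Γ.clique (e b) w → e b ≤ w) ↔ ∀ w ∈ cliqueAt H Y b, e b ≤ e w := by
    constructor
    · exact fun hm w hw => hm _ (h.lt w) ((h.clique_iff b w).2 hw)
    · intro hm i _ hi
      obtain ⟨w, rfl⟩ := (h.alive i).1 hi.1
      exact hm w ((h.clique_iff b w).1 hi)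
  simp [NatGraph.isMin, h.alive_apply, h.mark, this]

/-- A clique and its least number determine each other, which gives a bijection from the counted
vertices to the class. -/
theorem classSize_eq [Fintype W] (h : Γ.Models H Y e) (hY : IsClusterModulator H Y) (a : W) :
    Γ.classSize (e a) = (cliqueClass H Y (cliqueAt H Y a)).ncard := by
  classical
  rw [NatGraph.classSize, h.count_eq (Finset.univ.filter fun b =>
    Γ.isMin (e b) ∧ Γ.identical (e a) (e b)) (fun i hi => hi.1.1) (by simp)]
  symm
  rw [← Set.ncard_coe_finset]
  have hself : ∀ b, b ∉ Y → b ∈ cliqueAt H Y b := fun b hb => mem_cliqueAt.2 ⟨hb, Or.inl rfl⟩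
  refine (Set.ncard_congr (fun b _ => cliqueAt H Y b) ?_ ?_ ?_).symm
  · intro b hb
    simp only [Finset.coe_filter, Finset.mem_univ, true_and, Set.mem_ofPred_eq, h.isMin_iff,
      h.identical_iff] at hb
    exact ⟨hY.isCliqueOf_cliqueAt hb.1.1, hb.2.symm⟩
  · intro b c hb hc hbc
    simp only [Finset.coe_filter, Finset.mem_univ, true_and, Set.mem_ofPred_eq, h.isMin_iff] at hb hc
    refine h.inj (le_antisymm (hb.1.2 c ?_) (hc.1.2 b ?_))
    · exact hbc ▸ hself c hc.1.1
    · exact hbc ▸ hself b hb.1.1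
  · intro D hD
    obtain ⟨b, hb, hmin⟩ := Finset.exists_min_image D e hD.1.1
    have hDb := hD.1.eq_cliqueAt hb
    refine ⟨b, ?_, hDb.symm⟩
    simp only [Finset.coe_filter, Finset.mem_univ, true_and, Set.mem_ofPred_eq, h.isMin_iff,
      h.identical_iff]
    exact ⟨⟨hD.1.notMem hb, by rwa [← hDb]⟩, by rw [← hDb]; exact hD.2.symm⟩

theorem markCount_eq (h : Γ.Models H Y e) : Γ.markCount = Y.card :=
  h.count_eq Y (fun _ hi => hi.1) fun a => by simp [h.alive_apply, h.mark]

theorem cliqueRule_iff [Fintype W] (h : Γ.Models H Y e) (hY : IsClusterModulator H Y) (a : W) :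
    Γ.cliqueRule (e a) ↔ a ∉ Y ∧ CliqueRule H Y (cliqueAt H Y a) := by
  have h3 : (∀ u, u < Γ.n → ¬ Γ.twinRule u) ↔ ∀ u, ¬ TwinRule H u := by
    constructor
    · exact fun ht u hu => ht _ (h.lt u) ((h.twinRule_iff u).2 hu)
    · intro ht i _ hi
      obtain ⟨u, rfl⟩ := (h.alive i).1 hi.1
      exact ht u ((h.twinRule_iff u).1 hi)
  rw [NatGraph.cliqueRule, h3, h.mark, h.classSize_eq hY, h.markCount_eq, CliqueRule]
  have := h.alive_apply a
  constructor
  · rintro ⟨h1, -, ha, h2⟩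
    exact ⟨ha, h1, hY.isCliqueOf_cliqueAt ha, h2⟩
  · rintro ⟨ha, h1, -, h2⟩
    exact ⟨h1, this, ha, h2⟩

theorem isReduced (h : Γ.Models H Y e) [Fintype W] (hY : IsClusterModulator H Y)
    (h1 : ∀ u, u < Γ.n → ¬ Γ.twinRule u) (h2 : ∀ a, a < Γ.n → ¬ Γ.cliqueRule a) :
    IsReduced H Y := by
  refine ⟨fun u hu => h1 _ (h.lt u) ((h.twinRule_iff u).2 hu), fun C hC => ?_⟩
  obtain ⟨a, ha⟩ := hC.2.1.1
  refine h2 _ (h.lt a) ((h.cliqueRule_iff hY a).2 ⟨hC.2.1.notMem ha, ?_⟩)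
  rwa [← hC.2.1.eq_cliqueAt ha]

theorem twinPairs_eq [Fintype W] (h : Γ.Models H Y e) (a : W) :
    Γ.twinPairs (e a) = MetricDim.twinPairs H (cliqueAt H Y a) := by
  classical
  obtain ⟨P, hP⟩ : ∃ P : W → W → Prop, ∀ u w, P u w ↔ (e u < e w ∧ u ∈ cliqueAt H Y a ∧
    w ∈ cliqueAt H Y a ∧ TrueTwins H u w) := ⟨_, fun u w => Iff.rfl⟩
  have h1 : ∀ u, (Γ.count fun w => e u < w ∧ Γ.clique (e a) (e u) ∧ Γ.clique (e a) w ∧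
      Γ.trueTwins (e u) w) = (Finset.univ.filter (P u)).card := by
    intro u
    refine h.count_eq _ (fun i hi => hi.2.2.1.1) fun w => ?_
    rw [Finset.mem_filter, hP, h.clique_iff, h.clique_iff, h.trueTwins_iff]
    simp
  have h2 : Γ.twinPairs (e a) = ∑ u : W, (Finset.univ.filter (P u)).card := by
    rw [NatGraph.twinPairs, ← Finset.sum_subset
      (s₁ := (Finset.univ.map ⟨e, h.inj⟩ : Finset ℕ))]
    · rw [Finset.sum_map]
      exact Finset.sum_congr rfl fun u _ => h1 u
    · intro i hi
      obtain ⟨u, -, rfl⟩ := Finset.mem_map.1 hi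
      exact Finset.mem_range.2 (h.lt u)
    · intro i _ hi
      rw [NatGraph.count, countBelow_eq_card ∅, Finset.card_empty]
      intro j
      simp only [Finset.notMem_empty, false_iff]
      rintro ⟨-, -, hc, -⟩
      obtain ⟨u, rfl⟩ := (h.alive i).1 hc.1
      exact hi (Finset.mem_map_of_mem _ (Finset.mem_univ u))
  rw [h2, ← Finset.card_sigma]
  refine Finset.card_bij (fun p _ => ({p.1, p.2} : Finset W)) ?_ ?_ ?_
  · rintro ⟨u, w⟩ hp
    simp only [Finset.mem_sigma, Finset.mem_univ, true_and, Finset.mem_filter, hP] at hp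
    simp only [Finset.mem_filter, Finset.mem_powersetCard]
    refine ⟨⟨?_, Finset.card_pair fun huw => ?_⟩, ?_⟩
    · simp [Finset.insert_subset_iff, hp.2.1, hp.2.2.1]
    · rw [huw] at hp; exact lt_irrefl _ hp.1
    · intro x hx y hy
      simp only [Finset.mem_insert, Finset.mem_singleton] at hx hy
      rcases hx with rfl | rfl <;> rcases hy with rfl | rfl
      exacts [rfl, hp.2.2.2, hp.2.2.2.symm, rfl]
  · rintro ⟨u, w⟩ hp ⟨u', w'⟩ hp' heq
    simp only [Finset.mem_sigma, Finset.mem_univ, true_and, Finset.mem_filter, hP] at hp hp'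
    have hl := hp.1
    have hl' := hp'.1
    have hu : u ∈ ({u', w'} : Finset W) := heq ▸ Finset.mem_insert_self u {w}
    have hw : w ∈ ({u', w'} : Finset W) := by
      have : w ∈ ({u, w} : Finset W) := by simp
      rwa [show ({u, w} : Finset W) = {u', w'} from heq] at this
    simp only [Finset.mem_insert, Finset.mem_singleton] at hu hw
    rcases hu with rfl | rfl <;> rcases hw with rfl | rfl
    · exact absurd hl (lt_irrefl _)
    · rfl
    · exact absurd hl (lt_asymm hl')
    · exact absurd hl (lt_irrefl _)
  · intro p hp
    simp only [Finset.mem_filter, Finset.mem_powersetCard, Finset.card_eq_two] at hp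
    obtain ⟨⟨hpC, u, w, huw, rfl⟩, ht⟩ := hp
    have hu := hpC (Finset.mem_insert_self u {w})
    have hw := hpC (show w ∈ ({u, w} : Finset W) by simp)
    have hne : e u ≠ e w := fun h' => huw (h.inj h')
    rcases lt_or_gt_of_ne hne with hlt | hlt
    · refine ⟨⟨u, w⟩, ?_, rfl⟩
      simp only [Finset.mem_sigma, Finset.mem_univ, true_and, Finset.mem_filter, hP]
      exact ⟨hlt, hu, hw, ht u (by simp) w (by simp)⟩
    · refine ⟨⟨w, u⟩, ?_, Finset.pair_comm w u⟩
      simp only [Finset.mem_sigma, Finset.mem_univ, true_and, Finset.mem_filter, hP]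
      exact ⟨hlt, hw, hu, ht w (by simp) u (by simp)⟩

end NatGraph.Models

end MetricDim

namespace MetricDim

/-! ### Sequences of rule applications -/

theorem mem_restrict {V : Type*} {X : Finset V} {A : Set V} {a : A} :
    a ∈ restrict X A ↔ a.val ∈ X := by simp [restrict]

theorem IsClusterModulator.restrict {V : Type*} {G : SimpleGraph V} {X : Finset V}
    (hX : IsClusterModulator G X) (A : Set V) :
    IsClusterModulator (G.induce A) (restrict X A) := by
  intro u v huv hne
  let f : (G.induce A).induce ((MetricDim.restrict X A : Set A)ᶜ) →g G.induce ((X : Set V)ᶜ) :=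
    { toFun := fun x => ⟨x.1.1, fun h => x.2 (mem_restrict.2 h)⟩
      map_rel' := fun {x y} h => by simpa using h }
  have h := hX (f u) (f v) (huv.map f) (fun h => hne (by
    have := congrArg Subtype.val h
    exact Subtype.ext (Subtype.ext this)))
  exact h

theorem Step.safe {V : Type*} [Fintype V] {G : SimpleGraph V} {X : Finset V}
    (hX : IsClusterModulator G X) {p q : Set V × ℤ} (h : Step G X p q) :
    HasResolvingSet (G.induce p.1) p.2 ↔ HasResolvingSet (G.induce q.1) q.2 := by
  classical
  cases h with
  | twin A j u hu =>
    have : Subtype.val '' ({u}ᶜ : Set A) = A \ {u.val} := by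
      ext x
      simp only [Set.mem_image, Set.mem_compl_iff, Set.mem_singleton_iff, Subtype.exists,
        exists_and_right, exists_eq_right, Set.mem_sdiff]
      exact ⟨fun ⟨hx, hne⟩ => ⟨hx, fun h => hne (Subtype.ext h)⟩,
        fun ⟨hx, hne⟩ => ⟨hx, fun h => hne (congrArg Subtype.val h)⟩⟩
    rw [twinRule_safe _ _ u hu, hasResolvingSet_iso (induceInduceIso G A _), this]
  | clique A j C hC =>
    have hAC : Subtype.val '' ((C : Set A)ᶜ) = A \ Subtype.val '' (C : Set A) := by
      rw [Set.compl_eq_univ_sdiff, Set.image_sdiff Subtype.val_injective]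
      simp
    have : Fintype A := Fintype.ofFinite A
    rw [cliqueRule_safe _ _ _ C (hX.restrict A) hC, hasResolvingSet_iso (induceInduceIso G A _),
      hAC]

/-- This is what makes a nonpositive final budget conclusive: a twin rule leaves the other two
twins, and a clique rule leaves vertices in at least two other cliques of the class. -/
theorem Step.nontrivial {V : Type*} [Finite V] {G : SimpleGraph V} {X : Finset V}
    {p q : Set V × ℤ} (h : Step G X p q) : q.1.Nontrivial := by
  classical
  cases h with
  | twin A j u hu =>
    obtain ⟨v, w, huv, huw, hvw, -⟩ := hu
    refine ⟨v, ⟨v.2, ?_⟩, w, ⟨w.2, ?_⟩, fun h => hvw (Subtype.ext h)⟩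
    · exact fun h => huv (Subtype.ext h).symm
    · exact fun h => huw (Subtype.ext h).symm
  | clique A j C hC =>
    obtain ⟨-, hC, hcard⟩ := hC
    set 𝒞 := cliqueClass (G.induce A) (restrict X A) C
    have hpow : 0 < 2 ^ ((restrict X A).card + 2) := by positivity
    have h3 : 2 < 𝒞.ncard := by
      have : 4 ≤ 2 ^ ((restrict X A).card + 2) := by
        rw [pow_add]
        have : 0 < 2 ^ (restrict X A).card := by positivity
        omega
      omega
    have hfin : 𝒞.Finite := Set.toFinite _
    obtain ⟨D, hD, hDC⟩ : ∃ D ∈ 𝒞, D ∉ ({C} : Set (Finset A)) :=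
      Set.exists_mem_notMem_of_ncard_lt_ncard (by rw [Set.ncard_singleton]; omega)
    obtain ⟨E, hE, hEC⟩ : ∃ E ∈ 𝒞, E ∉ ({C, D} : Set (Finset A)) :=
      Set.exists_mem_notMem_of_ncard_lt_ncard (lt_of_le_of_lt
        ((Set.ncard_insert_le C {D}).trans (by rw [Set.ncard_singleton])) h3)
    simp only [Set.mem_insert_iff, Set.mem_singleton_iff, not_or] at hDC hEC
    obtain ⟨d, hd⟩ := hD.1.1
    obtain ⟨e, he⟩ := hE.1.1
    have out : ∀ F ∈ 𝒞, F ≠ C → ∀ f ∈ F, f.val ∈ A \ Subtype.val '' (C : Set A) := by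
      rintro F hF hne f hf
      refine ⟨f.2, ?_⟩
      rintro ⟨g, hg, hgf⟩
      have : g = f := Subtype.ext hgf
      exact hne (hF.1.eq_of_mem hC hf (this ▸ hg))
    refine ⟨d, out D hD hDC d hd, e, out E hE hEC.1 e he, fun h => ?_⟩
    have : d = e := Subtype.ext h
    exact hEC.2 (hE.1.eq_of_mem hD.1 he (this ▸ hd))

theorem Step.not_isReduced {V : Type*} {G : SimpleGraph V} {X : Finset V}
    {p q : Set V × ℤ} (h : Step G X p q) : ¬ IsReduced (G.induce p.1) (restrict X p.1) := by
  intro hred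
  cases h with
  | twin _ _ u hu => exact hred.1 u hu
  | clique _ _ C hC => exact hred.2 C hC

theorem steps_safe {V : Type*} [Fintype V] {G : SimpleGraph V} {X : Finset V}
    (hX : IsClusterModulator G X) {p q : Set V × ℤ} (h : Relation.ReflTransGen (Step G X) p q) :
    HasResolvingSet (G.induce p.1) p.2 ↔ HasResolvingSet (G.induce q.1) q.2 := by
  induction h with
  | refl => rfl
  | tail _ h ih => exact ih.trans (h.safe hX)

theorem steps_eq_or_nontrivial {V : Type*} [Finite V] {G : SimpleGraph V} {X : Finset V}
    {p q : Set V × ℤ} (h : Relation.ReflTransGen (Step G X) p q) : p = q ∨ q.1.Nontrivial := by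
  cases h with
  | refl => exact Or.inl rfl
  | tail _ h => exact Or.inr h.nontrivial

theorem hasResolvingSet_induce_univ {V : Type*} {G : SimpleGraph V} {k : ℤ} :
    HasResolvingSet (G.induce Set.univ) k ↔ HasResolvingSet G k :=
  hasResolvingSet_iso (SimpleGraph.induceUnivIso G)

theorem not_hasResolvingSet_of_nontrivial {V : Type*} [Nontrivial V] {G : SimpleGraph V} {k : ℤ}
    (hk : k ≤ 0) : ¬ HasResolvingSet G k := by
  rintro ⟨S, hS, hc⟩
  have : S = ∅ := Finset.card_eq_zero.1 (by omega)
  obtain ⟨a, b, hab⟩ := exists_pair_ne V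
  obtain ⟨s, hs, -⟩ := hS a b hab
  simp [this] at hs

end MetricDim

namespace RAM

open MetricDim Tm

/-! ### The reduction program -/

/-- Assignment to the first cell of an array. -/
def assign (a : ℕ) (e : Tm) : St := .set a (.const 0) e

@[simp] theorem eval_assign (a : ℕ) (e : Tm) (σ : Memory) :
    (assign a e).eval σ = σ.set a (e.eval σ) := rfl

theorem eval_seq (s t : St) (σ : Memory) : (St.seq s t).eval σ = t.eval (s.eval σ) := rfl

theorem natGraph_congr {σ τ : Memory} (h : ∀ a < 5, τ a = σ a) : natGraph τ = natGraph σ := by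
  simp only [natGraph, NatGraph.mk.injEq]
  refine ⟨by rw [h 0 (by omega)], ?_, ?_, ?_⟩
  · funext i j; simp only [adjOf, h 0 (by omega), h 2 (by omega)]
  · funext i; simp only [aliveOf, h 0 (by omega), h 4 (by omega)]
  · funext i; simp only [markOf, h 0 (by omega), h 3 (by omega)]

/-- Double array `9` if the loop variable is below array `10`. -/
def doubleSt : St := assign 9 (.ite (ltT (V 33) (V 10)) (.add (V 9) (V 9)) (V 9))

/-- Find a vertex for the twin rule, and compute the threshold of the clique rule. -/
def prepareSt : St :=
  .seq (assign 6 (leastT 34 35 (twinRuleT 35))) (.seq (assign 10 markCountT)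
    (.seq (assign 9 (.const 4))
      (.seq (.loop 0 33 doubleSt)
        (assign 8 (.add (.add (V 9) (V 10)) (.const 2))))))

/-- Find a clique for the clique rule, and apply one of the rules if possible. -/
def applySt : St :=
  .seq (assign 7 (leastT 34 35 (cliqueRuleT 35)))
    (.seq (assign 11 (.ite (ltT (V 7) (V 0)) (twinPairsT 7) (.const 0)))
      (.seq (assign 5 (.ite (ltT (V 6) (V 0)) (.add (V 5) (.const 1))
          -- In truncated subtraction, $t+(1-t)$ equals $\max\{1,t\}$.
          (.ite (ltT (V 7) (V 0)) (.add (V 5) (.add (V 11) (.sub (.const 1) (V 11)))) (V 5))))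
        (.bulk 0 4 32 (andT (aliveT 32) (andT (notT (eqT (V 32) (V 6)))
          (notT (andT (ltT (V 7) (V 0)) (cliqueT 7 32))))))))

/-- Apply both rules exhaustively, starting with all vertices. -/
def reduceSt : St :=
  .seq (.bulk 0 4 32 (.const 1)) (.seq (assign 5 (.const 0))
    (.loop 0 31 (.seq prepareSt applySt)))

theorem wf_reduceSt : reduceSt.wf [0] = true := by decide

theorem markCount_le (Γ : NatGraph) : Γ.markCount ≤ Γ.n := by
  exact countBelow_le _ _

theorem eval_prepareSt (σ : Memory) :
    (∀ a < 6, prepareSt.eval σ a = σ a) ∧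
    prepareSt.eval σ 6 0 = leastBelow (σ 0 0) (natGraph σ).twinRule ∧
    prepareSt.eval σ 8 0 = 2 ^ ((natGraph σ).markCount + 2) + (natGraph σ).markCount + 2 := by
  have h6 : (leastT 34 35 (twinRuleT 35)).eval σ =
      leastBelow (σ 0 0) (natGraph σ).twinRule :=
    eval_least (by omega) (by omega) (by simp)
  set x := (natGraph σ).markCount with hx
  set τ := ((σ.set 6 (leastBelow (σ 0 0) (natGraph σ).twinRule)).set 10 x).set 9 4 with hτ
  have hτ0 : τ 0 0 = σ 0 0 := by simp [hτ]
  -- The loop runs $n$ times, but doubling stops after $x$ rounds; since $x\le n$, the result is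
  -- $4\cdot 2^x$.
  have hloop : ∀ m, let ρ := iter doubleSt.eval 33 τ m;
      (∀ a, a ≠ 9 → a ≠ 33 → ρ a = τ a) ∧ ρ 9 0 = 2 ^ (min m x + 2) := by
    intro m
    induction m with
    | zero => simp [iter, hτ]
    | succ m ih =>
      simp only [iter, doubleSt, eval_assign] at ih ⊢
      obtain ⟨ih1, ih2⟩ := ih
      refine ⟨fun a h9 h33 => ?_, ?_⟩
      · rw [Memory.set_of_ne _ _ h9, Memory.set_of_ne _ _ h33, ih1 a h9 h33]
      · have h10 : τ 10 0 = x := by simp [hτ]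
        simp only [Memory.set_self, eval_ite, holds_lt, eval_V, eval_add]
        rw [Memory.set_of_ne _ _ (by omega), Memory.set_of_ne _ _ (by omega),
          ih1 10 (by omega) (by omega), h10, ih2]
        split_ifs with h
        · rw [min_eq_left h.le, min_eq_left (show m + 1 ≤ x by omega)]
          ring
        · rw [min_eq_right (not_lt.1 h), min_eq_right (by omega)]
  obtain ⟨h1, h2⟩ := hloop (σ 0 0)
  have hev : prepareSt.eval σ =
      (iter doubleSt.eval 33 τ (σ 0 0)).set 8
      (2 ^ (min (σ 0 0) x + 2) + x + 2) := by
    simp only [prepareSt, St.eval, eval_assign, h6, eval_markCountT]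
    rw [natGraph_set _ (by omega)]
    simp only [eval_const]
    rw [← hx, ← hτ, hτ0]
    congr 1
    simp only [eval_add, eval_V, eval_const, h2]
    rw [h1 10 (by omega) (by omega)]
    simp [hτ]
  have hmin : min (σ 0 0) x = x := min_eq_right (markCount_le _)
  rw [hev, hmin]
  refine ⟨fun a ha => ?_, ?_, by simp⟩
  · rw [Memory.set_of_ne _ _ (by omega), h1 a (by omega) (by omega), hτ,
      Memory.set_of_ne _ _ (by omega), Memory.set_of_ne _ _ (by omega),
      Memory.set_of_ne _ _ (by omega)]
  · rw [Memory.set_of_ne _ _ (by omega), h1 6 (by omega) (by omega), hτ]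
    simp

theorem eval_applySt {σ : Memory} {u : ℕ} (hu : σ 6 0 = u)
    (h8 : σ 8 0 = 2 ^ ((natGraph σ).markCount + 2) + (natGraph σ).markCount + 2) :
    let a := leastBelow (σ 0 0) (natGraph σ).cliqueRule
    (∀ b < 4, applySt.eval σ b = σ b) ∧
    applySt.eval σ 5 0 = (if u < σ 0 0 then σ 5 0 + 1 else
      if a < σ 0 0 then σ 5 0 + max 1 ((natGraph σ).twinPairs a) else σ 5 0) ∧
    ∀ i, aliveOf (applySt.eval σ) i ↔
      aliveOf σ i ∧ i ≠ u ∧ ¬ (a < σ 0 0 ∧ (natGraph σ).clique a i) := by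
  intro a
  have h7 : (leastT 34 35 (cliqueRuleT 35)).eval σ = a := by
    refine eval_least (by omega) (by omega) (fun i j => ?_)
    rw [holds_cliqueRuleT (by omega) (by simpa using h8)]
    simp
  set t := if a < σ 0 0 then (natGraph σ).twinPairs a else 0 with ht
  set τ := ((σ.set 7 a).set 11 t).set 5 (if u < σ 0 0 then σ 5 0 + 1 else
      if a < σ 0 0 then σ 5 0 + max 1 ((natGraph σ).twinPairs a) else σ 5 0) with hτ
  have hev : applySt.eval σ = (St.bulk 0 4 32 (andT (aliveT 32) (andT (notT (eqT (V 32) (V 6)))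
          (notT (andT (ltT (V 7) (V 0)) (cliqueT 7 32)))))).eval τ := by
    rw [applySt, eval_seq, eval_seq, eval_seq, eval_assign, eval_assign, eval_assign, h7]
    congr 1
    have h11 : (ite (ltT (V 7) (V 0)) (twinPairsT 7) (const 0)).eval (σ.set 7 a) = t := by
      simp [ht]
    rw [h11, hτ]
    congr 1
    simp [hu, ht]
    split_ifs
    · rfl
    · omega
    · rfl
  have hτ4 : ∀ b < 5, τ b = σ b := by
    intro b hb
    rw [hτ, Memory.set_of_ne _ _ (by omega), Memory.set_of_ne _ _ (by omega),
      Memory.set_of_ne _ _ (by omega)]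
  have hΓ : natGraph τ = natGraph σ := natGraph_congr hτ4
  have halive : aliveOf τ = aliveOf σ := congrArg NatGraph.alive hΓ
  have h76 : τ 7 0 = a ∧ τ 6 0 = u := by simp [hτ, hu]
  rw [hev]
  refine ⟨fun b hb => ?_, ?_, fun i => ?_⟩
  · rw [St.eval, Function.update_of_ne (by omega), hτ4 b (by omega)]
  · rw [St.eval, Function.update_of_ne (by omega), hτ, Memory.set_self]
  · have h00 : τ 0 0 = σ 0 0 := by rw [hτ4 0 (by omega)]
    simp only [aliveOf, St.eval, Function.update_self]
    rw [Function.update_of_ne (by omega), h00]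
    constructor
    · rintro ⟨hi, h⟩
      rw [if_pos hi] at h
      change Holds _ _ at h
      simpa [halive, hΓ, h76, h00, aliveOf, hτ4 4 (by omega)] using h
    · rintro ⟨⟨hi, h⟩, h'⟩
      refine ⟨hi, ?_⟩
      rw [if_pos hi]
      change Holds _ _
      have h4 : σ 4 i ≠ 0 := h
      simpa [halive, hΓ, h76, h00, aliveOf, hi, hτ4 4 (by omega), h4] using h'

/-- The memory holds an instance with a vertex set `X`, and array `4` holds the vertex set `A`. -/
structure Holding (σ : Memory) {n : ℕ} (G : SimpleGraph (Fin n)) (X : Finset (Fin n))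
    (A : Set (Fin n)) : Prop where
  n_eq : σ 0 0 = n
  adj : ∀ a b : Fin n, adjOf σ a b ↔ G.Adj a b
  mark : ∀ a : Fin n, markOf σ a ↔ a ∈ X
  alive : ∀ a : Fin n, aliveOf σ a ↔ a ∈ A

theorem Holding.models {σ : Memory} {n : ℕ} {G : SimpleGraph (Fin n)} {X : Finset (Fin n)}
    {A : Set (Fin n)} (h : Holding σ G X A) :
    (natGraph σ).Models (G.induce A) (restrict X A) (fun a => a.val.val) where
  inj := fun a b hab => Subtype.ext (Fin.ext hab)
  lt := fun a => h.n_eq ▸ a.val.isLt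
  adj := fun a b => h.adj a b
  alive := fun i => by
    constructor
    · intro hi
      have hlt : i < n := h.n_eq ▸ hi.1
      exact ⟨⟨⟨i, hlt⟩, (h.alive ⟨i, hlt⟩).1 hi⟩, rfl⟩
    · rintro ⟨a, rfl⟩
      exact (h.alive a).2 a.2
  mark := fun a => by rw [mem_restrict]; exact h.mark a

theorem Holding.congr {σ τ : Memory} {n : ℕ} {G : SimpleGraph (Fin n)} {X : Finset (Fin n)}
    {A B : Set (Fin n)} (h : Holding σ G X A) (hτ : ∀ a < 4, τ a = σ a)
    (hB : ∀ a : Fin n, aliveOf τ a ↔ a ∈ B) : Holding τ G X B where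
  n_eq := by rw [hτ 0 (by omega)]; exact h.n_eq
  adj := fun a b => by
    rw [← h.adj]; simp only [adjOf, hτ 0 (by omega), hτ 2 (by omega)]
  mark := fun a => by
    rw [← h.mark]; simp only [markOf, hτ 0 (by omega), hτ 3 (by omega)]
  alive := hB

/-- One round of the reduction program applies a rule, unless the graph is reduced. -/
theorem Holding.round {σ : Memory} {n : ℕ} {G : SimpleGraph (Fin n)} {X : Finset (Fin n)}
    {A : Set (Fin n)} (h : Holding σ G X A) (hX : IsClusterModulator G X) (k : ℤ) :
    let τ := applySt.eval (prepareSt.eval σ)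
    (∀ a < 4, τ a = σ a) ∧
    ((∃ B, Holding τ G X B ∧ B ⊂ A ∧ Step G X (A, k - σ 5 0) (B, k - τ 5 0)) ∨
      (Holding τ G X A ∧ τ 5 0 = σ 5 0 ∧ IsReduced (G.induce A) (restrict X A))) := by
  classical
  intro τ
  have : Fintype A := Fintype.ofFinite A
  obtain ⟨p1, p2, p3⟩ := eval_prepareSt σ
  have hΓ : natGraph (prepareSt.eval σ) = natGraph σ := natGraph_congr fun a ha => p1 a (by omega)
  obtain ⟨q1, q2, q3⟩ := eval_applySt p2 (by rw [hΓ]; exact p3)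
  rw [hΓ, p1 0 (by omega), p1 5 (by omega)] at q2
  rw [hΓ, p1 0 (by omega)] at q3
  have hal : aliveOf (prepareSt.eval σ) = aliveOf σ := congrArg NatGraph.alive hΓ
  rw [hal] at q3
  have hτ : ∀ a < 4, τ a = σ a := fun a ha => by rw [← p1 a (by omega)]; exact q1 a ha
  refine ⟨hτ, ?_⟩
  have hm := h.models
  rcases leastBelow_eq (σ 0 0) (natGraph σ).twinRule with ⟨hu, hu'⟩ | ⟨hu, hu'⟩
  · rcases leastBelow_eq (σ 0 0) (natGraph σ).cliqueRule with ⟨ha, ha'⟩ | ⟨ha, ha'⟩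
    · right
      rw [if_neg (by omega), if_neg (by omega)] at q2
      refine ⟨h.congr hτ fun a => ?_, q2, hm.isReduced (hX.restrict A) hu' ha'⟩
      rw [q3, ← h.alive]
      have := a.isLt
      rw [hu, ha, h.n_eq]
      constructor
      · exact fun h => h.1
      · exact fun h => ⟨h, by omega, fun h' => absurd h'.1 (lt_irrefl _)⟩
    · left
      set a := leastBelow (σ 0 0) (natGraph σ).cliqueRule
      obtain ⟨a', ha''⟩ := (hm.alive a).1 ha'.2.1
      rw [← ha'', hm.cliqueRule_iff (hX.restrict A)] at ha'
      rw [if_neg (by omega), if_pos ha, ← ha'', hm.twinPairs_eq] at q2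
      refine ⟨A \ Subtype.val '' (cliqueAt (G.induce A) (restrict X A) a' : Set A),
        h.congr hτ fun b => ?_, ?_, ?_⟩
      · rw [q3, Set.mem_sdiff, ← h.alive, ← ha'']
        constructor
        · rintro ⟨h1, -, h2⟩
          refine ⟨h1, ?_⟩
          rintro ⟨c, hc, rfl⟩
          exact h2 ⟨hm.lt a', (hm.clique_iff a' c).2 hc⟩
        · rintro ⟨h1, h2⟩
          refine ⟨h1, ?_, ?_⟩
          · have := b.isLt
            rw [hu, h.n_eq]
            omega
          · rintro ⟨-, h3⟩
            exact h2 ⟨⟨b, (h.alive b).1 h1⟩, (hm.clique_iff a' ⟨b, (h.alive b).1 h1⟩).1 h3, rfl⟩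
      · refine ⟨Set.sdiff_subset, fun hsub => ?_⟩
        have hmem : a' ∈ cliqueAt (G.induce A) (restrict X A) a' :=
          mem_cliqueAt.2 ⟨ha'.1, Or.inl rfl⟩
        exact (hsub a'.2).2 ⟨a', hmem, rfl⟩
      · have hs := Step.clique (G := G) (X := X) A (k - σ 5 0) _ ha'.2
        have : k - (τ 5 0 : ℤ) = k - σ 5 0 -
            max 1 (MetricDim.twinPairs (G.induce A) (cliqueAt (G.induce A) (restrict X A) a') : ℤ) := by
          rw [show τ 5 0 = _ from q2]
          push_cast
          ring
        rw [this]
        exact hs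
  · left
    set u := leastBelow (σ 0 0) (natGraph σ).twinRule
    obtain ⟨u', hu''⟩ := (hm.alive u).1 hu'.1
    -- The clique rule demands that no twin rule is applicable, so its search fails and only the
    -- twin is deleted in this round.
    have hno : leastBelow (σ 0 0) (natGraph σ).cliqueRule = σ 0 0 := by
      rcases leastBelow_eq (σ 0 0) (natGraph σ).cliqueRule with ⟨ha, -⟩ | ⟨-, ha⟩
      · exact ha
      · exact absurd hu' (ha.1 u hu)
    rw [if_pos hu] at q2
    rw [hno] at q3
    refine ⟨A \ {u'.val}, h.congr hτ fun b => ?_, ?_, ?_⟩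
    · rw [q3, Set.mem_sdiff, ← h.alive, Set.mem_singleton_iff, Fin.ext_iff, ← hu'']
      simp
    · refine ⟨Set.sdiff_subset, fun hsub => ?_⟩
      exact (hsub u'.2).2 rfl
    · have hs := Step.twin (G := G) (X := X) A (k - σ 5 0) u'
        ((hm.twinRule_iff u').1 (hu'' ▸ hu'))
      have : k - (τ 5 0 : ℤ) = k - σ 5 0 - 1 := by
        rw [show τ 5 0 = _ from q2]
        push_cast
        ring
      rw [this]
      exact hs

/-- The reduction program applies the rules exhaustively. -/
theorem eval_reduceSt {σ : Memory} {n : ℕ} {G : SimpleGraph (Fin n)} {X : Finset (Fin n)}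
    (h0 : σ 0 0 = n) (hadj : ∀ a b : Fin n, σ 2 (a * n + b) ≠ 0 ↔ G.Adj a b)
    (hmark : ∀ a : Fin n, σ 3 a ≠ 0 ↔ a ∈ X) (hX : IsClusterModulator G X) (k : ℤ) :
    let τ := reduceSt.eval σ
    (∀ a < 4, τ a = σ a) ∧ ∃ A, Holding τ G X A ∧ IsReduced (G.induce A) (restrict X A) ∧
      Relation.ReflTransGen (Step G X) (Set.univ, k) (A, k - τ 5 0) := by
  classical
  set ρ := (assign 5 (.const 0)).eval ((St.bulk 0 4 32 (.const 1)).eval σ) with hρ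
  have hρ4 : ∀ a < 4, ρ a = σ a := by
    intro a ha
    rw [hρ, eval_assign, Memory.set_of_ne _ _ (by omega), St.eval,
      Function.update_of_ne (by omega)]
  have hH : Holding ρ G X Set.univ := by
    refine ⟨by rw [hρ4 0 (by omega), h0], fun a b => ?_, fun a => ?_, fun a => ?_⟩
    · simp only [adjOf, hρ4 0 (by omega), hρ4 2 (by omega), h0, hadj, a.isLt, b.isLt, true_and]
    · simp only [markOf, hρ4 0 (by omega), hρ4 3 (by omega), h0, hmark, a.isLt, true_and]
    · simp only [aliveOf, hρ4 0 (by omega), h0, a.isLt, true_and, Set.mem_univ, iff_true]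
      rw [hρ, eval_assign, Memory.set_of_ne _ _ (by omega), St.eval, Function.update_self]
      simp [h0]
  have key : ∀ m, let τ := iter (St.seq prepareSt applySt).eval 31 ρ m
      (∀ a < 4, τ a = σ a) ∧ ∃ A, Holding τ G X A ∧
        -- Each round reaches a reduced graph or loses a vertex, so $n$ rounds are enough; an empty
        -- graph is reduced as well.
        (IsReduced (G.induce A) (restrict X A) ∨ m + A.ncard ≤ n) ∧
        Relation.ReflTransGen (Step G X) (Set.univ, k) (A, k - τ 5 0) := by
    intro m
    induction m with
    | zero =>
      refine ⟨hρ4, Set.univ, hH, Or.inr ?_, ?_⟩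
      · simp
      · have : ρ 5 0 = 0 := by rw [hρ, eval_assign, Memory.set_self, eval_const]
        simp only [iter, this]
        simpa using Relation.ReflTransGen.refl
    | succ m ih =>
      simp only [iter] at ih ⊢
      set τ := iter (St.seq prepareSt applySt).eval 31 ρ m
      obtain ⟨ih1, A, hA, hA', hsteps⟩ := ih
      have hset : ∀ a < 6, (τ.set 31 m) a = τ a := fun a ha => Memory.set_of_ne _ _ (by omega)
      have hAset : Holding (τ.set 31 m) G X A :=
        hA.congr (fun a ha => hset a (by omega)) fun a => by
          rw [aliveOf_set _ (by omega) (by omega), hA.alive]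
      obtain ⟨r1, r2⟩ := hAset.round hX k
      rw [hset 5 (by omega)] at r2
      refine ⟨fun a ha => by rw [St.eval, r1 a ha, hset a (by omega), ih1 a ha], ?_⟩
      rcases r2 with ⟨B, hB, hBA, hstep⟩ | ⟨hA2, h5, hred⟩
      · refine ⟨B, hB, ?_, hsteps.tail hstep⟩
        rcases hA' with hred | hle
        · exfalso
          exact hstep.not_isReduced hred
        · right
          have := Set.ncard_lt_ncard hBA (Set.toFinite A)
          omega
      · refine ⟨A, hA2, Or.inl hred, ?_⟩
        rw [St.eval, h5]
        exact hsteps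
  obtain ⟨h1, A, hA, hA', hsteps⟩ := key n
  have hev : reduceSt.eval σ = iter (St.seq prepareSt applySt).eval 31 ρ n := by
    rw [reduceSt, eval_seq, eval_seq, ← hρ, St.eval, hρ4 0 (by omega), h0]
  intro τ
  have hτ : τ = iter (St.seq prepareSt applySt).eval 31 ρ n := hev
  rw [hτ]
  refine ⟨h1, A, hA, ?_, hsteps⟩
  rcases hA' with h | h
  · exact h
  · have : A = ∅ := by
      rw [← Set.ncard_eq_zero (Set.toFinite A)]
      omega
    subst this
    refine ⟨fun u => absurd u.2 (Set.notMem_empty _), fun C hC => ?_⟩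
    obtain ⟨c, -⟩ := hC.2.1.1
    exact absurd c.2 (Set.notMem_empty _)

end RAM

namespace RAM

open MetricDim Tm

/-! ### Renumbering the reduced graph -/

/-- Compute the budget, the rank of every vertex, the new number of vertices and its square. -/
def measureSt : St :=
  .seq (assign 12 (.sub (V 1) (V 5)))
    (.seq (.bulk 0 13 30 (countT 31 (andT (aliveT 31) (ltT (V 31) (V 30)))))
      -- Array 12 is nonzero exactly if budget is left. Otherwise the output is the triangle, with 3
      -- vertices and a matrix of 9 entries.
      (.seq (assign 20 (.ite (V 12) (countT 30 (aliveT 30)) (.const 3)))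
        (assign 21 (.ite (V 12) (.sum 30 (.ite (aliveT 30) (V 20) (.const 0))) (.const 9)))))

/-- Write the renumbered graph, vertex set and budget, or a fixed no-instance. -/
def writeSt : St :=
  .seq (.bulk 21 2 30 (.ite (V 12)
      (.ite (.sum 31 (andT (aliveT 31) (.sum 32 (andT (aliveT 32) (andT (adjT 31 32)
        (eqT (.add (.sum 33 (.ite (aliveT 33) (.rd 13 (V 31)) (.const 0))) (.rd 13 (V 32)))
          (V 30)))))))
        (.const 1) (.const 0))
      -- Positions 0, 4 and 8 are the diagonal of a 3 by 3 matrix.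
      (.ite (orT (eqT (V 30) (.const 0)) (orT (eqT (V 30) (.const 4)) (eqT (V 30) (.const 8))))
        (.const 0) (.const 1))))
    (.seq (.bulk 20 3 30 (.ite (andT (V 12) (.sum 31 (andT (aliveT 31) (andT (markT 31)
        (eqT (.rd 13 (V 31)) (V 30)))))) (.const 1) (.const 0)))
      (assign 1 (.ite (V 12)
        -- This is $\min(j,\max(1,m))$ in truncated subtraction. The inner maximum keeps the budget
        -- positive if $m=0$.
        (.sub (V 12) (.sub (V 12) (.add (V 20) (.sub (.const 1) (V 20))))) (.const 1))))

theorem wf_measureSt : measureSt.wf [0] = true := by decide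

theorem wf_writeSt : writeSt.wf [0, 20, 21] = true := by decide

/-- Multiplication by the number $m$ of remaining vertices, as a repeated sum; it gives $m^2$ and
the row offsets of the new matrix. -/
theorem eval_sum_alive {σ : Memory} {v x : ℕ} {c : Tm} (hv : 4 < v)
    (hc : ∀ i, c.eval (σ.set v i) = x) :
    (sum v (ite (aliveT v) c (const 0))).eval σ =
      (natGraph σ).count (natGraph σ).alive * x := by
  classical
  rw [NatGraph.count, countBelow_eq_card ((Finset.range (σ 0 0)).filter (aliveOf σ))]
  · rw [← smul_eq_mul, ← Finset.sum_const, Finset.sum_filter, Tm.eval]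
    refine Finset.sum_congr rfl fun i _ => ?_
    have : (aliveT v).Holds (σ.set v i) ↔ aliveOf σ i := by
      rw [holds_alive, aliveOf_set _ (by omega) (by omega), Memory.set_self]
    rw [eval_ite, hc, eval_const]
    simp only [this]
  · intro i
    simp [natGraph]

theorem eval_measureSt (σ : Memory) :
    let τ := measureSt.eval σ
    let m := (natGraph σ).count (natGraph σ).alive
    (∀ a < 6, τ a = σ a) ∧ τ 12 0 = σ 1 0 - σ 5 0 ∧
    (∀ i < σ 0 0, τ 13 i = (natGraph σ).count fun j => (natGraph σ).alive j ∧ j < i) ∧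
    (σ 5 0 < σ 1 0 → τ 20 0 = m ∧ τ 21 0 = m * m) ∧
    (¬ σ 5 0 < σ 1 0 → τ 20 0 = 3 ∧ τ 21 0 = 9) := by
  intro τ m
  set ρ := (St.bulk 0 13 30 (countT 31 (andT (aliveT 31) (ltT (V 31) (V 30))))).eval
    (σ.set 12 (σ 1 0 - σ 5 0)) with hρ
  have hρa : ∀ a < 12, ρ a = σ a := fun a ha => by
    rw [hρ, St.eval, Function.update_of_ne (by omega), Memory.set_of_ne _ _ (by omega)]
  have hρ12 : ρ 12 0 = σ 1 0 - σ 5 0 := by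
    rw [hρ, St.eval, Function.update_of_ne (by omega), Memory.set_self]
  have hΓ : natGraph ρ = natGraph σ := natGraph_congr fun a ha => hρa a (by omega)
  have hal : aliveOf ρ = aliveOf σ := congrArg NatGraph.alive hΓ
  have h13 : ∀ i < σ 0 0, ρ 13 i = (natGraph σ).count fun j => (natGraph σ).alive j ∧ j < i := by
    intro i hi
    rw [hρ, St.eval, Function.update_self]
    simp [hi, NatGraph.count, natGraph]
  obtain ⟨e20, he20⟩ : ∃ e, e = (ite (V 12) (countT 30 (aliveT 30)) (const 3)).eval ρ := ⟨_, rfl⟩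
  have hm : (countT 30 (aliveT 30)).eval ρ = m := by
    simp [hal, hρa 0 (by omega), m, NatGraph.count, natGraph]
  have hev : τ = (ρ.set 20 e20).set 21 ((ite (V 12) (sum 30 (ite (aliveT 30) (V 20) (const 0)))
      (const 9)).eval (ρ.set 20 e20)) := by
    rw [he20]
    rfl
  have hsum : (sum 30 (ite (aliveT 30) (V 20) (const 0))).eval (ρ.set 20 e20) = m * e20 := by
    rw [eval_sum_alive (x := e20) (by omega) fun i => by simp,
      natGraph_set _ (by omega), hΓ]
  refine ⟨fun a ha => ?_, ?_, fun i hi => ?_, fun h => ?_, fun h => ?_⟩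
  · rw [hev, Memory.set_of_ne _ _ (by omega), Memory.set_of_ne _ _ (by omega), hρa a (by omega)]
  · rw [hev, Memory.set_of_ne _ _ (by omega), Memory.set_of_ne _ _ (by omega), hρ12]
  · rw [hev, Memory.set_of_ne _ _ (by omega), Memory.set_of_ne _ _ (by omega), h13 i hi]
  · have h12 : (V 12).Holds ρ := by simp only [Holds, eval_V, hρ12]; omega
    have h12' : (V 12).Holds (ρ.set 20 e20) := by
      simp only [Holds, eval_V] at h12 ⊢
      rwa [Memory.set_of_ne _ _ (by omega)]
    have : e20 = m := by rw [he20, eval_ite, if_pos h12, hm]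
    rw [hev, Memory.set_self, Memory.set_of_ne _ _ (by omega), Memory.set_self, eval_ite,
      if_pos h12', hsum, this]
    exact ⟨rfl, rfl⟩
  · have h12 : ¬ (V 12).Holds ρ := by simp only [Holds, eval_V, hρ12]; omega
    have h12' : ¬ (V 12).Holds (ρ.set 20 e20) := by
      simp only [Holds, eval_V] at h12 ⊢
      rwa [Memory.set_of_ne _ _ (by omega)]
    have : e20 = 3 := by rw [he20, eval_ite, if_neg h12, eval_const]
    rw [hev, Memory.set_self, Memory.set_of_ne _ _ (by omega), Memory.set_self, eval_ite,
      if_neg h12', this]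
    exact ⟨rfl, rfl⟩

/-- The marks are written after array 2 has been overwritten; its new contents are left unspecified
because the term for the marks does not read them. -/
theorem eval_writeSt_mark (σ : Memory) : ∃ f, ∀ i, writeSt.eval σ 3 i =
    if i < σ 20 0 then (Tm.ite (andT (V 12) (.sum 31 (andT (aliveT 31) (andT (markT 31)
        (eqT (.rd 13 (V 31)) (V 30)))))) (.const 1) (.const 0)).eval
          (Memory.set (Function.update σ 2 f) 30 i) else σ 3 i :=
  ⟨_, fun _ => rfl⟩

theorem eval_writeSt_of_eq_zero {σ : Memory} (h12 : σ 12 0 = 0) (h20 : σ 20 0 = 3)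
    (h21 : σ 21 0 = 9) :
    let τ := writeSt.eval σ
    τ 20 0 = 3 ∧ τ 1 0 = 1 ∧ (∀ i l : Fin 3, τ 2 (i * 3 + l) = if i ≠ l then 1 else 0) ∧
      ∀ i : Fin 3, τ 3 i = 0 := by
  have h12' : ∀ i, ¬ (V 12).Holds (σ.set 30 i) := fun i => by simp [Holds, h12]
  refine ⟨?_, ?_, ?_, ?_⟩
  · simp [writeSt, St.eval, h20]
  · simp [writeSt, St.eval, Holds, h12]
  · intro i l
    simp only [writeSt, eval_seq, eval_assign]
    rw [Memory.set_of_ne _ _ (by omega)]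
    simp only [St.eval]
    rw [Function.update_of_ne (by omega), Function.update_self, h21, if_pos (by omega), eval_ite,
      if_neg (h12' _)]
    fin_cases i <;> fin_cases l <;> simp
  · intro i
    obtain ⟨f, hf⟩ := eval_writeSt_mark σ
    rw [hf, h20, if_pos i.isLt, eval_ite, if_neg, eval_const]
    rw [holds_and]
    refine fun h => absurd h.1 ?_
    simp [Holds, h12]

theorem eval_writeSt_of_pos {σ : Memory} {m : ℕ} (h12 : 0 < σ 12 0) (h20 : σ 20 0 = m)
    (h21 : σ 21 0 = m * m) (hm : (natGraph σ).count (natGraph σ).alive = m) :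
    let τ := writeSt.eval σ
    τ 20 0 = m ∧ τ 1 0 = min (σ 12 0) (max 1 m) ∧
    (∀ p < m * m, τ 2 p = open Classical in
      if ∃ u, u < σ 0 0 ∧ aliveOf σ u ∧ ∃ v, v < σ 0 0 ∧ aliveOf σ v ∧ adjOf σ u v ∧
        m * σ 13 u + σ 13 v = p then 1 else 0) ∧
    ∀ i < m, τ 3 i = open Classical in
      if ∃ u, u < σ 0 0 ∧ aliveOf σ u ∧ markOf σ u ∧ σ 13 u = i then 1 else 0 := by
  have h12' : ∀ i, (V 12).Holds (σ.set 30 i) := fun i => by simp [Holds]; omega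
  refine ⟨?_, ?_, ?_, ?_⟩
  · simp [writeSt, St.eval, h20]
  · have : (V 12).Holds σ := by simp [Holds]; omega
    simp only [Holds, eval_V] at this
    simp [writeSt, St.eval, Holds, this, h20]
    omega
  · intro p hp
    simp only [writeSt, eval_seq, eval_assign]
    rw [Memory.set_of_ne _ _ (by omega)]
    simp only [St.eval]
    rw [Function.update_of_ne (by omega), Function.update_self, h21, if_pos hp, eval_ite,
      if_pos (h12' _), eval_ite]
    simp only [eval_const]
    congr 1
    rw [eq_iff_iff]
    have hs : ∀ u v, (sum 33 (ite (aliveT 33) (rd 13 (V 31)) (const 0))).eval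
        (((σ.set 30 p).set 31 u).set 32 v) = m * σ 13 u := by
      intro u v
      rw [eval_sum_alive (x := σ 13 u) (by omega) fun i => by simp,
        natGraph_set _ (by omega), natGraph_set _ (by omega), natGraph_set _ (by omega), hm]
    simp [hs]
  · intro i hi
    obtain ⟨f, hf⟩ := eval_writeSt_mark σ
    rw [hf, h20, if_pos hi, eval_ite]
    simp only [eval_const]
    congr 1
    rw [eq_iff_iff, holds_and]
    have h12'' : ∀ f, (V 12).Holds (Memory.set (Function.update σ 2 f) 30 i) := fun f => by
      simp [Holds]; omega
    have h1 : ∀ f, aliveOf (Function.update σ 2 f) = aliveOf σ := fun f => by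
      funext u; simp [aliveOf]
    have h2 : ∀ f, markOf (Function.update σ 2 f) = markOf σ := fun f => by
      funext u; simp [markOf]
    rw [and_iff_right (h12'' _)]
    simp [h1, h2]

/-- The memory after renumbering describes the reduced graph, or a fixed no-instance. -/
theorem eval_output {σ : Memory} {n : ℕ} {G : SimpleGraph (Fin n)} {X : Finset (Fin n)}
    {A : Set (Fin n)} (h : Holding σ G X A) :
    let τ := writeSt.eval (measureSt.eval σ)
    (σ 5 0 < σ 1 0 → ∃ m, ∃ φ : Fin m ≃ A, τ 20 0 = m ∧
      τ 1 0 = min (σ 1 0 - σ 5 0) (max 1 m) ∧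
      (∀ i l : Fin m, τ 2 (i * m + l) = open Classical in
        if G.Adj (φ i) (φ l) then 1 else 0) ∧
      ∀ i : Fin m, τ 3 i = open Classical in if (φ i).val ∈ X then 1 else 0) ∧
    (¬ σ 5 0 < σ 1 0 → τ 20 0 = 3 ∧ τ 1 0 = 1 ∧
      (∀ i l : Fin 3, τ 2 (i * 3 + l) = if i ≠ l then 1 else 0) ∧ ∀ i : Fin 3, τ 3 i = 0) := by
  classical
  intro τ
  obtain ⟨q1, q2, q3, q4, q5⟩ := eval_measureSt σ
  refine ⟨fun hlt => ?_, fun hlt => ?_⟩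
  swap
  · obtain ⟨h20, h21⟩ := q5 hlt
    exact eval_writeSt_of_eq_zero (by rw [q2]; omega) h20 h21
  obtain ⟨h20, h21⟩ := q4 hlt
  have : Fintype A := Fintype.ofFinite A
  have hm := h.models
  have hcard : (natGraph σ).count (natGraph σ).alive = Fintype.card A :=
    hm.count_eq Finset.univ (fun _ hi => hi) fun a => by simp [hm.alive_apply]
  have hΓ : natGraph (measureSt.eval σ) = natGraph σ := natGraph_congr fun a ha => q1 a (by omega)
  have hal : aliveOf (measureSt.eval σ) = aliveOf σ := congrArg NatGraph.alive hΓ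
  have had : adjOf (measureSt.eval σ) = adjOf σ := congrArg NatGraph.adj hΓ
  have hma : markOf (measureSt.eval σ) = markOf σ := congrArg NatGraph.mark hΓ
  rw [hcard] at h20 h21
  obtain ⟨w1, w2, w3, w4⟩ := eval_writeSt_of_pos (m := Fintype.card A) (by rw [q2]; omega) h20 h21
    (by rw [hΓ, hcard])
  rw [q2] at w2
  -- The new number of a vertex is the number of smaller remaining vertices, which is strictly
  -- increasing and hence a bijection onto the numbers below $|A|$.
  have hrank : ∀ a : A, measureSt.eval σ 13 a.val = (Finset.univ.filter fun b : A => b < a).card := by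
    intro a
    rw [q3 _ (hm.lt a)]
    exact hm.count_eq _ (fun _ hi => hi.1) fun b => by
      rw [Finset.mem_filter]
      exact ⟨fun hb => ⟨hm.alive_apply b, hb.2⟩, fun hb => ⟨Finset.mem_univ b, hb.2⟩⟩
  have hrlt : ∀ a : A, measureSt.eval σ 13 a.val < Fintype.card A := by
    intro a
    rw [hrank]
    refine Finset.card_lt_card ⟨Finset.subset_univ _, fun hs => ?_⟩
    have := hs (Finset.mem_univ a)
    simp at this
  have hmono : ∀ a b : A, a < b → measureSt.eval σ 13 a.val < measureSt.eval σ 13 b.val := by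
    intro a b hab
    rw [hrank, hrank]
    refine Finset.card_lt_card ⟨fun c hc => ?_, fun hs => ?_⟩
    · rw [Finset.mem_filter] at hc ⊢
      exact ⟨hc.1, hc.2.trans hab⟩
    · have := hs (Finset.mem_filter.2 ⟨Finset.mem_univ a, hab⟩)
      simp at this
  have hinj : ∀ a b : A, measureSt.eval σ 13 a.val = measureSt.eval σ 13 b.val → a = b := by
    intro a b hab
    rcases lt_trichotomy a b with hl | hl | hl
    · have := hmono a b hl; omega
    · exact hl
    · have := hmono b a hl; omega
  let rk : A → Fin (Fintype.card A) := fun a => ⟨measureSt.eval σ 13 a.val, hrlt a⟩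
  have hbij : Function.Bijective rk := by
    rw [Fintype.bijective_iff_injective_and_card]
    exact ⟨fun a b hab => hinj a b (congrArg Fin.val hab), by simp⟩
  let φ := (Equiv.ofBijective rk hbij).symm
  have hφ : ∀ i, measureSt.eval σ 13 (φ i).val = i := fun i =>
    congrArg Fin.val ((Equiv.ofBijective rk hbij).apply_symm_apply i)
  have hφ' : ∀ a : A, ∀ i : Fin (Fintype.card A), measureSt.eval σ 13 a.val = i → a = φ i :=
    fun a i ha => hinj _ _ (by rw [ha, hφ])
  refine ⟨Fintype.card A, φ, w1, w2, fun i l => ?_, fun i => ?_⟩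
  · have hlt' : (i : ℕ) * Fintype.card A + l < Fintype.card A * Fintype.card A := by
      have := i.isLt
      have := l.isLt
      nlinarith
    change writeSt.eval (measureSt.eval σ) 2 _ = _
    rw [w3 _ hlt']
    congr 1
    rw [eq_iff_iff, hal, had, q1 0 (by omega)]
    constructor
    · rintro ⟨u, hu, hau, v, hv, hav, hadj, heq⟩
      obtain ⟨a, rfl⟩ := (hm.alive u).1 hau
      obtain ⟨b, rfl⟩ := (hm.alive v).1 hav
      have ha := hrlt a
      have hb := hrlt b
      have hl := l.isLt
      have h1 : measureSt.eval σ 13 a.val = i := by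
        have e1 := congrArg (· / Fintype.card A) heq
        rw [Nat.mul_add_div (by omega), Nat.div_eq_of_lt hb, mul_comm, Nat.mul_add_div (by omega),
          Nat.div_eq_of_lt hl] at e1
        omega
      have h2 : measureSt.eval σ 13 b.val = l := by
        rw [h1, mul_comm] at heq
        omega
      rw [← hφ' a i h1, ← hφ' b l h2]
      exact (hm.adj a b).1 hadj
    · intro hadj
      refine ⟨(φ i).val, hm.lt (φ i), hm.alive_apply (φ i), (φ l).val, hm.lt (φ l),
        hm.alive_apply (φ l), (hm.adj (φ i) (φ l)).2 hadj, ?_⟩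
      rw [hφ, hφ, mul_comm]
  · change writeSt.eval (measureSt.eval σ) 3 _ = _
    rw [w4 _ i.isLt]
    congr 1
    rw [eq_iff_iff, hal, hma, q1 0 (by omega)]
    constructor
    · rintro ⟨u, hu, hau, hmu, heq⟩
      obtain ⟨a, rfl⟩ := (hm.alive u).1 hau
      rw [← hφ' a i heq]
      exact (h.mark a.val).1 hmu
    · intro hmem
      exact ⟨(φ i).val, hm.lt (φ i), hm.alive_apply (φ i), (h.mark _).2 hmem, hφ i⟩

end RAM

namespace MetricDim

/-! ### The kernel -/

/-- The bound for the number of vertices of the kernel. -/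
def kernelBound (x : ℕ) : ℕ :=
  2 ^ 2 ^ (x + 1) * (2 ^ (x + 2) + x + 1) * 2 ^ (x + 1) + x

theorem kernelBound_mono : Monotone kernelBound := by
  intro x y h
  unfold kernelBound
  gcongr <;> norm_num

theorem three_le_kernelBound (x : ℕ) : 3 ≤ kernelBound x :=
  le_trans (by norm_num [kernelBound]) (kernelBound_mono (Nat.zero_le x))

/-- Two vertices outside $S$ are at distance 1 from every vertex of $S$. -/
theorem not_hasResolvingSet_completeGraph :
    ¬ HasResolvingSet (⊤ : SimpleGraph (Fin 3)) 1 := by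
  rintro ⟨S, hS, hc⟩
  have hc' : S.card + Sᶜ.card = 3 := by simp
  obtain ⟨u, hu, v, hv, huv⟩ := Finset.one_lt_card.1 (show 1 < Sᶜ.card by omega)
  rw [Finset.mem_compl] at hu hv
  obtain ⟨w, hw, hne⟩ := hS u v huv
  have h : ∀ x, x ∉ S → (⊤ : SimpleGraph (Fin 3)).edist w x = 1 := fun x hx =>
    SimpleGraph.edist_eq_one_iff_adj.2 ((SimpleGraph.top_adj w x).2 fun h => hx (h ▸ hw))
  exact hne (by rw [h u hu, h v hv])

/-- The instance `I'` with the vertex set `X'` is obtained from `I` and `X` by applying the two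
rules exhaustively. -/
def IsKernelOf (I : Instance) (X : Finset (Fin I.n)) (I' : Instance) (X' : Finset (Fin I'.n)) :
    Prop :=
  (I.IsYes ↔ I'.IsYes) ∧ IsClusterModulator I'.graph X' ∧ X'.card ≤ X.card ∧
    I'.n ≤ kernelBound X.card ∧ I'.k ≤ kernelBound X.card ∧
    ∃ (A : Set (Fin I.n)) (j : ℤ),
      Relation.ReflTransGen (Step I.graph X) (Set.univ, (I.k : ℤ)) (A, j) ∧
        IsReduced (I.graph.induce A) (restrict X A) ∧
        (0 < j → (I'.k : ℤ) ≤ j ∧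
          ∃ φ : I'.graph ≃g I.graph.induce A, ∀ i, i ∈ X' ↔ (φ i).val ∈ X)

theorem HasResolvingSet.mono {V : Type*} {G : SimpleGraph V} {j k : ℤ} (h : HasResolvingSet G j)
    (hjk : j ≤ k) : HasResolvingSet G k := by
  obtain ⟨S, hS, hc⟩ := h
  exact ⟨S, hS, hc.trans hjk⟩

/-- A budget beyond the number of vertices is useless, so it may be capped; this bounds $k'$ by the
kernel size. -/
theorem hasResolvingSet_min_iff {V : Type*} [Fintype V] {G : SimpleGraph V} {j m : ℤ}
    (hm : (Fintype.card V : ℤ) ≤ m) : HasResolvingSet G (min j m) ↔ HasResolvingSet G j := by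
  refine ⟨fun h => h.mono (min_le_left _ _), ?_⟩
  rintro ⟨S, hS, hc⟩
  refine ⟨S, hS, le_min hc (le_trans ?_ hm)⟩
  exact_mod_cast S.card_le_univ

theorem IsClusterModulator.iso {V W : Type*} {G : SimpleGraph V} {H : SimpleGraph W}
    (φ : H ≃g G) {X : Finset V} {Y : Finset W} (h : ∀ i, i ∈ Y ↔ φ i ∈ X)
    (hX : IsClusterModulator G X) : IsClusterModulator H Y := by
  intro u v huv hne
  let f : H.induce ((Y : Set W)ᶜ) →g G.induce ((X : Set V)ᶜ) :=
    { toFun := fun x => ⟨φ x.1, fun hx => x.2 ((h _).2 hx)⟩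
      map_rel' := fun {x y} hxy => φ.map_rel_iff.2 hxy }
  have := hX (f u) (f v) (huv.map f) fun h => hne (Subtype.ext (φ.injective
    (congrArg Subtype.val h)))
  exact φ.map_rel_iff.1 this

section

variable {I : Instance} {X : Finset (Fin I.n)} {A : Set (Fin I.n)} {r : ℕ}

theorem isKernelOf_of_lt (hX : IsClusterModulator I.graph X)
    (hsteps : Relation.ReflTransGen (Step I.graph X) (Set.univ, (I.k : ℤ)) (A, (I.k : ℤ) - r))
    (hred : IsReduced (I.graph.induce A) (restrict X A)) (hr : r < I.k) {m : ℕ}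
    (φ : Fin m ≃ A) {Y : Finset (Fin m)} (hY : ∀ i, i ∈ Y ↔ (φ i).val ∈ X) :
    IsKernelOf I X ⟨m, (I.graph.induce A).comap φ, min (I.k - r) (max 1 m), by omega⟩ Y := by
  classical
  have : Fintype A := Fintype.ofFinite A
  have hm : Fintype.card A = m := by simpa using (Fintype.card_congr φ).symm
  let ψ : (I.graph.induce A).comap φ ≃g I.graph.induce A := ⟨φ, Iff.rfl⟩
  have hXA : (restrict X A).card ≤ X.card := by
    rw [← Finset.card_map (Function.Embedding.subtype _)]
    refine Finset.card_le_card fun x hx => ?_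
    obtain ⟨y, hy, rfl⟩ := Finset.mem_map.1 hx
    exact mem_restrict.1 hy
  have hmb : m ≤ kernelBound X.card := by
    rw [← hm]
    exact (card_le_of_isReduced _ _ (hX.restrict A) hred).trans (kernelBound_mono hXA)
  have h3 := three_le_kernelBound X.card
  refine ⟨?_, ?_, ?_, hmb, ?_, A, _, hsteps, hred, fun _ => ⟨?_, ψ, hY⟩⟩
  · have := steps_safe hX hsteps
    rw [hasResolvingSet_induce_univ] at this
    rw [Instance.IsYes, Instance.IsYes, this, hasResolvingSet_iso ψ, ← hasResolvingSet_min_iff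
      (m := (max 1 m : ℕ)) (by rw [hm]; exact_mod_cast le_max_right 1 m)]
    have : ((min (I.k - r) (max 1 m) : ℕ) : ℤ) = min ((I.k : ℤ) - r) ((max 1 m : ℕ) : ℤ) := by
      rw [Nat.cast_min, Nat.cast_sub hr.le]
    rw [← this]
  · exact (hX.restrict A).iso ψ fun i => by rw [hY, mem_restrict]; rfl
  · rw [← Finset.card_map (φ.toEmbedding.trans (Function.Embedding.subtype _))]
    refine Finset.card_le_card fun x hx => ?_
    obtain ⟨y, hy, rfl⟩ := Finset.mem_map.1 hx
    exact (hY y).1 hy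
  · show min _ _ ≤ _
    omega
  · show ((min (I.k - r) (max 1 m) : ℕ) : ℤ) ≤ _
    omega

/-- The original budget was positive, so some rule was applied and at least two vertices remain,
which no set of size at most zero resolves. The triangle with budget 1 is negative too. -/
theorem isKernelOf_of_le (hX : IsClusterModulator I.graph X)
    (hsteps : Relation.ReflTransGen (Step I.graph X) (Set.univ, (I.k : ℤ)) (A, (I.k : ℤ) - r))
    (hred : IsReduced (I.graph.induce A) (restrict X A)) (hr : I.k ≤ r) :
    IsKernelOf I X ⟨3, ⊤, 1, one_pos⟩ (∅ : Finset (Fin 3)) := by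
  have h3 := three_le_kernelBound X.card
  have hk := I.k_pos
  refine ⟨iff_of_false ?_ ?_, ?_, by simp, h3, le_trans (by norm_num) h3, A, _, hsteps, hred,
    fun hj => absurd hj (by omega)⟩
  · have := steps_safe hX hsteps
    rw [hasResolvingSet_induce_univ] at this
    rw [Instance.IsYes, this]
    rcases steps_eq_or_nontrivial hsteps with h | h
    · have := congrArg Prod.snd h
      simp only at this
      omega
    · have : Nontrivial A := h.coe_sort
      exact not_hasResolvingSet_of_nontrivial (by simp only; omega)
  · exact_mod_cast not_hasResolvingSet_completeGraph
  · intro u v _ hne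
    simpa [Subtype.ext_iff] using fun h => hne (Subtype.ext h)

end

theorem encode_adj (I : Instance) (X : Finset (Fin I.n)) (a b : Fin I.n) :
    encode I X 2 (a * I.n + b) ≠ 0 ↔ I.graph.Adj a b := by
  have key : (∃ u v : Fin I.n, I.graph.Adj u v ∧ (a * I.n + b : ℕ) = u.val * I.n + v.val) ↔
      I.graph.Adj a b := by
    constructor
    · rintro ⟨u, v, huv, h⟩
      have h1 : a = u := by
        have := congrArg (· / I.n) h
        simp only [mul_comm _ I.n, Nat.mul_add_div a.pos,
          Nat.div_eq_of_lt b.isLt, Nat.div_eq_of_lt v.isLt] at this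
        exact Fin.ext (by omega)
      subst h1
      have h2 : b = v := Fin.ext (by omega)
      subst h2
      exact huv
    · exact fun h => ⟨a, b, h, rfl⟩
  simp [encode, key]

theorem encode_mark (I : Instance) (X : Finset (Fin I.n)) (a : Fin I.n) :
    encode I X 3 a ≠ 0 ↔ a ∈ X := by
  have key : (∃ u ∈ X, (a : ℕ) = u.val) ↔ a ∈ X :=
    ⟨fun ⟨u, hu, h⟩ => Fin.ext h ▸ hu, fun h => ⟨a, h, rfl⟩⟩
  simp [encode, key]

theorem Instance.lt_size (I : Instance) : I.n < I.size := by
  have := I.k_pos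
  have h1 : 0 < Nat.size I.k := Nat.size_pos.2 this
  have h2 : I.n ≤ I.n ^ 2 := Nat.le_self_pow (by norm_num) _
  rw [Instance.size]
  omega

end MetricDim

/-! ### The kernelization program and its running time -/

namespace RAM

open MetricDim

/-- The kernelization program. -/
def kernelProg : Prog :=
  .seq (reduceSt.compile 64) (.seq (measureSt.compile 64)
    -- The new number of vertices is stored last, since the old one is needed to index the old
    -- matrix.
    (.seq (writeSt.compile 64) (setReg 0 (reg 20))))

theorem PolyBounded.comp_sq {f : ℕ → ℕ} (hf : PolyBounded f) :
    PolyBounded fun n => f ((n + 3) ^ 2) := by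
  obtain ⟨K, d, h⟩ := hf
  refine ⟨K * 10 ^ d, 2 * d, fun n => (h _).trans ?_⟩
  rw [mul_assoc, pow_mul, ← mul_pow]
  have : (n + 3) ^ 2 + 1 ≤ 10 * (n + 1) ^ 2 :=
    Nat.le.intro (show _ + (9 * n ^ 2 + 14 * n) = _ by ring)
  gcongr

/-- Only arrays 0 to 3 of the initial memory are prescribed, rather than a fresh encoding, because
the decision program starts the kernelization on the memory left by the modulator program. -/
theorem exists_run_kernelProg : ∃ K d : ℕ, ∀ (I : Instance) (X : Finset (Fin I.n)) (σ : Memory),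
    IsClusterModulator I.graph X → σ 0 0 = I.n → σ 1 0 = I.k →
    (∀ a b : Fin I.n, σ 2 (a * I.n + b) ≠ 0 ↔ I.graph.Adj a b) →
    (∀ a : Fin I.n, σ 3 a ≠ 0 ↔ a ∈ X) →
    ∃ (τ : Memory) (t : ℕ) (I' : Instance) (X' : Finset (Fin I'.n)), Run kernelProg σ τ t ∧
      t ≤ K * (I.n + 1) ^ d ∧ Contains τ I' X' ∧ IsKernelOf I X I' X' := by
  classical
  obtain ⟨K, d, hKd⟩ := (((reduceSt.polyBounded_cost.add measureSt.polyBounded_cost).add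
    writeSt.polyBounded_cost).add (.const 4)).comp_sq
  refine ⟨K, d, fun I X σ hX h0 h1 h2 h3 => ?_⟩
  -- This dominates all loop bounds: $n$, $m$ and $m^2$, and also 3 and 9 for the triangle.
  set N := (I.n + 3) ^ 2 with hN
  have hN0 : I.n ≤ N := by nlinarith
  have hN9 : 9 ≤ N := by nlinarith
  obtain ⟨hsame, A, hA, hred, hsteps⟩ := eval_reduceSt h0 h2 h3 hX (I.k : ℤ)
  obtain ⟨o1, o2⟩ := eval_output hA
  set σ₁ := reduceSt.eval σ
  obtain ⟨m1, -, -, m4, m5⟩ := eval_measureSt σ₁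
  have hB : ∀ b ∈ [0, 20, 21], measureSt.eval σ₁ b 0 ≤ N := by
    have hm : (natGraph σ₁).count (natGraph σ₁).alive ≤ I.n := by
      refine (countBelow_le _ _).trans_eq ?_
      exact hA.n_eq
    intro b hb
    simp only [List.mem_cons, List.not_mem_nil, or_false] at hb
    by_cases hlt : σ₁ 5 0 < σ₁ 1 0
    · obtain ⟨h20, h21⟩ := m4 hlt
      rcases hb with rfl | rfl | rfl
      · rw [m1 0 (by omega), hA.n_eq]; exact hN0
      · rw [h20]; omega
      · rw [h21]; nlinarith
    · obtain ⟨h20, h21⟩ := m5 hlt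
      rcases hb with rfl | rfl | rfl
      · rw [m1 0 (by omega), hA.n_eq]; exact hN0
      · rw [h20]; omega
      · rw [h21]; omega
  obtain ⟨τ₁, t₁, r₁, ht₁, e₁, -⟩ := St.run (N := N) (by simp) reduceSt wf_reduceSt 64 le_rfl σ σ
    (fun _ _ => rfl) (by simpa [h0] using hN0)
  obtain ⟨τ₂, t₂, r₂, ht₂, e₂, -⟩ := St.run (N := N) (by simp) measureSt wf_measureSt 64 le_rfl
    σ₁ τ₁ e₁ (by simpa [hA.n_eq] using hN0)
  obtain ⟨τ₃, t₃, r₃, ht₃, e₃, -⟩ := St.run (N := N) (by simp) writeSt wf_writeSt 64 le_rfl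
    (measureSt.eval σ₁) τ₂ e₂ hB
  have r₄ := run_setReg τ₃ 0 (reg 20)
  have hrun := Run.seq r₁ (Run.seq r₂ (Run.seq r₃ r₄))
  have htime : t₁ + (t₂ + (t₃ + ((reg 20).cost + 2))) ≤ K * (I.n + 1) ^ d := by
    refine le_trans ?_ (hKd I.n)
    rw [show (reg 20).cost + 2 = 4 from rfl]
    simp only [← hN]
    omega
  have hfin : ∀ a, a < 64 → a ≠ 0 → (τ₃.set 0 ((reg 20).eval τ₃)) a =
      writeSt.eval (measureSt.eval σ₁) a := fun a ha ha0 => by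
    rw [Memory.set_of_ne _ _ ha0, e₃ a ha]
  have hfin0 : (τ₃.set 0 ((reg 20).eval τ₃)) 0 0 = writeSt.eval (measureSt.eval σ₁) 20 0 := by
    rw [Memory.set_self, eval_reg, e₃ 20 (by omega)]
  have hk : σ₁ 1 0 = I.k := by rw [hsame 1 (by omega), h1]
  rw [hk] at o1 o2
  by_cases hlt : σ₁ 5 0 < I.k
  · obtain ⟨m, φ, w1, w2, w3, w4⟩ := o1 hlt
    refine ⟨_, _, ⟨m, (I.graph.induce A).comap φ, min (I.k - σ₁ 5 0) (max 1 m), by omega⟩,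
      Finset.univ.filter fun i => (φ i).val ∈ X, hrun, htime, ⟨?_, ?_, ?_, ?_⟩,
      isKernelOf_of_lt hX hsteps hred hlt φ (by simp)⟩
    · rw [hfin0, w1]
    · rw [hfin 1 (by omega) (by omega), w2]
    · intro u v
      rw [hfin 2 (by omega) (by omega), w3]
      rfl
    · intro u
      rw [hfin 3 (by omega) (by omega), w4]
      simp
  · obtain ⟨w1, w2, w3, w4⟩ := o2 hlt
    refine ⟨_, _, ⟨3, ⊤, 1, one_pos⟩, (∅ : Finset (Fin 3)), hrun, htime, ⟨?_, ?_, ?_, ?_⟩,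
      isKernelOf_of_le hX hsteps hred (not_lt.1 hlt)⟩
    · rw [hfin0, w1]
    · rw [hfin 1 (by omega) (by omega), w2]
    · intro u v
      rw [hfin 2 (by omega) (by omega), w3]
      simp
    · intro u
      rw [hfin 3 (by omega) (by omega), w4]
      simp

end RAM

namespace MetricDim

theorem hasKernel : HasKernel kernelBound := by
  obtain ⟨K, d, h⟩ := RAM.exists_run_kernelProg
  -- A single constant has to serve both as factor and as exponent.
  refine ⟨RAM.kernelProg, max K d, fun I X hX => ?_⟩
  obtain ⟨τ, t, I', X', hrun, ht, hc, hker⟩ := h I X (encode I X) hX (by simp [encode])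
    (by simp [encode]) (encode_adj I X) (encode_mark I X)
  refine ⟨τ, t, I', X', hrun, ht.trans ?_, hc, hker⟩
  have := I.lt_size
  calc K * (I.n + 1) ^ d ≤ K * I.size ^ d := by gcongr; omega
    _ ≤ max K d * I.size ^ max K d :=
      Nat.mul_le_mul (le_max_left _ _) (Nat.pow_le_pow_right (by omega) (le_max_right _ _))

end MetricDim

namespace MetricDim

/-! ### A cluster modulator of at most three times the minimum size -/

/-- `u, v, w` is an induced path on three vertices. -/
def IsInducedPath {V : Type*} (G : SimpleGraph V) (u v w : V) : Prop :=
  G.Adj u v ∧ G.Adj v w ∧ u ≠ w ∧ ¬ G.Adj u w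

theorem IsClusterModulator.not_isInducedPath {V : Type*} {G : SimpleGraph V} {X : Finset V}
    (hX : IsClusterModulator G X) {u v w : V} (h : IsInducedPath G u v w) :
    u ∈ X ∨ v ∈ X ∨ w ∈ X := by
  by_contra! hn
  obtain ⟨hu, hv, hw⟩ := hn
  obtain ⟨huv, hvw, hne, hnot⟩ := h
  have h1 : (G.induce ((X : Set V)ᶜ)).Adj ⟨u, hu⟩ ⟨v, hv⟩ := huv
  have h2 : (G.induce ((X : Set V)ᶜ)).Adj ⟨v, hv⟩ ⟨w, hw⟩ := hvw
  exact hnot (hX ⟨u, hu⟩ ⟨w, hw⟩ (h1.reachable.trans h2.reachable)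
    fun h => hne (congrArg Subtype.val h))

/-- Induction along a walk: if $ab$ is an edge and $b$ is equal or adjacent to the end $c\neq a$,
then $ac$ must be an edge, or else $a,b,c$ is an induced path. -/
theorem isClusterModulator_of_forall_not_isInducedPath {V : Type*} {G : SimpleGraph V}
    {X : Finset V} (h : ∀ u v w, u ∉ X → v ∉ X → w ∉ X → ¬ IsInducedPath G u v w) :
    IsClusterModulator G X := by
  rintro u v ⟨p⟩
  induction p with
  | nil => exact fun h => absurd rfl h
  | @cons a b c hab q ih =>
    intro hac
    by_cases hbc : b = c
    · exact hbc ▸ hab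
    · by_contra hn
      exact h a b c a.2 b.2 c.2 ⟨hab, ih hbc, fun h => hac (Subtype.ext h), hn⟩

/-- Every cluster modulator $Y$ contains a vertex of the path, so three new vertices in $X$ bring at
least one new vertex of $Y$. This is the approximation ratio 3. -/
theorem card_insert_path_le {V : Type*} [DecidableEq V] {G : SimpleGraph V} {X Y : Finset V}
    (hY : IsClusterModulator G Y) (hXY : X.card ≤ 3 * (X ∩ Y).card) {u v w : V}
    (h : IsInducedPath G u v w) (hu : u ∉ X) (hv : v ∉ X) (hw : w ∉ X) :
    (insert u (insert v (insert w X))).card ≤ 3 * (insert u (insert v (insert w X)) ∩ Y).card := by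
  have h1 : (insert u (insert v (insert w X))).card ≤ X.card + 3 := by
    have e1 := Finset.card_insert_le u (insert v (insert w X))
    have e2 := Finset.card_insert_le v (insert w X)
    have e3 := Finset.card_insert_le w X
    omega
  have h2 : (X ∩ Y).card < (insert u (insert v (insert w X)) ∩ Y).card := by
    have hsub : X ⊆ insert u (insert v (insert w X)) := fun x hx => by simp [hx]
    refine Finset.card_lt_card ⟨Finset.inter_subset_inter_right hsub, fun hs => ?_⟩
    rcases hY.not_isInducedPath h with hm | hm | hm
    · exact hu (Finset.mem_inter.1 (hs (Finset.mem_inter.2 ⟨by simp, hm⟩))).1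
    · exact hv (Finset.mem_inter.1 (hs (Finset.mem_inter.2 ⟨by simp, hm⟩))).1
    · exact hw (Finset.mem_inter.1 (hs (Finset.mem_inter.2 ⟨by simp, hm⟩))).1
  omega

theorem isClusterModulator_univ {V : Type*} [Fintype V] (G : SimpleGraph V) :
    IsClusterModulator G Finset.univ :=
  fun u => absurd (Finset.mem_univ u.1) u.2

theorem exists_card_eq_distToCluster {V : Type*} [Fintype V] (G : SimpleGraph V) :
    ∃ X, IsClusterModulator G X ∧ X.card = distToCluster G :=
  Nat.sInf_mem (s := {m | ∃ X : Finset V, IsClusterModulator G X ∧ X.card = m})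
    ⟨_, Finset.univ, isClusterModulator_univ G, rfl⟩

theorem distToCluster_le_distToClique {V : Type*} [Fintype V] (G : SimpleGraph V) :
    distToCluster G ≤ distToClique G := by
  obtain ⟨X, hX, hc⟩ := Nat.sInf_mem
    (s := {m | ∃ X : Finset V, G.IsClique ((X : Set V)ᶜ) ∧ X.card = m})
    ⟨_, Finset.univ, by simp, rfl⟩
  exact Nat.sInf_le ⟨X, fun u v _ hne => hX u.2 v.2 fun h => hne (Subtype.ext h), hc⟩

end MetricDim

namespace RAM

open MetricDim Tm

/-- `u, v, w` are unmarked and induce a path. -/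
def pathOf (σ : Memory) (u v w : ℕ) : Prop :=
  (¬ markOf σ u ∧ ¬ markOf σ v ∧ ¬ markOf σ w) ∧ adjOf σ u v ∧ adjOf σ v w ∧ u ≠ w ∧ ¬ adjOf σ u w

@[simp] theorem pathOf_set {σ : Memory} {v : ℕ} (i : ℕ) (h : 3 < v) :
    pathOf (σ.set v i) = pathOf σ := by
  funext a b c
  rw [pathOf, pathOf, adjOf_set _ (by omega) (by omega), markOf_set _ (by omega) (by omega)]

def pathT (u v w : ℕ) : Tm :=
  andT (andT (notT (markT u)) (andT (notT (markT v)) (notT (markT w))))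
    (andT (adjT u v) (andT (adjT v w) (andT (notT (eqT (V u) (V w))) (notT (adjT u w)))))

@[simp] theorem holds_pathT {σ : Memory} {u v w : ℕ} (hu : u ≠ 63) (hv : v ≠ 63) :
    (pathT u v w).Holds σ ↔ pathOf σ (σ u 0) (σ v 0) (σ w 0) := by
  simp [pathT, pathOf, hu, hv]

/-- Find an induced path among the unmarked vertices, and mark it. -/
def markPathSt : St :=
  .seq (assign 6 (leastT 34 35 (.sum 36 (.sum 37 (pathT 35 36 37)))))
    (.seq (assign 7 (leastT 34 36 (.sum 37 (pathT 6 36 37))))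
      (.seq (assign 8 (leastT 34 37 (pathT 6 7 37)))
        (.bulk 0 3 32 (orT (markT 32) (orT (eqT (V 32) (V 6))
          (orT (eqT (V 32) (V 7)) (eqT (V 32) (V 8))))))))

/-- Mark disjoint induced paths on three vertices as long as possible. -/
def modulatorSt : St := .loop 0 31 markPathSt

theorem wf_modulatorSt : modulatorSt.wf [0] = true := by decide

theorem eval_markPathSt (σ : Memory) :
    (∀ a < 3, markPathSt.eval σ a = σ a) ∧
    (((∀ u v w, ¬ pathOf σ u v w) ∧ ∀ i, markOf (markPathSt.eval σ) i ↔ markOf σ i) ∨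
      ∃ u v w, pathOf σ u v w ∧
        ∀ i, i < σ 0 0 → (markOf (markPathSt.eval σ) i ↔ i = u ∨ i = v ∨ i = w ∨ markOf σ i)) := by
  set n := σ 0 0 with hn
  set x := leastBelow n fun u => ∃ v, v < n ∧ ∃ w, w < n ∧ pathOf σ u v w with hx
  set y := leastBelow n fun v => ∃ w, w < n ∧ pathOf σ x v w with hy
  set z := leastBelow n fun w => pathOf σ x y w with hz
  set τ := ((σ.set 6 x).set 7 y).set 8 z with hτ
  have h6 : (leastT 34 35 (.sum 36 (.sum 37 (pathT 35 36 37)))).eval σ = x :=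
    eval_least (by omega) (by omega) (by simp [← hn])
  have h7 : (leastT 34 36 (.sum 37 (pathT 6 36 37))).eval (σ.set 6 x) = y := by
    rw [eval_least (P := fun v => ∃ w, w < n ∧ pathOf σ x v w) (by omega) (by omega)
      (by simp [← hn])]
    simp [hy, hn]
  have h8 : (leastT 34 37 (pathT 6 7 37)).eval ((σ.set 6 x).set 7 y) = z := by
    rw [eval_least (P := fun w => pathOf σ x y w) (by omega) (by omega) (by simp)]
    simp [hz, hn]
  have hev : markPathSt.eval σ = (St.bulk 0 3 32 (orT (markT 32) (orT (eqT (V 32) (V 6))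
          (orT (eqT (V 32) (V 7)) (eqT (V 32) (V 8)))))).eval τ := by
    rw [markPathSt, eval_seq, eval_seq, eval_seq, eval_assign, eval_assign, eval_assign, h6, h7, h8]
  have hτa : ∀ a < 6, τ a = σ a := fun a ha => by
    rw [hτ, Memory.set_of_ne _ _ (by omega), Memory.set_of_ne _ _ (by omega),
      Memory.set_of_ne _ _ (by omega)]
  have hm : ∀ i, i < n → (markOf (markPathSt.eval σ) i ↔ markOf σ i ∨ i = x ∨ i = y ∨ i = z) := by
    intro i hi
    rw [hev]
    simp only [markOf, St.eval, Function.update_self]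
    rw [Function.update_of_ne (by omega), hτa 0 (by omega), ← hn, if_pos hi, and_iff_right hi]
    change Holds _ _ ↔ _
    have hm' : markOf σ i ↔ σ 3 i ≠ 0 := by simp [markOf, ← hn, hi]
    simp [hτ, hm', hi]
  refine ⟨fun a ha => ?_, ?_⟩
  · rw [hev, St.eval, Function.update_of_ne (by omega), hτa a (by omega)]
  have hlt : ∀ u v w, pathOf σ u v w → u < n ∧ v < n ∧ w < n := fun u v w h =>
    ⟨h.2.1.1, h.2.1.2.1, h.2.2.1.2.1⟩
  rcases leastBelow_eq n fun u => ∃ v, v < n ∧ ∃ w, w < n ∧ pathOf σ u v w with ⟨e1, e2⟩ | ⟨e1, e2⟩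
  · left
    have hno : ∀ u v w, ¬ pathOf σ u v w := fun u v w h =>
      e2 u (hlt u v w h).1 ⟨v, (hlt u v w h).2.1, w, (hlt u v w h).2.2, h⟩
    -- All three searches return the default $n$, and marking affects only numbers below $n$, so
    -- nothing changes.
    have hxn : x = n := e1
    have hyn : y = n := by
      rcases leastBelow_eq n fun v => ∃ w, w < n ∧ pathOf σ x v w with ⟨e, -⟩ | ⟨-, w, -, e⟩
      · exact e
      · exact absurd e (hno _ _ _)
    have hzn : z = n := by
      rcases leastBelow_eq n fun w => pathOf σ x y w with ⟨e, -⟩ | ⟨-, e⟩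
      · exact e
      · exact absurd e (hno _ _ _)
    refine ⟨hno, fun i => ?_⟩
    by_cases hi : i < n
    · rw [hm i hi, hxn, hyn, hzn]
      exact ⟨fun h => h.resolve_right (by omega), Or.inl⟩
    · refine iff_of_false (fun h => hi ?_) fun h => hi h.1
      have := h.1
      rwa [hev, St.eval, Function.update_of_ne (by omega), hτa 0 (by omega)] at this
  · right
    refine ⟨x, y, z, ?_, fun i hi => by rw [hm i hi]; tauto⟩
    obtain ⟨v, hv, hv'⟩ := e2
    rcases leastBelow_eq n fun v => ∃ w, w < n ∧ pathOf σ x v w with ⟨-, e⟩ | ⟨-, w, hw, hw'⟩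
    · exact absurd hv' (e v hv)
    · rcases leastBelow_eq n fun w => pathOf σ x y w with ⟨-, e⟩ | ⟨-, e⟩
      · exact absurd hw' (e w hw)
      · exact e

theorem eval_modulatorSt {σ : Memory} {n : ℕ} {G : SimpleGraph (Fin n)}
    (h0 : σ 0 0 = n) (hadj : ∀ a b : Fin n, σ 2 (a * n + b) ≠ 0 ↔ G.Adj a b)
    (hmark : ∀ a : Fin n, σ 3 a = 0) :
    let τ := modulatorSt.eval σ
    (∀ a < 3, τ a = σ a) ∧ ∃ X : Finset (Fin n), (∀ a : Fin n, τ 3 a ≠ 0 ↔ a ∈ X) ∧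
      IsClusterModulator G X ∧ X.card ≤ 3 * distToCluster G := by
  have key : ∀ m, let τ := iter markPathSt.eval 31 σ m
      (∀ a < 3, τ a = σ a) ∧ ∃ X : Finset (Fin n), (∀ a : Fin n, markOf τ a ↔ a ∈ X) ∧
        -- A round marks a new vertex unless no path is left. After $n$ rounds either $X$ is a
        -- modulator or it has all $n$ vertices, and then it is one trivially.
        (m ≤ X.card ∨ IsClusterModulator G X) ∧
        ∀ Y, IsClusterModulator G Y → X.card ≤ 3 * (X ∩ Y).card := by
    intro m
    induction m with
    | zero => exact ⟨fun _ _ => rfl, ∅, fun a => by simp [markOf, iter, hmark], by simp, by simp⟩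
    | succ m ih =>
      simp only [iter] at ih ⊢
      obtain ⟨ih1, X, hX, hm, hY⟩ := ih
      set τ := (iter markPathSt.eval 31 σ m).set 31 m with hτ
      have hτa : ∀ a < 3, τ a = σ a := fun a ha => by
        rw [hτ, Memory.set_of_ne _ _ (by omega), ih1 a ha]
      have hX' : ∀ a : Fin n, markOf τ a ↔ a ∈ X := fun a => by
        rw [hτ, markOf_set _ (by omega) (by omega), hX]
      have hadj' : ∀ a b : Fin n, adjOf τ a b ↔ G.Adj a b := fun a b => by
        simp only [adjOf, hτa 0 (by omega), hτa 2 (by omega), h0, hadj, a.isLt, b.isLt, true_and]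
      have hpath : ∀ u v w : Fin n, pathOf τ u v w ↔
          (u ∉ X ∧ v ∉ X ∧ w ∉ X) ∧ IsInducedPath G u v w := fun u v w => by
        simp only [pathOf, IsInducedPath, hX', hadj', ne_eq, Fin.ext_iff]
      obtain ⟨r1, r2⟩ := eval_markPathSt τ
      refine ⟨fun a ha => by rw [r1 a ha, hτa a ha], ?_⟩
      rcases r2 with ⟨hno, hsame⟩ | ⟨u, v, w, hp, hi⟩
      · refine ⟨X, fun a => by rw [hsame, hX'], Or.inr ?_, hY⟩
        exact isClusterModulator_of_forall_not_isInducedPath fun u v w hu hv hw h =>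
          hno u v w ((hpath u v w).2 ⟨⟨hu, hv, hw⟩, h⟩)
      · have hτ0 : τ 0 0 = n := by rw [hτa 0 (by omega), h0]
        lift u to Fin n using hτ0 ▸ hp.2.1.1
        lift v to Fin n using hτ0 ▸ hp.2.1.2.1
        lift w to Fin n using hτ0 ▸ hp.2.2.1.2.1
        obtain ⟨⟨hu, hv, hw⟩, h⟩ := (hpath u v w).1 hp
        refine ⟨insert u (insert v (insert w X)), fun a => ?_, Or.inl ?_, fun Y hY' =>
          card_insert_path_le hY' (hY Y hY') h hu hv hw⟩
        · rw [hi a (hτ0 ▸ a.isLt), hX']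
          simp [Fin.ext_iff]
        · have hmX : m ≤ X.card := hm.resolve_right fun hX => by
            rcases hX.not_isInducedPath h with h | h | h
            exacts [hu h, hv h, hw h]
          have : X.card < (insert u (insert v (insert w X))).card :=
            Finset.card_lt_card ⟨fun x hx => by simp [hx], fun hs => hu (hs (by simp))⟩
          omega
  intro τ
  have hτ : τ = iter markPathSt.eval 31 σ n := by
    show modulatorSt.eval σ = _
    rw [modulatorSt, St.eval, h0]
  obtain ⟨k1, X, hX, hm, hY⟩ := key n
  rw [← hτ] at k1 hX
  refine ⟨k1, X, fun a => ?_, ?_, ?_⟩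
  · rw [← hX, markOf, k1 0 (by omega), h0, and_iff_right a.isLt]
  · rcases hm with hm | hm
    · have : X = Finset.univ := Finset.eq_univ_of_card X
        (le_antisymm X.card_le_univ (by simpa using hm))
      rw [this]
      exact isClusterModulator_univ G
    · exact hm
  · obtain ⟨Y, hY', hc⟩ := exists_card_eq_distToCluster G
    rw [← hc]
    exact (hY Y hY').trans (Nat.mul_le_mul_left 3 (Finset.card_le_card Finset.inter_subset_right))

end RAM

namespace MetricDim

/-! ### Distances -/

theorem edist_le_natCast_iff {V : Type*} {G : SimpleGraph V} {a b : V} {m : ℕ} :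
    G.edist a b ≤ m ↔ ∃ p : G.Walk a b, p.length ≤ m := by
  constructor
  · intro h
    obtain ⟨p, hp⟩ := SimpleGraph.exists_walk_of_edist_ne_top
      (ne_top_of_le_ne_top (ENat.natCast_ne_top m) h)
    exact ⟨p, by exact_mod_cast hp ▸ h⟩
  · rintro ⟨p, hp⟩
    exact (SimpleGraph.edist_le p).trans (by exact_mod_cast hp)

/-- Splitting off the last edge of a walk is the recursion of the distance computation. -/
theorem edist_le_succ_iff {V : Type*} {G : SimpleGraph V} {a b : V} {m : ℕ} :
    G.edist a b ≤ (m + 1 : ℕ) ↔ G.edist a b ≤ m ∨ ∃ w, G.edist a w ≤ m ∧ G.Adj w b := by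
  simp only [edist_le_natCast_iff]
  constructor
  · rintro ⟨p, hp⟩
    rw [← p.length_reverse] at hp
    cases h : p.reverse with
    | nil => exact Or.inl ⟨.nil, by simp⟩
    | @cons _ w _ hw q =>
      rw [h, SimpleGraph.Walk.length_cons] at hp
      exact Or.inr ⟨w, ⟨q.reverse, by rw [q.length_reverse]; omega⟩, hw.symm⟩
  · rintro (⟨p, hp⟩ | ⟨w, ⟨p, hp⟩, hw⟩)
    · exact ⟨p, by omega⟩
    · exact ⟨p.concat hw, by rw [SimpleGraph.Walk.length_concat]; omega⟩

theorem edist_eq_top_or_lt {n : ℕ} (G : SimpleGraph (Fin n)) (a b : Fin n) :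
    G.edist a b = ⊤ ∨ ∃ x < n, G.edist a b = x := by
  by_cases h : G.edist a b = ⊤
  · exact Or.inl h
  · right
    obtain ⟨p, hp, hlen⟩ := (SimpleGraph.edist_ne_top_iff_reachable.1 h).exists_path_of_dist
    refine ⟨p.length, by simpa using hp.length_lt, ?_⟩
    rw [hlen, SimpleGraph.dist, ENat.natCast_toNat h]

theorem countBelow_succ (m : ℕ) (P : ℕ → Prop) [Decidable (P m)] :
    countBelow (m + 1) P = countBelow m P + if P m then 1 else 0 := by
  classical
  rw [countBelow, Finset.range_add_one, Finset.filter_insert]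
  split_ifs with h
  · rw [Finset.card_insert_of_notMem (by simp), countBelow]
  · rw [countBelow, add_zero]

/-- Counting the $m<n$ with $m<d$ stores an extended distance as a number: a finite distance, which
is less than $n$, is stored as itself and $\infty$ as $n$. -/
theorem countBelow_lt_inj {n : ℕ} {d e : ℕ∞} (hd : d = ⊤ ∨ ∃ x < n, d = x)
    (he : e = ⊤ ∨ ∃ x < n, e = x) :
    (countBelow n fun m => (m : ℕ∞) < d) = (countBelow n fun m => (m : ℕ∞) < e) ↔ d = e := by
  have h1 : (countBelow n fun m => (m : ℕ∞) < ⊤) = n :=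
    (countBelow_eq_card (Finset.range n) (by simp)).trans (Finset.card_range n)
  have h2 : ∀ x < n, (countBelow n fun m => (m : ℕ∞) < x) = x := fun x hx =>
    (countBelow_eq_card (Finset.range x) fun i => by
      rw [Finset.mem_range, Nat.cast_lt]
      omega).trans (Finset.card_range x)
  rcases hd with rfl | ⟨x, hx, rfl⟩ <;> rcases he with rfl | ⟨y, hy, rfl⟩
  · simp
  · rw [h1, h2 y hy]
    exact iff_of_false (by omega) (ENat.top_ne_natCast y)
  · rw [h1, h2 x hx]
    exact iff_of_false (by omega) (ENat.natCast_ne_top x)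
  · rw [h2 x hx, h2 y hy, Nat.cast_inj]

theorem mul_add_inj {n a b c d : ℕ} (hb : b < n) (hd : d < n) :
    a * n + b = c * n + d ↔ a = c ∧ b = d := by
  refine ⟨fun h => ?_, by rintro ⟨rfl, rfl⟩; rfl⟩
  have h1 : a = c := by
    have := congrArg (· / n) h
    simpa [mul_comm _ n, Nat.mul_add_div (by omega : 0 < n), Nat.div_eq_of_lt hb,
      Nat.div_eq_of_lt hd] using this
  subst h1
  omega

theorem mul_add_lt {n : ℕ} (a b : Fin n) : (a * n + b : ℕ) < n * n := by
  have : ((a : ℕ) + 1) * n ≤ n * n := Nat.mul_le_mul_right n a.isLt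
  rw [add_mul] at this
  have := b.isLt
  omega

/-! ### Sets as binary numbers -/

/-- Carrying: adding one flips bit $i$ exactly if all lower bits are one. In this way the search
steps through all vertex sets. -/
theorem testBit_add_one (m i : ℕ) : (m + 1).testBit i = true ↔
    ¬ (m.testBit i = true ↔ ∀ j < i, m.testBit j = true) := by
  induction i generalizing m with
  | zero =>
    simp only [Nat.testBit_zero, decide_eq_true_eq]
    have : ∀ j < 0, m.testBit j = true := fun j hj => absurd hj (Nat.not_lt_zero j)
    rw [iff_true_right this]
    omega
  | succ i ih =>
    have hall : (∀ j < i + 1, m.testBit j = true) ↔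
        m % 2 = 1 ∧ ∀ j < i, (m / 2).testBit j = true := by
      constructor
      · intro h
        refine ⟨by simpa using h 0 (by omega), fun j hj => ?_⟩
        rw [← Nat.testBit_succ]
        exact h (j + 1) (by omega)
      · rintro ⟨h0, h⟩ j hj
        cases j with
        | zero => simpa using h0
        | succ j => rw [Nat.testBit_succ]; exact h j (by omega)
    rw [Nat.testBit_succ, Nat.testBit_succ, hall]
    rcases Nat.mod_two_eq_zero_or_one m with h | h
    · rw [show (m + 1) / 2 = m / 2 by omega]
      simp [h]
    · rw [show (m + 1) / 2 = m / 2 + 1 by omega, ih]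
      simp [h]

/-- The set of positions of ones in the binary representation of `m`. -/
def bitSet (n m : ℕ) : Finset (Fin n) := Finset.univ.filter fun i => m.testBit i = true

theorem mem_bitSet {n m : ℕ} {i : Fin n} : i ∈ bitSet n m ↔ m.testBit i = true := by
  simp [bitSet]

theorem exists_bitSet_eq {n : ℕ} (S : Finset (Fin n)) : ∃ m < 2 ^ n, bitSet n m = S :=
  ⟨Nat.ofBits fun i => decide (i ∈ S), Nat.ofBits_lt_two_pow _, by ext i; simp [mem_bitSet]⟩

end MetricDim

namespace RAM

open MetricDim Tm

/-! ### Searching for a resolving set -/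

/-- Compute the square of the number of vertices, and the number of vertex sets. -/
def sizeSt : St :=
  .seq (assign 21 (.sum 30 (V 0))) (.seq (assign 22 (.const 1))
    (.loop 0 30 (assign 22 (.add (V 22) (V 22)))))

/-- Array `14` holds the pairs at distance at most `m`, array `15` the distances cut off at `m`;
increase `m` by one. -/
def roundSt : St :=
  .seq (.bulk 21 15 30 (.add (.rd 15 (V 30)) (notT (.rd 14 (V 30)))))
    (.bulk 21 14 30 (.sum 31 (.sum 32 (andT (eqT (.add (mulT 31) (V 32)) (V 30))
      (orT (.rd 14 (V 30)) (.sum 33 (andT (.rd 14 (.add (mulT 31) (V 33))) (adjT 33 32))))))))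

/-- Compute all distances. -/
def distSt : St :=
  .seq (.bulk 21 14 30 (.sum 31 (eqT (.add (mulT 31) (V 31)) (V 30))))
    (.seq (.bulk 21 15 30 (.const 0)) (.loop 0 35 roundSt))

/-- The set in array `16` is a small resolving set. -/
def checkT : Tm :=
  andT (leT (countT 32 (.rd 16 (V 32))) (V 1))
    (allT 32 (allT 33 (impT (notT (eqT (V 32) (V 33))) (.sum 34 (andT (.rd 16 (V 34))
      (notT (eqT (.rd 15 (.add (mulT 34) (V 32))) (.rd 15 (.add (mulT 34) (V 33))))))))))

/-- Check the set in array `16`, and move on to the next set. -/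
def nextSt : St :=
  .seq (assign 17 (.ite (orT (V 17) checkT) (.const 1) (.const 0)))
    (.bulk 0 16 30 (notT (iffT (.rd 16 (V 30)) (allT 33 (impT (ltT (V 33) (V 30))
      (.rd 16 (V 33)))))))

/-- Check all sets. -/
def searchSt : St :=
  .seq (.bulk 0 16 30 (.const 0)) (.seq (assign 17 (.const 0)) (.loop 22 36 nextSt))

theorem wf_sizeSt : sizeSt.wf [0] = true := by decide

theorem wf_distSt : distSt.wf [0, 21] = true := by decide

theorem wf_searchSt : searchSt.wf [0, 22] = true := by decide

theorem St.bulk_eval_of_lt {σ : Memory} {b a v i : ℕ} {e : Tm} (h : i < σ b 0) :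
    (St.bulk b a v e).eval σ a i = e.eval (σ.set v i) := by
  rw [St.eval, Function.update_self, if_pos h]

theorem St.bulk_eval_of_ne {σ : Memory} {b a v x : ℕ} {e : Tm} (h : x ≠ a) :
    (St.bulk b a v e).eval σ x = σ x := by
  rw [St.eval, Function.update_of_ne h]

theorem eval_sizeSt (σ : Memory) :
    let τ := sizeSt.eval σ
    (∀ a < 4, τ a = σ a) ∧ τ 21 0 = σ 0 0 * σ 0 0 ∧ τ 22 0 = 2 ^ σ 0 0 := by
  set ρ := (σ.set 21 ((sum 30 (V 0)).eval σ)).set 22 1 with hρ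
  have h21 : ρ 21 0 = σ 0 0 * σ 0 0 := by simp [hρ, Tm.eval]
  have key : ∀ m, let τ := iter (assign 22 (.add (V 22) (V 22))).eval 30 ρ m
      (∀ a, a ≠ 22 → a ≠ 30 → τ a = ρ a) ∧ τ 22 0 = 2 ^ m := by
    intro m
    induction m with
    | zero => exact ⟨fun _ _ _ => rfl, by simp [iter, hρ]⟩
    | succ m ih =>
      simp only [iter, eval_assign] at ih ⊢
      obtain ⟨ih1, ih2⟩ := ih
      refine ⟨fun a h22 h30 => ?_, ?_⟩
      · rw [Memory.set_of_ne _ _ h22, Memory.set_of_ne _ _ h30, ih1 a h22 h30]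
      · simp only [Memory.set_self, eval_add, eval_V]
        rw [Memory.set_of_ne _ _ (by omega), ih2]
        ring
  have hρa : ∀ a < 4, ρ a = σ a := fun a ha => by
    rw [hρ, Memory.set_of_ne _ _ (by omega), Memory.set_of_ne _ _ (by omega)]
  intro τ
  have hτ : τ = iter (assign 22 (.add (V 22) (V 22))).eval 30 ρ (σ 0 0) := by
    show sizeSt.eval σ = _
    rw [sizeSt, eval_seq, eval_seq, eval_assign, eval_assign, eval_const, ← hρ, St.eval,
      hρa 0 (by omega)]
  obtain ⟨k1, k2⟩ := key (σ 0 0)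
  rw [hτ]
  refine ⟨fun a ha => ?_, ?_, k2⟩
  · rw [k1 a (by omega) (by omega), hρa a ha]
  · rw [k1 21 (by omega) (by omega), h21]

section

variable {σ : Memory} {n : ℕ} {G : SimpleGraph (Fin n)}

open Classical in
theorem eval_roundSt (h0 : σ 0 0 = n) (h21 : σ 21 0 = n * n)
    (hadj : ∀ a b : Fin n, σ 2 (a * n + b) ≠ 0 ↔ G.Adj a b) {m : ℕ}
    (h14 : ∀ a b : Fin n, σ 14 (a * n + b) ≠ 0 ↔ G.edist a b ≤ m) :
    let τ := roundSt.eval σ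
    (∀ a, a ≠ 14 → a ≠ 15 → τ a = σ a) ∧
    (∀ a b : Fin n, τ 14 (a * n + b) ≠ 0 ↔ G.edist a b ≤ (m + 1 : ℕ)) ∧
    ∀ a b : Fin n, τ 15 (a * n + b) =
      σ 15 (a * n + b) + if (m : ℕ∞) < G.edist a b then 1 else 0 := by
  obtain ⟨ρ, hρ⟩ : ∃ ρ, ρ = (St.bulk 21 15 30 (.add (.rd 15 (V 30)) (notT (.rd 14 (V 30))))).eval σ :=
    ⟨_, rfl⟩
  have hρa : ∀ a, a ≠ 15 → ρ a = σ a := fun a ha => by rw [hρ, St.bulk_eval_of_ne ha]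
  rw [roundSt, eval_seq, ← hρ]
  refine ⟨fun a h14 h15 => by rw [St.bulk_eval_of_ne h14, hρa a h15], fun a b => ?_, fun a b => ?_⟩
  · rw [St.bulk_eval_of_lt (by rw [hρa 21 (by omega), h21]; exact mul_add_lt a b)]
    change Holds _ _ ↔ _
    have hadj' : ∀ i j, adjOf ρ i j ↔ ∃ c d : Fin n, i = c ∧ j = d ∧ G.Adj c d := by
      intro i j
      simp only [adjOf, hρa 0 (by omega), hρa 2 (by omega), h0]
      constructor
      · rintro ⟨hi, hj, h⟩
        exact ⟨⟨i, hi⟩, ⟨j, hj⟩, rfl, rfl, (hadj _ _).1 h⟩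
      · rintro ⟨c, d, rfl, rfl, h⟩
        exact ⟨c.isLt, d.isLt, (hadj _ _).2 h⟩
    have hrd : ∀ e μ, (rd 14 e).Holds μ ↔ μ 14 (e.eval μ) ≠ 0 := fun _ _ => Iff.rfl
    simp only [holds_sum, holds_and, holds_or, holds_eq, hrd, eval_add, eval_V, holds_adj,
      eval_mulT, Memory.set_self, Memory.set_of_ne, adjOf_set, hadj', ne_eq,
      not_false_eq_true, hρa, h0, Nat.reduceEqDiff, OfNat.zero_ne_ofNat]
    rw [edist_le_succ_iff]
    constructor
    · rintro ⟨i, hi, j, hj, hij, h⟩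
      obtain ⟨rfl, rfl⟩ := (mul_add_inj hj b.isLt).1 hij
      rcases h with h | ⟨w, hw, hw', c, d, rfl, hd, hcd⟩
      · exact Or.inl ((h14 a b).1 h)
      · obtain rfl := Fin.ext hd
        exact Or.inr ⟨c, (h14 a c).1 hw', hcd⟩
    · intro h
      refine ⟨a, a.isLt, b, b.isLt, rfl, ?_⟩
      rcases h with h | ⟨w, hw, hw'⟩
      · exact Or.inl ((h14 a b).2 h)
      · exact Or.inr ⟨w, w.isLt, (h14 a w).2 hw, w, b, rfl, rfl, hw'⟩
  · rw [St.bulk_eval_of_ne (by omega), hρ, St.bulk_eval_of_lt (by rw [h21]; exact mul_add_lt a b)]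
    simp only [eval_add, eval_rd, eval_V, notT, eval_sub, eval_const, Memory.set_self]
    rw [Memory.set_of_ne _ _ (by omega), Memory.set_of_ne _ _ (by omega)]
    have := h14 a b
    rw [← not_lt] at this
    split_ifs with h
    · have : σ 14 (a * n + b) = 0 := by tauto
      omega
    · have : σ 14 (a * n + b) ≠ 0 := by tauto
      omega

theorem eval_distSt (h0 : σ 0 0 = n) (h21 : σ 21 0 = n * n)
    (hadj : ∀ a b : Fin n, σ 2 (a * n + b) ≠ 0 ↔ G.Adj a b) :
    let τ := distSt.eval σ
    (∀ a, a ≠ 14 → a ≠ 15 → a ≠ 35 → τ a = σ a) ∧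
    ∀ a b : Fin n, τ 15 (a * n + b) = countBelow n fun m => (m : ℕ∞) < G.edist a b := by
  classical
  obtain ⟨ρ, hρ⟩ : ∃ ρ, ρ = (St.bulk 21 15 30 (.const 0)).eval
    ((St.bulk 21 14 30 (.sum 31 (eqT (.add (mulT 31) (V 31)) (V 30)))).eval σ) := ⟨_, rfl⟩
  have hρa : ∀ a, a ≠ 14 → a ≠ 15 → ρ a = σ a := fun a h14 h15 => by
    rw [hρ, St.bulk_eval_of_ne h15, St.bulk_eval_of_ne h14]
  have h15 : ∀ a b : Fin n, ρ 15 (a * n + b) = 0 := fun a b => by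
    rw [hρ, St.bulk_eval_of_lt, eval_const]
    rw [St.bulk_eval_of_ne (by omega), h21]
    exact mul_add_lt a b
  have h14 : ∀ a b : Fin n, ρ 14 (a * n + b) ≠ 0 ↔ G.edist a b ≤ (0 : ℕ) := fun a b => by
    rw [hρ, St.bulk_eval_of_ne (by omega), St.bulk_eval_of_lt (by rw [h21]; exact mul_add_lt a b)]
    change Holds _ _ ↔ _
    simp only [holds_sum, holds_eq, eval_add, eval_V, eval_mulT, ne_eq,
      not_false_eq_true, Memory.set_self, Memory.set_of_ne, h0, Nat.reduceEqDiff,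
      OfNat.zero_ne_ofNat]
    rw [Nat.cast_zero, nonpos_iff_eq_zero, SimpleGraph.edist_eq_zero_iff]
    constructor
    · rintro ⟨i, hi, h⟩
      obtain ⟨rfl, h'⟩ := (mul_add_inj hi b.isLt).1 h
      exact Fin.ext h'
    · rintro rfl
      exact ⟨a, a.isLt, rfl⟩
  -- After $m$ rounds array 15 holds the minimum of $m$ and the distance; $n$ rounds determine every
  -- distance, since a finite one is below $n$.
  have key : ∀ m, let τ := iter roundSt.eval 35 ρ m
      (∀ a, a ≠ 14 → a ≠ 15 → a ≠ 35 → τ a = σ a) ∧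
      (∀ a b : Fin n, τ 14 (a * n + b) ≠ 0 ↔ G.edist a b ≤ m) ∧
      ∀ a b : Fin n, τ 15 (a * n + b) = countBelow m fun m => (m : ℕ∞) < G.edist a b := by
    intro m
    induction m with
    | zero => exact ⟨fun a h _ _ => hρa a h ‹_›, h14, fun a b => (h15 a b).trans (by simp [countBelow])⟩
    | succ m ih =>
      simp only [iter] at ih ⊢
      obtain ⟨ih1, ih2, ih3⟩ := ih
      set τ := (iter roundSt.eval 35 ρ m).set 35 m with hτ
      have hτa : ∀ a, a ≠ 35 → τ a = iter roundSt.eval 35 ρ m a := fun a ha =>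
        Memory.set_of_ne _ _ ha
      have hs : ∀ a, a ≠ 14 → a ≠ 15 → a ≠ 35 → τ a = σ a := fun a h14 h15 h35 => by
        rw [hτa a h35, ih1 a h14 h15 h35]
      obtain ⟨r1, r2, r3⟩ := eval_roundSt (σ := τ) (G := G) (m := m)
        (by rw [hs 0 (by omega) (by omega) (by omega), h0])
        (by rw [hs 21 (by omega) (by omega) (by omega), h21])
        (fun a b => by rw [hs 2 (by omega) (by omega) (by omega), hadj])
        (fun a b => by rw [hτa 14 (by omega), ih2])
      refine ⟨fun a h14 h15 h35 => by rw [r1 a h14 h15, hs a h14 h15 h35], r2, fun a b => ?_⟩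
      rw [r3, hτa 15 (by omega), ih3, countBelow_succ]
  intro τ
  have hτ : τ = iter roundSt.eval 35 ρ n := by
    show distSt.eval σ = _
    rw [distSt, eval_seq, eval_seq, ← hρ, St.eval, hρa 0 (by omega) (by omega), h0]
  rw [hτ]
  exact ⟨(key n).1, (key n).2.2⟩

/-- The sets of size at most `k` that resolve `G`. -/
def IsSolution (G : SimpleGraph (Fin n)) (k : ℕ) (S : Finset (Fin n)) : Prop :=
  S.card ≤ k ∧ IsResolving G S

theorem holds_checkT {m : ℕ} (h0 : σ 0 0 = n)
    (h15 : ∀ a b : Fin n, σ 15 (a * n + b) = countBelow n fun m => (m : ℕ∞) < G.edist a b)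
    (h16 : ∀ a : Fin n, σ 16 a ≠ 0 ↔ m.testBit a = true) :
    checkT.Holds σ ↔ IsSolution G (σ 1 0) (bitSet n m) := by
  have hrd : ∀ a e μ, (rd a e).Holds μ ↔ μ a (e.eval μ) ≠ 0 := fun _ _ _ => Iff.rfl
  have hcard : (countBelow n fun i => σ 16 i ≠ 0) = (bitSet n m).card := by
    rw [← Finset.card_map Fin.valEmbedding]
    refine countBelow_eq_card _ fun i => ?_
    simp only [Finset.mem_map, mem_bitSet, Fin.valEmbedding_apply]
    constructor
    · rintro ⟨a, ha, rfl⟩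
      exact ⟨a.isLt, (h16 a).2 ha⟩
    · rintro ⟨hi, h⟩
      exact ⟨⟨i, hi⟩, (h16 ⟨i, hi⟩).1 h, rfl⟩
  simp only [checkT, holds_and, holds_le, eval_count, holds_all, holds_imp, holds_not, holds_eq,
    holds_sum, hrd, eval_add, eval_V, eval_mulT, eval_rd, ne_eq,
    not_false_eq_true, Memory.set_self, Memory.set_of_ne, h0, Nat.reduceEqDiff,
    OfNat.zero_ne_ofNat]
  simp only [ne_eq] at hcard
  rw [hcard, IsSolution]
  refine and_congr_right fun _ => ?_
  constructor
  · intro h u v huv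
    obtain ⟨w, hw, hw', hne⟩ := h u u.isLt v v.isLt fun h => huv (Fin.ext h)
    lift w to Fin n using hw
    refine ⟨w, mem_bitSet.2 ((h16 w).1 hw'), fun heq => hne ?_⟩
    rw [h15, h15, heq]
  · intro h u hu v hv huv
    lift u to Fin n using hu
    lift v to Fin n using hv
    obtain ⟨w, hw, hne⟩ := h u v fun h => huv (congrArg Fin.val h)
    refine ⟨w, w.isLt, (h16 w).2 (mem_bitSet.1 hw), ?_⟩
    rwa [h15, h15, countBelow_lt_inj (edist_eq_top_or_lt G w u) (edist_eq_top_or_lt G w v)]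

theorem eval_searchSt (h0 : σ 0 0 = n) (h22 : σ 22 0 = 2 ^ n)
    (h15 : ∀ a b : Fin n, σ 15 (a * n + b) = countBelow n fun m => (m : ℕ∞) < G.edist a b) :
    searchSt.eval σ 17 0 =
      open Classical in if HasResolvingSet G (σ 1 0 : ℤ) then 1 else 0 := by
  classical
  obtain ⟨ρ, hρ⟩ : ∃ ρ, ρ = ((St.bulk 0 16 30 (.const 0)).eval σ).set 17 0 := ⟨_, rfl⟩
  have hρa : ∀ a, a ≠ 16 → a ≠ 17 → ρ a = σ a := fun a h16 h17 => by
    rw [hρ, Memory.set_of_ne _ _ h17, St.bulk_eval_of_ne h16]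
  -- After $m$ rounds array 16 holds the binary digits of $m$, and array 17 records whether one of
  -- the first $m$ sets is a solution.
  have key : ∀ m, let τ := iter nextSt.eval 36 ρ m
      (∀ a < 16, τ a = σ a) ∧ (∀ a : Fin n, τ 16 a ≠ 0 ↔ m.testBit a = true) ∧
      τ 17 0 = if ∃ j < m, IsSolution G (σ 1 0) (bitSet n j) then 1 else 0 := by
    intro m
    induction m with
    | zero =>
      refine ⟨fun a ha => hρa a (by omega) (by omega), fun a => ?_, ?_⟩
      · simp only [iter]
        rw [hρ, Memory.set_of_ne _ _ (by omega), St.bulk_eval_of_lt (by rw [h0]; exact a.isLt)]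
        simp
      · simp [iter, hρ]
    | succ m ih =>
      simp only [iter] at ih ⊢
      obtain ⟨ih1, ih2, ih3⟩ := ih
      set τ := (iter nextSt.eval 36 ρ m).set 36 m with hτ
      have hτa : ∀ a, a ≠ 36 → τ a = iter nextSt.eval 36 ρ m a := fun a ha =>
        Memory.set_of_ne _ _ ha
      have hs : ∀ a < 16, τ a = σ a := fun a ha => by rw [hτa a (by omega), ih1 a ha]
      have hcheck : checkT.Holds τ ↔ IsSolution G (σ 1 0) (bitSet n m) := by
        rw [← hs 1 (by omega)]
        exact holds_checkT (by rw [hs 0 (by omega), h0])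
          (fun a b => by rw [hs 15 (by omega), h15]) fun a => by rw [hτa 16 (by omega), ih2]
      have h17 : (ite (orT (V 17) checkT) (const 1) (const 0)).eval τ =
          if ∃ j < m + 1, IsSolution G (σ 1 0) (bitSet n j) then 1 else 0 := by
        rw [eval_ite, eval_const, eval_const]
        refine if_congr ?_ rfl rfl
        rw [holds_or, hcheck, Holds, eval_V, hτa 17 (by omega), ih3]
        constructor
        · rintro (h | h)
          · split_ifs at h with h'
            · obtain ⟨j, hj, h'⟩ := h'
              exact ⟨j, by omega, h'⟩
            · exact absurd rfl h
          · exact ⟨m, by omega, h⟩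
        · rintro ⟨j, hj, h⟩
          rcases Nat.lt_succ_iff_lt_or_eq.1 hj with hj | rfl
          · left
            rw [if_pos ⟨j, hj, h⟩]
            exact one_ne_zero
          · exact Or.inr h
      rw [nextSt, eval_seq, eval_assign, h17]
      set x := if ∃ j < m + 1, IsSolution G (σ 1 0) (bitSet n j) then 1 else 0
      refine ⟨fun a ha => ?_, fun a => ?_, ?_⟩
      · rw [St.bulk_eval_of_ne (by omega), Memory.set_of_ne _ _ (by omega), hs a ha]
      · have h0' : (τ.set 17 x) 0 0 = n := by
          rw [Memory.set_of_ne _ _ (by omega), hs 0 (by omega), h0]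
        rw [St.bulk_eval_of_lt (by rw [h0']; exact a.isLt), testBit_add_one]
        change Holds _ _ ↔ _
        have hrd : ∀ e μ, (rd 16 e).Holds μ ↔ μ 16 (e.eval μ) ≠ 0 := fun _ _ => Iff.rfl
        have h16 : ∀ a : Fin n, τ 16 a ≠ 0 ↔ m.testBit a = true := fun a => by
          rw [hτa 16 (by omega), ih2]
        rw [holds_not, holds_iff, hrd, eval_V, Memory.set_self, Memory.set_of_ne _ _ (by omega),
          Memory.set_of_ne _ _ (by omega), h16]
        refine not_congr (iff_congr Iff.rfl ?_)
        simp only [holds_all, holds_imp, holds_lt, hrd, eval_V, Memory.set_self]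
        rw [Memory.set_of_ne _ _ (by omega), h0']
        constructor
        · intro h j hj
          have hjn : j < n := hj.trans a.isLt
          rw [← h16 ⟨j, hjn⟩]
          simpa using h j hjn (by simpa using hj)
        · intro h j hjn hj
          have := (h16 ⟨j, hjn⟩).2 (h j (by simpa using hj))
          simpa using this
      · rw [St.bulk_eval_of_ne (by omega), Memory.set_self]
  have hev : searchSt.eval σ = iter nextSt.eval 36 ρ (2 ^ n) := by
    rw [searchSt, eval_seq, eval_seq, eval_assign, eval_const, ← hρ, St.eval,
      hρa 22 (by omega) (by omega), h22]
  rw [hev, (key _).2.2]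
  refine if_congr ?_ rfl rfl
  constructor
  · rintro ⟨j, -, hc, hr⟩
    exact ⟨_, hr, by exact_mod_cast hc⟩
  · rintro ⟨S, hr, hc⟩
    obtain ⟨j, hj, rfl⟩ := exists_bitSet_eq S
    exact ⟨j, hj, by exact_mod_cast hc, hr⟩

end

end RAM

/-! ### The decision program: exhaustive search, then modulator, kernel and search -/

namespace RAM

open MetricDim

/-- The program that decides an instance by checking all vertex sets. -/
def searchProg : Prog :=
  .seq (sizeSt.compile 64) (.seq (distSt.compile 64)
    (.seq (searchSt.compile 64) (setReg 0 (reg 17))))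

open Classical in
theorem exists_run_searchProg : ∃ K d : ℕ, ∀ (I : Instance) (X : Finset (Fin I.n)) (σ : Memory),
    Contains σ I X → ∃ (τ : Memory) (t : ℕ), Run searchProg σ τ t ∧
      t ≤ K * (4 ^ I.n + 1) ^ d ∧ τ 0 0 = if I.IsYes then 1 else 0 := by
  obtain ⟨K, d, hKd⟩ := ((sizeSt.polyBounded_cost.add distSt.polyBounded_cost).add
    searchSt.polyBounded_cost).add (.const 4)
  refine ⟨K, d, fun I X σ ⟨h0, h1, h2, _⟩ => ?_⟩
  have hadj : ∀ a b : Fin I.n, σ 2 (a * I.n + b) ≠ 0 ↔ I.graph.Adj a b := fun a b => by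
    rw [h2]
    split_ifs with h <;> simp [h]
  -- One bound for all loops, which run to $n$, $n^2$ or $2^n$.
  set N := 4 ^ I.n with hN
  have hlt : I.n < 2 ^ I.n := Nat.lt_two_pow_self
  have hpow : N = 2 ^ I.n * 2 ^ I.n := by rw [hN, ← mul_pow]; norm_num
  have hN1 : I.n ≤ N := by nlinarith
  have hN2 : I.n * I.n ≤ N := by rw [hpow]; exact Nat.mul_le_mul hlt.le hlt.le
  have hN3 : 2 ^ I.n ≤ N := by nlinarith
  obtain ⟨s1, s2, s3⟩ := eval_sizeSt σ
  rw [h0] at s2 s3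
  have hs : ∀ a b : Fin I.n, sizeSt.eval σ 2 (a * I.n + b) ≠ 0 ↔ I.graph.Adj a b := fun a b => by
    rw [s1 2 (by omega), hadj]
  have hs0 : sizeSt.eval σ 0 0 = I.n := by rw [s1 0 (by omega), h0]
  obtain ⟨d1, d2⟩ := eval_distSt hs0 s2 hs
  have hd0 : distSt.eval (sizeSt.eval σ) 0 0 = I.n := by
    rw [d1 0 (by omega) (by omega) (by omega), hs0]
  have hd22 : distSt.eval (sizeSt.eval σ) 22 0 = 2 ^ I.n := by
    rw [d1 22 (by omega) (by omega) (by omega), s3]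
  have hsearch := eval_searchSt hd0 hd22 d2
  rw [d1 1 (by omega) (by omega) (by omega), s1 1 (by omega), h1] at hsearch
  obtain ⟨τ₁, t₁, r₁, ht₁, e₁, -⟩ := St.run (N := N) (by simp) sizeSt wf_sizeSt 64 le_rfl σ σ
    (fun _ _ => rfl) (by simpa [h0] using hN1)
  obtain ⟨τ₂, t₂, r₂, ht₂, e₂, -⟩ := St.run (N := N) (by simp) distSt wf_distSt 64 le_rfl
    (sizeSt.eval σ) τ₁ e₁ (by simpa [hs0, s2] using ⟨hN1, hN2⟩)
  obtain ⟨τ₃, t₃, r₃, ht₃, e₃, -⟩ := St.run (N := N) (by simp) searchSt wf_searchSt 64 le_rfl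
    (distSt.eval (sizeSt.eval σ)) τ₂ e₂ (by simpa [hd0, hd22] using ⟨hN1, hN3⟩)
  refine ⟨_, _, Run.seq r₁ (Run.seq r₂ (Run.seq r₃ (run_setReg τ₃ 0 (reg 17)))), ?_, ?_⟩
  · refine le_trans ?_ (hKd N)
    rw [show (reg 17).cost + 2 = 4 from rfl]
    simp only
    omega
  · rw [Memory.set_self, eval_reg, e₃ 17 (by omega), hsearch]
    rfl

/-- The program that decides an instance by computing a modulator, the kernel, and its answer. -/
def decideProg : Prog := .seq (modulatorSt.compile 64) (.seq kernelProg searchProg)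

open Classical in
theorem exists_run_decideProg : ∃ K L c d : ℕ, ∀ I : Instance, ∃ (τ : Memory) (t : ℕ),
    Run decideProg (encode I ∅) τ t ∧
      t ≤ (K + L * (4 ^ kernelBound (3 * distToCluster I.graph) + 1) ^ d) * I.size ^ c ∧
      τ 0 0 = if I.IsYes then 1 else 0 := by
  obtain ⟨K₁, d₁, h₁⟩ := modulatorSt.polyBounded_cost
  obtain ⟨K₂, d₂, h₂⟩ := exists_run_kernelProg
  obtain ⟨K₃, d₃, h₃⟩ := exists_run_searchProg
  refine ⟨K₁ + K₂, K₃, d₁ + d₂, d₃, fun I => ?_⟩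
  set σ := encode I ∅ with hσ
  have h0 : σ 0 0 = I.n := by simp [hσ, encode]
  have h1 : σ 1 0 = I.k := by simp [hσ, encode]
  obtain ⟨m1, X, m2, m3, m4⟩ := eval_modulatorSt h0 (encode_adj I ∅)
    fun a => not_not.1 fun h => absurd ((encode_mark I ∅ a).1 h) (Finset.notMem_empty a)
  obtain ⟨τ₁, t₁, r₁, ht₁, e₁, -⟩ := St.run (N := I.n) (by simp) modulatorSt wf_modulatorSt 64
    le_rfl σ σ (fun _ _ => rfl) (by simp [h0])
  have e₁' : ∀ a < 3, τ₁ a = σ a := fun a ha => by rw [e₁ a (by omega), m1 a ha]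
  obtain ⟨τ₂, t₂, I', X', r₂, ht₂, hcont, hker⟩ := h₂ I X τ₁ m3 (by rw [e₁' 0 (by omega), h0])
    (by rw [e₁' 1 (by omega), h1]) (fun a b => by rw [e₁' 2 (by omega)]; exact encode_adj I ∅ a b)
    (fun a => by rw [e₁ 3 (by omega)]; exact m2 a)
  obtain ⟨τ₃, t₃, r₃, ht₃, hans⟩ := h₃ I' X' τ₂ hcont
  obtain ⟨hyes, -, -, hn, -⟩ := hker
  refine ⟨τ₃, _, Run.seq r₁ (Run.seq r₂ r₃), ?_, by simp only [hans, hyes]⟩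
  have hsize := I.lt_size
  have hpow : ∀ e ≤ d₁ + d₂, (I.n + 1) ^ e ≤ I.size ^ (d₁ + d₂) := fun e he =>
    (Nat.pow_le_pow_left hsize e).trans (Nat.pow_le_pow_right (by omega) he)
  have b₁ : t₁ ≤ K₁ * I.size ^ (d₁ + d₂) :=
    (ht₁.trans (h₁ I.n)).trans (Nat.mul_le_mul_left _ (hpow d₁ (by omega)))
  have b₂ : t₂ ≤ K₂ * I.size ^ (d₁ + d₂) :=
    ht₂.trans (Nat.mul_le_mul_left _ (hpow d₂ (by omega)))
  -- The search is exponential only in the kernel size, and this is at most the kernel bound at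
  -- three times the distance to cluster.
  have b₃ : t₃ ≤ K₃ * (4 ^ kernelBound (3 * distToCluster I.graph) + 1) ^ d₃ *
      I.size ^ (d₁ + d₂) := by
    refine (ht₃.trans (Nat.mul_le_mul_left _ (Nat.pow_le_pow_left (Nat.add_le_add_right
      (Nat.pow_le_pow_right (by omega) (hn.trans (kernelBound_mono m4))) 1) d₃))).trans ?_
    exact Nat.le_mul_of_pos_right _ (Nat.pow_pos (by omega))
  rw [add_mul, add_mul]
  omega

end RAM

namespace MetricDim

/-! ### Fixed-parameter tractability -/

theorem primrec_pow : Primrec₂ ((· ^ ·) : ℕ → ℕ → ℕ) :=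
  Primrec₂.unpaired'.1 Nat.Primrec.pow

theorem primrec_kernelBound : Primrec kernelBound := by
  have two : ∀ {f : ℕ → ℕ}, Primrec f → Primrec fun x => 2 ^ f x := fun hf =>
    primrec_pow.comp (.const 2) hf
  have add : ∀ c, Primrec fun x : ℕ => x + c := fun c =>
    Primrec.nat_add.comp .id (.const c)
  exact Primrec.nat_add.comp (Primrec.nat_mul.comp (Primrec.nat_mul.comp (two (two (add 1)))
    (Primrec.nat_add.comp (Primrec.nat_add.comp (two (add 2)) .id) (.const 1))) (two (add 1))) .id

theorem computable_bound (K L d : ℕ) :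
    Computable fun x => K + L * (4 ^ kernelBound (3 * x) + 1) ^ d :=
  Primrec.to_comp <| Primrec.nat_add.comp (.const K) <| Primrec.nat_mul.comp (.const L) <|
    primrec_pow.comp (Primrec.nat_add.comp (primrec_pow.comp (.const 4)
      (primrec_kernelBound.comp (Primrec.nat_mul.comp (.const 3) .id))) (.const 1)) (.const d)

/-- Metric Dimension is fixed-parameter tractable for every parameter that is at least the distance
to cluster. -/
theorem isFPT_of_distToCluster_le {κ : Instance → ℕ} (h : ∀ I, distToCluster I.graph ≤ κ I) :
    IsFPT κ := by
  obtain ⟨K, L, c, d, hrun⟩ := RAM.exists_run_decideProg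
  refine ⟨RAM.decideProg, _, c, computable_bound K L d, fun I => ?_⟩
  obtain ⟨τ, t, hr, ht, hans⟩ := hrun I
  refine ⟨τ, t, hr, ht.trans ?_, hans⟩
  have := kernelBound_mono (Nat.mul_le_mul_left 3 (h I))
  gcongr
  norm_num

end MetricDim

theorem mainTheorem2 :
    -- the twin rule is safe
    (∀ (V : Type*) [Fintype V] (G : SimpleGraph V) (k : ℤ) (u : V),
      MetricDim.TwinRule G u →
        (MetricDim.HasResolvingSet G k ↔
          MetricDim.HasResolvingSet (G.induce ({u}ᶜ : Set V)) (k - 1))) ∧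
    -- the clique rule is safe
    (∀ (V : Type*) [Fintype V] (G : SimpleGraph V) (k : ℤ) (X C : Finset V),
      MetricDim.IsClusterModulator G X →
      MetricDim.CliqueRule G X C →
        (MetricDim.HasResolvingSet G k ↔
          MetricDim.HasResolvingSet (G.induce ((C : Set V)ᶜ))
            (k - max 1 (MetricDim.twinPairs G C : ℤ)))) ∧
    -- a graph to which neither rule applies is small
    (∀ (V : Type*) [Fintype V] (G : SimpleGraph V) (X : Finset V),
      MetricDim.IsClusterModulator G X →
      MetricDim.IsReduced G X →
        Fintype.card V ≤
          2 ^ 2 ^ (X.card + 1) * (2 ^ (X.card + 2) + X.card + 1) * 2 ^ (X.card + 1) + X.card) ∧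
    -- the kernel
    MetricDim.HasKernel
      (fun x => 2 ^ 2 ^ (x + 1) * (2 ^ (x + 2) + x + 1) * 2 ^ (x + 1) + x) ∧
    -- fixed-parameter tractability
    MetricDim.IsFPT (fun I => MetricDim.distToCluster I.graph) ∧
    MetricDim.IsFPT (fun I => MetricDim.distToClique I.graph) := by
  exact ⟨fun V _ G k u hu => MetricDim.twinRule_safe G k u hu,
    fun V _ G k X C hX hC => MetricDim.cliqueRule_safe G k X C hX hC,
    fun V _ G X hX hred => MetricDim.card_le_of_isReduced G X hX hred, MetricDim.hasKernel,
    MetricDim.isFPT_of_distToCluster_le fun _ => le_rfl,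
    MetricDim.isFPT_of_distToCluster_le fun I => MetricDim.distToCluster_le_distToClique I.graph⟩
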